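/- Let $C_1>0$ and $1<b<2$. For $\mathbf p,\mathbf q\in\mathbb R^3$ write $p=|\mathbf p|$, $q=|\mathbf q|$, $\varrho=\sqrt{2(pq-\mathbf p\cdot\mathbf q)}$, and for $\omega\in\mathbb S^2$ let $$\mathbf p'=\tfrac12(\mathbf p+\mathbf q)+\tfrac12\varrho\,\omega+\tfrac12\,\frac{(\mathbf p+\mathbf q)\cdot\omega}{p+q+\varrho}\,(\mathbf p+\mathbf q),$$ and let $\mathbf q'$ be given by the same formula with $\omega$ replaced by $-\omega$. For $\varepsilon\ge 0$ put $$Q_\varepsilon(f,f)(\mathbf p)=C_1\int_{\mathbb R^3}\int_{\mathbb S^2}\mathbf 1_{\{\varrho\ge\varepsilon\}}\frac{\varrho^{2-b}}{pq}\Big(f(\mathbf p')f(\mathbf q')-f(\mathbf p)f(\mathbf q)\Big)\,d\omega\,d^3q .$$ The equation $\partial_s f=Q_0(f,f)$ is the rescaled massless Boltzmann equation in the redefined time $s$ for the cross-section $\sigma(h,\Theta)=C_1h^{-b}$ in a spatially flat FLRW background; $s=0$ is the bang surface. A nonnegative solution of $\partial_s f=Q_\varepsilon(f,f)$ on an interval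 $I\ni 0$ with data $f_0$ means a function $f\in C^1(I;L^1(\mathbb R^3))$ with $f(0)=f_0$ such that for every $s\in I$ the function $f(s)$ is nonnegative and isotropic (it depends on $\mathbf p$ only through $p$), the gain and the loss part of the integral defining $Q_\varepsilon(f(s),f(s))(\mathbf p)$ converge for almost every $\mathbf p$, and $\partial_sf(s)=Q_\varepsilon(f(s),f(s))$ almost everywhere. Let $f_0\in L^1(\mathbb R^3)$ be nonnegative and isotropic with $\int_{\mathbb R^3}f_0\,p^m\,d^3p<\infty$ for all real $-2\le m\le 2$. Then there is $T>0$ such that: 1. the equation $\partial_sf=Q_0(f,f)$ has a unique nonnegative solution $f$ on $[0,T]$ with data $f_0$ at $s=0$; 2. there is a constant $C_T$ with $\displaystyle\sup_{0\le s\le T}\int_{\mathbb R^3}f(s,p)\,p^m\,d^3p\le C_T$ for all $-1\le m\le 2$; 3. for $k=1,2,\dots$ the cut-off equation $\partial_sf_k=Q_{1/k}(f_k,f_k)$ has a nonnegative solution $f_k$ on $[0,\infty)$ with data $f_0$, it is the only nonnegative solution on $[0,T]$, and $$\sup_{0\le s\le T}\int_{\mathbb R^3}|f_k(s,p)-f(s,p)|\Big(1+\frac1p\Big)d^3p\longrightarrow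 0\qquad(k\to\infty).$$ -/

import Mathlib

open MeasureTheory Set Filter Topology
open scoped ENNReal

namespace MasslessBoltzmann

noncomputable section

/-- Momentum space `ℝ³` with its Euclidean norm; the energy of a massless particle of
momentum `p` is `‖p‖`. -/
abbrev Mom : Type := EuclideanSpace ℝ (Fin 3)

/-- The unit sphere `S²` of scattering directions. -/
abbrev Dir : Type := Metric.sphere (0 : Mom) 1

/-- The space `L¹(ℝ³)` of integrable functions (up to almost everywhere equality). -/
abbrev L1 : Type := Lp ℝ 1 (volume : Measure Mom)

/-- The measure `d³q dω` on `ℝ³ × S²`; `volume.toSphere` is the surface measure of the sphere,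
of total mass `4π`. -/
def collisionMeasure : Measure (Mom × Dir) :=
  (volume : Measure Mom).prod (volume : Measure Mom).toSphere

/-- The rescaled relative momentum `ϱ = √(2(pq - 𝐩·𝐪))`. -/
def relMom (p q : Mom) : ℝ := Real.sqrt (2 * (‖p‖ * ‖q‖ - inner ℝ p q))

/-- The post-collisional momentum
`𝐩' = ½(𝐩+𝐪) + ½ϱω + ½((𝐩+𝐪)·ω)(𝐩+𝐪)/(p+q+ϱ)`, whose energy is `½(p+q) + ½(𝐩+𝐪)·ω`. -/
def outMom (p q ω : Mom) : Mom :=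
  (1 / 2 : ℝ) • (p + q) + (relMom p q / 2) • ω
    + (inner ℝ (p + q) ω / 2 / (‖p‖ + ‖q‖ + relMom p q)) • (p + q)

/-- The other post-collisional momentum `𝐪'`: the sign of `ω` is switched. -/
def outMom' (p q ω : Mom) : Mom := outMom p q (-ω)

/-- The collision kernel `ϱ^(2-b)/(pq)`, cut off to the region `ϱ ≥ ε`.
Since `ϱ ≥ 0`, the value `ε = 0` means that there is no cut-off. -/
def kernel (b ε : ℝ) (p q : Mom) : ℝ :=
  if ε ≤ relMom p q then relMom p q ^ (2 - b) / (‖p‖ * ‖q‖) else 0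

/-- The gain integrand `ϱ^(2-b)/(pq) f(p') f(q')` as a function of `(q, ω)`. -/
def gainIntegrand (b ε : ℝ) (f : Mom → ℝ) (p : Mom) (x : Mom × Dir) : ℝ :=
  kernel b ε p x.1 * (f (outMom p x.1 x.2) * f (outMom' p x.1 x.2))

/-- The loss integrand `ϱ^(2-b)/(pq) f(p) f(q)` as a function of `(q, ω)`. -/
def lossIntegrand (b ε : ℝ) (f : Mom → ℝ) (p : Mom) (x : Mom × Dir) : ℝ :=
  kernel b ε p x.1 * (f p * f x.1)

/-- The collision operator
`Q_ε(f,f)(p) = C₁ ∫_{ℝ³} ∫_{S²} 1_{ϱ ≥ ε} ϱ^(2-b)/(pq) (f(p')f(q') - f(p)f(q)) dω d³q`. -/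
def collisionOp (C₁ b ε : ℝ) (f : Mom → ℝ) (p : Mom) : ℝ :=
  C₁ * ∫ x, (gainIntegrand b ε f p x - lossIntegrand b ε f p x) ∂collisionMeasure

/-- `f` is isotropic: it depends on `𝐩` through `p = |𝐩|` only. -/
def IsIsotropic (f : L1) : Prop :=
  ∃ φ : ℝ → ℝ, Measurable φ ∧ ∀ᵐ p ∂(volume : Measure Mom), f p = φ ‖p‖

/-- `f` is a nonnegative isotropic solution in `C¹(I; L¹(ℝ³))` of `∂ₛ f = Q_ε(f,f)`, `f(0) = f₀`.
The gain and the loss part of the collision integral converge, so that `Q_ε(f,f)` is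
meaningful. With `ε = 0` this is the rescaled massless Boltzmann equation, with `ε > 0` it is
the equation with cut-off. -/
structure IsSolution (C₁ b ε : ℝ) (I : Set ℝ) (f₀ : L1) (f : ℝ → L1) : Prop where
  contDiffOn : ContDiffOn ℝ 1 f I
  initial : f 0 = f₀
  nonneg : ∀ s ∈ I, 0 ≤ f s
  isotropic : ∀ s ∈ I, IsIsotropic (f s)
  integrable_gain : ∀ s ∈ I, ∀ᵐ p ∂(volume : Measure Mom),
    Integrable (gainIntegrand b ε (f s) p) collisionMeasure
  integrable_loss : ∀ s ∈ I, ∀ᵐ p ∂(volume : Measure Mom),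
    Integrable (lossIntegrand b ε (f s) p) collisionMeasure
  equation : ∀ s ∈ I, ∀ᵐ p ∂(volume : Measure Mom),
    (derivWithin f I s : L1) p = collisionOp C₁ b ε (f s) p

/-- The distance of `f` and `g` in `L¹(ℝ³)` with weight `1 + 1/p` (possibly infinite). -/
def weightedDist (f g : L1) : ℝ≥0∞ :=
  ∫⁻ p : Mom, ENNReal.ofReal (|f p - g p| * (1 + 1 / ‖p‖))

end

end MasslessBoltzmann

/-! ### Centre-of-mass coordinates for a pair of massless particles -/

namespace MasslessBoltzmann

noncomputable section

/-! A pair of massless particles of total momentum `P` is described by the vector `x` whose half is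
the momentum in the centre-of-mass frame; its length is `ϱ`. In the coordinates `P`, `|x|`, `x/|x|`
the measure `d³p d³q/(pq)` has a density depending on `P` and `|x|` alone, and a collision only
replaces the direction `x/|x|` by `ω`. Hence `d³p d³q dω/(pq)` is invariant under collisions
(`lintegral_collision_swap`), and the gain term tested against a weight becomes an average of the
weight over `ω`. By Archimedes' theorem (`lintegral_sphere_inner`) the energy `p'` is uniformly
distributed on an interval, so these averages are one-dimensional integrals.

The decisive quantity is the moment of order `-2`. The average of `p'⁻²` is `4/ϱ² = 2/(pq(1 - cos
θ))`. Its part `1/(pq)` is at most the mean of `p⁻²` and `q⁻²` and is absorbed by the loss. The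
rest, multiplied by the kernel, is of size `(pq)^(-1-b/2) (1 - cos θ)^(-b/2)`; for isotropic `f` the
angle integrates out, which is possible because `b < 2` (`kernel_div_le`,
`exists_lintegral_gain_inv_sq_le`). The moment thus obeys `y' ≤ C y²` and at most doubles on a short
interval, uniformly in the cut-off (`exists_moment_bound`). This applies to every solution: isotropy
and convergence of the loss term already make the total collision rate finite, so that testing
against bounded regularized weights is legitimate. The moment of order `2` then satisfies a linear
inequality.

With this bound, two solutions are compared in `L¹` with weight `1 + 1/p`
(`exists_collisionOp_sub_le`). The one term that this weight cannot control is the loss `-Λ (f -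
g)`, which has the good sign and is dropped in an implicit Euler argument
(`lintegral_enorm_wt_le_of_dissipative`). A change of cut-off costs `ε^ζ` times a kernel with the
larger exponent `b + ζ < 2`. This yields uniqueness without moment assumptions on the competitor and
a Cauchy estimate for cut-off solutions.

With cut-off the kernel is bounded and the collision operator is a bounded quadratic map on `L¹`;
the Wild sum, a power series with nonnegative coefficients, solves the equation globally
(`exists_global_solution`). The cut-off solutions and their time derivatives converge uniformly on
the short interval, and the limit solves the full equation (`exists_isSolution_of_cutoff`). -/

/-- The total energy of two massless particles of total momentum `P` and relative momentum `r`. -/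
def totalEnergy (P : Mom) (r : ℝ) : ℝ := Real.sqrt (r ^ 2 + ‖P‖ ^ 2)

/-- The momentum of one of two massless particles of total momentum `P`, whose momentum in the
centre-of-mass frame is `x / 2`. -/
def boost (P x : Mom) : Mom :=
  (1 / 2 : ℝ) • (P + x + (inner ℝ P x / (‖x‖ * (totalEnergy P ‖x‖ + ‖x‖))) • P)

/-- The inverse of `boost`. -/
def unboost (P p : Mom) : Mom :=
  p - (P - p) - ((‖p‖ - ‖P - p‖) / (‖p‖ + ‖P - p‖ + relMom p (P - p))) • P

lemma totalEnergy_sq (P : Mom) (r : ℝ) : totalEnergy P r ^ 2 = r ^ 2 + ‖P‖ ^ 2 :=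
  Real.sq_sqrt (by positivity)

lemma norm_le_totalEnergy (P : Mom) (r : ℝ) : ‖P‖ ≤ totalEnergy P r :=
  Real.le_sqrt_of_sq_le (by nlinarith [sq_nonneg r])

lemma totalEnergy_pos (P : Mom) {r : ℝ} (hr : 0 < r) : 0 < totalEnergy P r :=
  Real.sqrt_pos.2 (by positivity)

lemma relMom_nonneg (p q : Mom) : 0 ≤ relMom p q := Real.sqrt_nonneg _

lemma relMom_sq (p q : Mom) : relMom p q ^ 2 = (‖p‖ + ‖q‖) ^ 2 - ‖p + q‖ ^ 2 := by
  rw [relMom, Real.sq_sqrt, norm_add_sq_real]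
  · ring
  · linarith [real_inner_le_norm p q]

lemma relMom_sq_le (p q : Mom) : relMom p q ^ 2 ≤ 4 * (‖p‖ * ‖q‖) := by
  rw [relMom, Real.sq_sqrt]
  · linarith [neg_le_of_abs_le (abs_real_inner_le_norm p q)]
  · linarith [real_inner_le_norm p q]

lemma boost_neg (P x : Mom) : boost P (-x) = P - boost P x := by
  simp only [boost, norm_neg, inner_neg_right, neg_div, neg_smul]
  module

lemma abs_inner_div_norm_le (P x : Mom) : |inner ℝ P x / ‖x‖| ≤ ‖P‖ := by
  rw [abs_div, abs_norm]
  exact div_le_of_le_mul₀ (norm_nonneg _) (norm_nonneg _) (abs_real_inner_le_norm P x)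

/-- Since `‖P‖² = (E + r)(E - r)`, the squared length of the boosted vector is a perfect square. The
energy is linear in the component of `P` along `x`. -/
lemma norm_boost (P : Mom) {x : Mom} (hx : x ≠ 0) :
    ‖boost P x‖ = (totalEnergy P ‖x‖ + inner ℝ P x / ‖x‖) / 2 := by
  have hr : 0 < ‖x‖ := norm_pos_iff.2 hx
  have hE := totalEnergy_pos P hr
  have hE2 := totalEnergy_sq P ‖x‖
  have h1 := norm_le_totalEnergy P ‖x‖
  have h2 := abs_le.1 (abs_inner_div_norm_le P x)
  have h3 : 0 ≤ (totalEnergy P ‖x‖ + inner ℝ P x / ‖x‖) / 2 := by linarith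
  rw [← sq_eq_sq₀ (norm_nonneg _) h3, boost, norm_smul, mul_pow, norm_add_sq_real,
    norm_add_sq_real, norm_smul, inner_smul_right, inner_add_left, real_inner_self_eq_norm_sq,
    real_inner_comm P x]
  have hP : ‖P‖ ^ 2 = (totalEnergy P ‖x‖ + ‖x‖) * (totalEnergy P ‖x‖ - ‖x‖) := by
    linarith
  simp only [mul_pow, hP, norm_div, norm_mul, Real.norm_eq_abs, div_pow, sq_abs]
  generalize totalEnergy P ‖x‖ = E at *
  generalize ‖x‖ = r at *
  generalize (inner ℝ P x : ℝ) = c at *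
  have : (0 : ℝ) < E + r := by positivity
  field_simp
  ring

lemma norm_boost_neg (P : Mom) {x : Mom} (hx : x ≠ 0) :
    ‖boost P (-x)‖ = (totalEnergy P ‖x‖ - inner ℝ P x / ‖x‖) / 2 := by
  rw [norm_boost P (neg_ne_zero.2 hx), norm_neg, inner_neg_right]
  ring

/-- `ϱ` is the Lorentz-invariant mass: its square is the squared total energy minus `‖P‖²`. -/
lemma relMom_boost (P : Mom) {x : Mom} (hx : x ≠ 0) :
    relMom (boost P x) (boost P (-x)) = ‖x‖ := by
  have h := relMom_sq (boost P x) (boost P (-x))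
  rw [norm_boost P hx, norm_boost_neg P hx, boost_neg, add_sub_cancel] at h
  rw [← sq_eq_sq₀ (relMom_nonneg _ _) (norm_nonneg _), boost_neg, h]
  linarith [totalEnergy_sq P ‖x‖]

lemma unboost_boost (P : Mom) {x : Mom} (hx : x ≠ 0) : unboost P (boost P x) = x := by
  have hr : 0 < ‖x‖ := norm_pos_iff.2 hx
  have hE := totalEnergy_pos P hr
  rw [unboost, ← boost_neg, relMom_boost P hx, norm_boost P hx, norm_boost_neg P hx, boost_neg]
  have : (totalEnergy P ‖x‖ + inner ℝ P x / ‖x‖) / 2 - (totalEnergy P ‖x‖ - inner ℝ P x / ‖x‖) / 2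
    = inner ℝ P x / ‖x‖ := by ring
  rw [this]
  have : (totalEnergy P ‖x‖ + inner ℝ P x / ‖x‖) / 2 + (totalEnergy P ‖x‖ - inner ℝ P x / ‖x‖) / 2
    + ‖x‖ = totalEnergy P ‖x‖ + ‖x‖ := by ring
  rw [this, div_div, boost]
  module

lemma relMom_pos_ne {p q : Mom} (h : 0 < relMom p q) : p ≠ 0 ∧ q ≠ 0 := by
  constructor <;> rintro rfl <;> simp [relMom] at h

lemma inner_add_sub (p q : Mom) : inner ℝ (p + q) (p - q) = ‖p‖ ^ 2 - ‖q‖ ^ 2 := by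
  rw [inner_add_left, inner_sub_right, inner_sub_right, real_inner_self_eq_norm_sq,
    real_inner_self_eq_norm_sq, real_inner_comm p q]
  ring

lemma boost_unboost {P p : Mom} (h : 0 < relMom p (P - p)) :
    unboost P p ≠ 0 ∧ boost P (unboost P p) = p := by
  obtain ⟨q, rfl⟩ : ∃ q, P = p + q := ⟨P - p, by simp⟩
  simp only [add_sub_cancel_left] at h
  obtain ⟨hp, hq⟩ := relMom_pos_ne h
  replace hp := norm_pos_iff.2 hp
  replace hq := norm_pos_iff.2 hq
  have hS := relMom_sq p q
  set r := relMom p q with hr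
  have hx : unboost (p + q) p = p - q - ((‖p‖ - ‖q‖) / (‖p‖ + ‖q‖ + r)) • (p + q) := by
    simp [unboost, hr]
  have hP : ‖p + q‖ ^ 2 = (‖p‖ + ‖q‖ + r) * (‖p‖ + ‖q‖ - r) := by linarith
  have hd : ‖p - q‖ ^ 2 = r ^ 2 + (‖p‖ - ‖q‖) ^ 2 := by
    have h1 := norm_add_sq_real p q
    have h2 := norm_sub_sq_real p q
    linarith
  have hin := inner_add_sub p q
  have hnorm : ‖unboost (p + q) p‖ = r := by
    rw [← sq_eq_sq₀ (norm_nonneg _) h.le, hx, norm_sub_sq_real, norm_smul, mul_pow,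
      inner_smul_right, real_inner_comm, hin, hP, hd, Real.norm_eq_abs, sq_abs]
    field_simp
    ring
  have hE : totalEnergy (p + q) r = ‖p‖ + ‖q‖ := by
    rw [totalEnergy, hP, show r ^ 2 + (‖p‖ + ‖q‖ + r) * (‖p‖ + ‖q‖ - r) = (‖p‖ + ‖q‖) ^ 2 by ring,
      Real.sqrt_sq (by positivity)]
  have hI : inner ℝ (p + q) (unboost (p + q) p) = r * (‖p‖ - ‖q‖) := by
    rw [hx, inner_sub_right, hin, inner_smul_right, real_inner_self_eq_norm_sq, hP]
    field_simp
    ring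
  refine ⟨norm_pos_iff.1 (by rw [hnorm]; exact h), ?_⟩
  rw [boost, hnorm, hE, hI, hx, mul_div_mul_left _ _ h.ne']
  module

/-- The reason for the coordinates: a collision keeps `P` and `‖x‖` and turns `x` into the direction
`ω`. -/
lemma outMom_boost (P : Mom) {x ω : Mom} (hx : x ≠ 0) (hω : ‖ω‖ = 1) :
    outMom (boost P x) (boost P (-x)) ω = boost P (‖x‖ • ω) := by
  have hr : 0 < ‖x‖ := norm_pos_iff.2 hx
  have hE := totalEnergy_pos P hr
  have h1 : ‖boost P x‖ + ‖boost P (-x)‖ = totalEnergy P ‖x‖ := by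
    rw [norm_boost P hx, norm_boost_neg P hx]; ring
  have h2 : boost P x + boost P (-x) = P := by rw [boost_neg]; abel
  rw [outMom, h1, relMom_boost P hx, h2, boost, inner_smul_right, norm_smul, norm_norm, hω, mul_one,
    mul_div_mul_left _ _ hr.ne']
  module

/-- Equality in Cauchy-Schwarz makes `p` and `P - p` parallel. These are the only momenta possibly
missed by `boost P`, and a line is a null set in dimension three. -/
lemma relMom_neg_ray {P p : Mom} (h : relMom p (P - p) = 0) :
    p ∈ (Submodule.span ℝ {P} : Submodule ℝ Mom) := by
  have h1 : inner ℝ p (P - p) = ‖p‖ * ‖P - p‖ := by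
    have := real_inner_le_norm p (P - p)
    have := (Real.sqrt_eq_zero (by linarith)).1 h
    linarith
  rw [inner_eq_norm_mul_iff_real] at h1
  by_cases h0 : ‖P - p‖ + ‖p‖ = 0
  · have : ‖p‖ = 0 := by linarith [norm_nonneg p, norm_nonneg (P - p)]
    rw [norm_eq_zero.1 this]; exact Submodule.zero_mem _
  · rw [Submodule.mem_span_singleton]
    refine ⟨(‖P - p‖ + ‖p‖)⁻¹ * ‖p‖, ?_⟩
    have h2 : (‖P - p‖ + ‖p‖) • p = ‖p‖ • P := by
      rw [add_smul, h1, smul_sub, sub_add_cancel]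
    rw [mul_smul, ← h2, inv_smul_smul₀ h0]

lemma volume_relMom_eq_zero (P : Mom) : volume {p : Mom | relMom p (P - p) = 0} = 0 := by
  refine measure_mono_null (fun p hp => relMom_neg_ray hp)
    (Measure.addHaar_submodule _ (Submodule.span ℝ {P} : Submodule ℝ Mom) ?_)
  intro h
  have h1 := finrank_span_le_card (R := ℝ) ({P} : Set Mom)
  rw [h, finrank_top] at h1
  simp at h1

/-- The slope of `boost P` at `x` in the direction of `P`. -/
def boostSlope (P x : Mom) : Mom →L[ℝ] ℝ :=
  (1 / (‖x‖ * (totalEnergy P ‖x‖ + ‖x‖))) • innerSL ℝ P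
    - (inner ℝ P x / (totalEnergy P ‖x‖ * ‖x‖ ^ 3)) • innerSL ℝ x

lemma hasFDerivAt_boost (P : Mom) {x : Mom} (hx : x ≠ 0) :
    HasFDerivAt (boost P)
      ((1 / 2 : ℝ) • (ContinuousLinearMap.id ℝ Mom + (boostSlope P x).smulRight P)) x := by
  have hr : 0 < ‖x‖ := norm_pos_iff.2 hx
  have hE := totalEnergy_pos P hr
  have hE2 := totalEnergy_sq P ‖x‖
  have hn : HasFDerivAt (fun y : Mom => ‖y‖) ((1 / ‖x‖) • innerSL ℝ x) x := by
    have h := (hasStrictFDerivAt_norm_sq x).hasFDerivAt.sqrt (by positivity)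
    simp only [Real.sqrt_sq (norm_nonneg _)] at h
    refine h.congr_fderiv ?_
    rw [← Nat.cast_smul_eq_nsmul ℝ, smul_smul]
    congr 1; push_cast; field_simp
  -- The numerator of the derivative is `(E + r)²/E`, because `E² = r² + ‖P‖²`, so the factor `E +
  -- r` cancels completely.
  have hg : HasDerivAt (fun r : ℝ => 1 / (r * (totalEnergy P r + r)))
      (-1 / (totalEnergy P ‖x‖ * ‖x‖ ^ 2)) ‖x‖ := by
    have h1 : HasDerivAt (totalEnergy P) (‖x‖ / totalEnergy P ‖x‖) ‖x‖ := by
      have := (((hasDerivAt_id ‖x‖).pow 2).add_const (‖P‖ ^ 2)).sqrt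
        (show ‖x‖ ^ 2 + ‖P‖ ^ 2 ≠ 0 by positivity)
      refine this.congr_deriv ?_
      simp [totalEnergy]
      field_simp
    have h2 := ((hasDerivAt_id ‖x‖).mul (h1.add (hasDerivAt_id ‖x‖))).inv
      (by simp only [Pi.mul_apply, Pi.add_apply, id]; positivity)
    have h3 : (fun r : ℝ => 1 / (r * (totalEnergy P r + r))) = (id * (totalEnergy P + id))⁻¹ := by
      ext r; simp [one_div]
    rw [h3]
    refine h2.congr_deriv ?_
    · simp only [Pi.mul_apply, Pi.add_apply, id]
      generalize totalEnergy P ‖x‖ = E at *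
      generalize ‖x‖ = r at *
      have : (0 : ℝ) < E + r := by positivity
      field_simp
      ring
  have hgn := hg.comp_hasFDerivAt x hn
  have hin : HasFDerivAt (fun y : Mom => (inner ℝ P y : ℝ)) (innerSL ℝ P) x :=
    (innerSL ℝ P).hasFDerivAt
  have hm := hin.mul hgn
  have := (((hasFDerivAt_id x).const_add P).add (hm.smul_const P)).const_smul (1 / 2 : ℝ)
  have hb : boost P = (1 / 2 : ℝ) • ((fun x => P + id x) + fun y => ((fun y : Mom => (inner ℝ P y : ℝ)) *
      (fun r : ℝ => 1 / (r * (totalEnergy P r + r))) ∘ fun y : Mom => ‖y‖) y • P) := by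
    funext y
    simp [boost, div_eq_mul_inv]
  rw [hb]
  refine this.congr_fderiv ?_
  · congr 3
    ext y
    simp only [boostSlope, sub_apply, smul_apply,
      add_apply, Function.comp_apply, smul_eq_mul, innerSL_apply_apply]
    field_simp
    ring

/-- The derivative is half of the identity plus a rank-one map, so its determinant is `(1/2)³` times
one plus the slope applied to `P`. The factor `‖boost P x‖ * ‖boost P (-x)‖` appears as a difference
of two squares. -/
lemma det_boost (P : Mom) {x : Mom} (hx : x ≠ 0) :
    ((1 / 2 : ℝ) • (ContinuousLinearMap.id ℝ Mom + (boostSlope P x).smulRight P)).det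
      = ‖boost P x‖ * ‖boost P (-x)‖ / (2 * totalEnergy P ‖x‖ * ‖x‖) := by
  have hr : 0 < ‖x‖ := norm_pos_iff.2 hx
  have hE := totalEnergy_pos P hr
  have hE2 := totalEnergy_sq P ‖x‖
  have h1 : ((1 / 2 : ℝ) • (ContinuousLinearMap.id ℝ Mom + (boostSlope P x).smulRight P)).det
      = (1 / 2 : ℝ) ^ 3 *
        (LinearMap.transvection (boostSlope P x : Mom →ₗ[ℝ] ℝ) P).det := by
    change LinearMap.det ((1 / 2 : ℝ) •
      LinearMap.transvection (boostSlope P x : Mom →ₗ[ℝ] ℝ) P) = _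
    rw [LinearMap.det_smul, finrank_euclideanSpace_fin]
  rw [h1, LinearMap.transvection.det, norm_boost P hx, norm_boost_neg P hx]
  have hP : ‖P‖ ^ 2 = (totalEnergy P ‖x‖ + ‖x‖) * (totalEnergy P ‖x‖ - ‖x‖) := by
    linarith
  have h2 : (boostSlope P x) P = ‖P‖ ^ 2 / (‖x‖ * (totalEnergy P ‖x‖ + ‖x‖))
      - inner ℝ P x ^ 2 / (totalEnergy P ‖x‖ * ‖x‖ ^ 3) := by
    simp only [boostSlope, sub_apply, smul_apply,
      smul_eq_mul, innerSL_apply_apply, real_inner_self_eq_norm_sq, real_inner_comm P x]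
    ring
  rw [ContinuousLinearMap.coe_coe, h2, hP]
  generalize totalEnergy P ‖x‖ = E at *
  generalize ‖x‖ = r at *
  have : (0 : ℝ) < E + r := by positivity
  field_simp
  ring

end

end MasslessBoltzmann

/-! ### Invariance of the collision measure -/

namespace MasslessBoltzmann

noncomputable section

@[fun_prop]
lemma measurable_relMom : Measurable fun z : Mom × Mom => relMom z.1 z.2 := by
  unfold relMom; fun_prop

@[fun_prop]
lemma measurable_boost : Measurable fun z : Mom × Mom => boost z.1 z.2 := by
  unfold boost totalEnergy; fun_prop

@[fun_prop]
lemma measurable_outMom : Measurable fun z : Mom × Mom × Mom => outMom z.1 z.2.1 z.2.2 := by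
  unfold outMom; fun_prop

/-- The numerator of the Jacobian is exactly the product of the two energies, which cancels the
weight. What remains depends on `x` through its length only. -/
lemma lintegral_boost (P : Mom) (G : Mom → ℝ≥0∞) :
    ∫⁻ p : Mom, ENNReal.ofReal (1 / (‖p‖ * ‖P - p‖)) * G p
      = ∫⁻ x : Mom, ENNReal.ofReal (1 / (2 * totalEnergy P ‖x‖ * ‖x‖)) * G (boost P x) := by
  have himg : (boost P '' {0}ᶜ : Set Mom) =ᵐ[volume] univ := by
    rw [eventuallyEq_univ, mem_ae_iff]
    refine measure_mono_null (fun p hp => ?_) (volume_relMom_eq_zero P)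
    by_contra h
    have := boost_unboost (lt_of_le_of_ne (relMom_nonneg p (P - p)) (Ne.symm h))
    exact hp ⟨_, this.1, this.2⟩
  rw [← setLIntegral_univ, ← setLIntegral_congr himg,
    lintegral_image_eq_lintegral_abs_det_fderiv_mul volume (measurableSet_singleton (0 : Mom)).compl
      (fun x hx => (hasFDerivAt_boost P hx).hasFDerivWithinAt)
      (fun x hx y hy h => by rw [← unboost_boost P hx, h, unboost_boost P hy])]
  conv_rhs => rw [← restrict_compl_singleton (μ := (volume : Measure Mom)) (0 : Mom)]
  refine setLIntegral_congr_fun (measurableSet_singleton (0 : Mom)).compl fun x hx => ?_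
  have hr : 0 < ‖x‖ := norm_pos_iff.2 hx
  have hE := totalEnergy_pos P hr
  obtain ⟨hp, hq⟩ := relMom_pos_ne (p := boost P x) (q := boost P (-x)) (by rwa [relMom_boost P hx])
  rw [← mul_assoc, ← ENNReal.ofReal_mul (abs_nonneg _), det_boost P hx, ← boost_neg,
    abs_of_nonneg (by positivity)]
  replace hp := norm_pos_iff.2 hp
  replace hq := norm_pos_iff.2 hq
  congr 2
  field_simp

/-- Integration in polar coordinates. -/
lemma lintegral_polar (G : Mom → ℝ≥0∞) (hG : Measurable G) :
    ∫⁻ x, G x = ∫⁻ r in Ioi (0 : ℝ), ENNReal.ofReal (r ^ 2) *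
      ∫⁻ ω : Dir, G (r • (ω : Mom)) ∂(volume : Measure Mom).toSphere := by
  have hmp := (volume : Measure Mom).measurePreserving_homeomorphUnitSphereProd
  have h1 : ∫⁻ x, G x = ∫⁻ x : ({(0 : Mom)}ᶜ : Set Mom), G (x : Mom) ∂(Measure.comap Subtype.val volume) := by
    rw [lintegral_subtype_comap (measurableSet_singleton _).compl, restrict_compl_singleton]
  have hm : Measurable fun x : Dir × Ioi (0 : ℝ) => G ((x.2 : ℝ) • (x.1 : Mom)) := by
    fun_prop
  have h2 : ∫⁻ x : ({(0 : Mom)}ᶜ : Set Mom), G (x : Mom) ∂(Measure.comap Subtype.val volume)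
      = ∫⁻ x : Dir × Ioi (0 : ℝ), G ((x.2 : ℝ) • (x.1 : Mom))
        ∂((volume : Measure Mom).toSphere.prod (.volumeIoiPow (Module.finrank ℝ Mom - 1))) := by
    rw [← hmp.lintegral_comp hm]
    refine lintegral_congr fun x => ?_
    have hx : ‖(x : Mom)‖ ≠ 0 := norm_ne_zero_iff.2 x.2
    simp [smul_smul, hx]
  rw [h1, h2, lintegral_prod_symm _ hm.aemeasurable, finrank_euclideanSpace_fin,
    Measure.volumeIoiPow, lintegral_withDensity_eq_lintegral_mul _ (by fun_prop)]
  · rw [← lintegral_subtype_comap measurableSet_Ioi]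
    rfl
  · exact hm.lintegral_prod_left'

/-- The measure `d³p d³q dω`. -/
abbrev tripleMeasure : Measure (Mom × Mom × Dir) := (volume : Measure Mom).prod collisionMeasure

instance : SigmaFinite collisionMeasure :=
  Measure.prod.instSigmaFinite (μ := (volume : Measure Mom)) (ν := (volume : Measure Mom).toSphere)

lemma lintegral_triple {Φ : Mom × Mom × Dir → ℝ≥0∞} (hΦ : Measurable Φ) :
    ∫⁻ z, Φ z ∂tripleMeasure
      = ∫⁻ p : Mom, ∫⁻ q : Mom, ∫⁻ ω : Dir, Φ (p, q, ω) ∂(volume : Measure Mom).toSphere := by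
  rw [tripleMeasure, lintegral_prod _ hΦ.aemeasurable]
  refine lintegral_congr fun p => ?_
  rw [collisionMeasure, lintegral_prod _ (by fun_prop)]

/-- The directions `η` and `ω`, before and after the collision, are integrated against the same
measure and the density contains neither of them. -/
lemma lintegral_triple_eq_boost {Φ : Mom × Mom × Dir → ℝ≥0∞} (hΦ : Measurable Φ) :
    ∫⁻ z, ENNReal.ofReal (1 / (‖z.1‖ * ‖z.2.1‖)) * Φ z ∂tripleMeasure
      = ∫⁻ P : Mom, ∫⁻ r in Ioi (0 : ℝ), ENNReal.ofReal (r ^ 2) *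
          (ENNReal.ofReal (1 / (2 * totalEnergy P r * r)) *
          ∫⁻ η : Dir, ∫⁻ ω : Dir, Φ (boost P (r • (η : Mom)), boost P (-(r • (η : Mom))), ω)
            ∂(volume : Measure Mom).toSphere ∂(volume : Measure Mom).toSphere) := by
  rw [lintegral_triple (by fun_prop)]
  have h1 : ∀ p : Mom, ∫⁻ q : Mom, ∫⁻ ω : Dir, ENNReal.ofReal (1 / (‖p‖ * ‖q‖)) * Φ (p, q, ω)
        ∂(volume : Measure Mom).toSphere
      = ∫⁻ P : Mom, ENNReal.ofReal (1 / (‖p‖ * ‖P - p‖)) * ∫⁻ ω : Dir, Φ (p, P - p, ω)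
        ∂(volume : Measure Mom).toSphere := fun p => by
    rw [← lintegral_sub_right_eq_self _ p]
    refine lintegral_congr fun P => ?_
    rw [lintegral_const_mul _ (by fun_prop)]
  simp_rw [h1]
  have hm1 : Measurable fun z : Mom × Mom => ∫⁻ ω : Dir, Φ (z.1, z.2 - z.1, ω)
        ∂(volume : Measure Mom).toSphere :=
    Measurable.lintegral_prod_right' (f := fun y : (Mom × Mom) × Dir => Φ (y.1.1, y.1.2 - y.1.1, y.2))
      (by fun_prop)
  rw [lintegral_lintegral_swap (by fun_prop)]
  refine lintegral_congr fun P => ?_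
  rw [lintegral_boost P fun p => ∫⁻ ω : Dir, Φ (p, P - p, ω) ∂(volume : Measure Mom).toSphere]
  simp_rw [← boost_neg]
  have hm3 : Measurable fun x : Mom => ∫⁻ ω : Dir, Φ (boost P x, boost P (-x), ω)
        ∂(volume : Measure Mom).toSphere :=
    Measurable.lintegral_prod_right'
      (f := fun y : Mom × Dir => Φ (boost P y.1, boost P (-y.1), y.2)) (by fun_prop)
  rw [lintegral_polar _ (by unfold totalEnergy; fun_prop)]
  refine setLIntegral_congr_fun measurableSet_Ioi fun r hr => ?_
  have hr' : ∀ ω : Dir, ‖r • (ω : Mom)‖ = r := fun ω => by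
    simp [norm_smul, abs_of_pos (mem_Ioi.1 hr)]
  simp only [hr']
  rw [lintegral_const_mul]
  exact hm3.comp (g := fun x : Mom => ∫⁻ ω : Dir, Φ (boost P x, boost P (-x), ω)
        ∂(volume : Measure Mom).toSphere) (f := fun η : Dir => r • (η : Mom)) (by fun_prop)

/-- The invariance of the collision measure `d³p d³q dω / (pq)` under the exchange of the momenta
before and after the collision. -/
theorem lintegral_collision_swap {H : ℝ × (Mom × Mom) × Mom × Mom → ℝ≥0∞} (hH : Measurable H) :
    ∫⁻ z, ENNReal.ofReal (1 / (‖z.1‖ * ‖z.2.1‖)) * H (relMom z.1 z.2.1,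
        (outMom z.1 z.2.1 z.2.2, outMom' z.1 z.2.1 z.2.2), z.1, z.2.1) ∂tripleMeasure
      = ∫⁻ z, ENNReal.ofReal (1 / (‖z.1‖ * ‖z.2.1‖)) * H (relMom z.1 z.2.1,
        (z.1, z.2.1), outMom z.1 z.2.1 z.2.2, outMom' z.1 z.2.1 z.2.2) ∂tripleMeasure := by
  have ho : Measurable fun z : Mom × Mom × Dir => outMom z.1 z.2.1 z.2.2 :=
    measurable_outMom.comp (f := fun z : Mom × Mom × Dir => (z.1, z.2.1, (z.2.2 : Mom)))
      (by fun_prop)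
  have ho' : Measurable fun z : Mom × Mom × Dir => outMom' z.1 z.2.1 z.2.2 :=
    measurable_outMom.comp (f := fun z : Mom × Mom × Dir => (z.1, z.2.1, -(z.2.2 : Mom)))
      (by fun_prop)
  rw [lintegral_triple_eq_boost (Φ := fun z => H (relMom z.1 z.2.1,
        (outMom z.1 z.2.1 z.2.2, outMom' z.1 z.2.1 z.2.2), z.1, z.2.1)) (by fun_prop),
    lintegral_triple_eq_boost (Φ := fun z => H (relMom z.1 z.2.1,
        (z.1, z.2.1), outMom z.1 z.2.1 z.2.2, outMom' z.1 z.2.1 z.2.2)) (by fun_prop)]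
  refine lintegral_congr fun P => setLIntegral_congr_fun measurableSet_Ioi fun r hr => ?_
  have hr0 : (0 : ℝ) < r := hr
  have hr' : ∀ ω : Dir, ‖r • (ω : Mom)‖ = r := fun ω => by
    simp [norm_smul, abs_of_pos hr0]
  have hne : ∀ ω : Dir, r • (ω : Mom) ≠ 0 := fun ω => norm_ne_zero_iff.1 (by rw [hr']; exact hr0.ne')
  have e1 : ∀ η ω : Dir, outMom (boost P (r • (η : Mom))) (boost P (-(r • (η : Mom)))) ω
      = boost P (r • (ω : Mom)) := fun η ω => by
    rw [outMom_boost P (hne η) (by simp), hr']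
  have e2 : ∀ η ω : Dir, outMom (boost P (r • (η : Mom))) (boost P (-(r • (η : Mom)))) (-ω)
      = boost P (-(r • (ω : Mom))) := fun η ω => by
    rw [outMom_boost P (hne η) (by simp), hr', smul_neg]
  simp only [outMom', relMom_boost P (hne _), hr', e1, e2]
  congr 2
  -- In these coordinates the collision exchanges `η` and `ω`, so the invariance is Tonelli's
  -- theorem on the product of two spheres.
  rw [lintegral_lintegral_swap]
  exact Measurable.aemeasurable (hH.comp (f := fun z : Dir × Dir => (r, (boost P (r • (z.2 : Mom)),
    boost P (-(r • (z.2 : Mom)))), boost P (r • (z.1 : Mom)), boost P (-(r • (z.1 : Mom)))))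
    (by fun_prop))

end

end MasslessBoltzmann

/-! ### Rotations and the uniform projection of the sphere -/

namespace MasslessBoltzmann

noncomputable section

lemma exists_isometry_map_eq {v w : Mom} (h : ‖v‖ = ‖w‖) : ∃ R : Mom ≃ₗᵢ[ℝ] Mom, R v = w :=
  ⟨_, Submodule.reflection_sub h⟩

/-- Integration in cylindrical coordinates. -/
lemma lintegral_cylindrical {G : ℝ × ℝ → ℝ≥0∞} (hG : Measurable G) :
    ∫⁻ x : Mom, G (x 0, ‖x‖)
      = ENNReal.ofReal (2 * Real.pi) *
        ∫⁻ w : ℝ × ℝ, ENNReal.ofReal w.2 * G (w.1, Real.sqrt (w.1 ^ 2 + w.2 ^ 2)) := by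
  have h1 : ∫⁻ x : Mom, G (x 0, ‖x‖)
      = ∫⁻ v : Fin 3 → ℝ, G (v 0, Real.sqrt (v 0 ^ 2 + v 1 ^ 2 + v 2 ^ 2)) := by
    rw [← (PiLp.volume_preserving_toLp (Fin 3)).lintegral_comp (by fun_prop)]
    simp [EuclideanSpace.norm_eq, Fin.sum_univ_three]
  have h2 : ∫⁻ v : Fin 3 → ℝ, G (v 0, Real.sqrt (v 0 ^ 2 + v 1 ^ 2 + v 2 ^ 2))
      = ∫⁻ z : ℝ × (Fin 2 → ℝ), G (z.1, Real.sqrt (z.1 ^ 2 + z.2 0 ^ 2 + z.2 1 ^ 2)) := by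
    rw [← (volume_preserving_piFinSuccAbove (fun _ : Fin 3 => ℝ) 0).lintegral_comp (by fun_prop)]
    rfl
  rw [h1, h2, Measure.volume_eq_prod, lintegral_prod _ (by fun_prop), Measure.volume_eq_prod, lintegral_prod _ (by fun_prop),
    ← lintegral_const_mul _ (by fun_prop)]
  refine lintegral_congr fun z => ?_
  dsimp only
  have h3 : ∫⁻ y : Fin 2 → ℝ, G (z, Real.sqrt (z ^ 2 + y 0 ^ 2 + y 1 ^ 2))
      = ∫⁻ w : ℝ × ℝ, G (z, Real.sqrt (z ^ 2 + w.1 ^ 2 + w.2 ^ 2)) := by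
    rw [← (volume_preserving_finTwoArrow ℝ).lintegral_comp (by fun_prop)]
    rfl
  rw [h3, ← lintegral_comp_polarCoord_symm]
  have h4 : ∀ p : ℝ × ℝ, ENNReal.ofReal p.1 • G (z, Real.sqrt (z ^ 2 + (polarCoord.symm p).1 ^ 2
      + (polarCoord.symm p).2 ^ 2)) = ENNReal.ofReal p.1 * G (z, Real.sqrt (z ^ 2 + p.1 ^ 2)) := by
    intro p
    rw [smul_eq_mul, polarCoord_symm_apply, add_assoc]
    congr 4
    dsimp only
    nlinarith [Real.sin_sq_add_cos_sq p.2]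
  simp_rw [h4]
  rw [polarCoord_target, Measure.volume_eq_prod, ← Measure.prod_restrict,
    lintegral_prod _ (by fun_prop)]
  simp only [lintegral_const, Measure.restrict_apply_univ, Real.volume_Ioo]
  rw [lintegral_mul_const _ (by fun_prop), mul_comm, show Real.pi - -Real.pi = 2 * Real.pi by ring]
  congr 1
  -- `ENNReal.ofReal r` vanishes for `r ≤ 0`, so the radial integral may run over the whole line.
  rw [← lintegral_indicator measurableSet_Ioi]
  refine lintegral_congr fun r => ?_
  by_cases hr : 0 < r
  · simp [hr]
  · simp [hr, ENNReal.ofReal_of_nonpos (not_lt.1 hr)]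

/-- Substitution `t = cos θ` on the half where the sine is positive; on the other half
`ENNReal.ofReal` annihilates the integrand. -/
lemma lintegral_sin_mul_comp_cos (F : ℝ → ℝ≥0∞) :
    ∫⁻ θ in Ioo (-Real.pi) Real.pi, ENNReal.ofReal (Real.sin θ) * F (Real.cos θ)
      = ∫⁻ t in Icc (-1 : ℝ) 1, F t := by
  have himg : Real.cos '' Ioo 0 Real.pi = Ioo (-1) 1 := by
    ext t
    constructor
    · rintro ⟨θ, hθ, rfl⟩
      have h1 := Real.strictAntiOn_cos ⟨le_rfl, Real.pi_pos.le⟩ ⟨hθ.1.le, hθ.2.le⟩ hθ.1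
      have h2 := Real.strictAntiOn_cos ⟨hθ.1.le, hθ.2.le⟩ ⟨Real.pi_pos.le, le_rfl⟩ hθ.2
      simp only [Real.cos_zero, Real.cos_pi] at h1 h2
      exact ⟨h2, h1⟩
    · intro ht
      refine ⟨Real.arccos t, ⟨Real.arccos_pos.2 ht.2, ?_⟩, Real.cos_arccos ht.1.le ht.2.le⟩
      refine lt_of_le_of_ne (Real.arccos_le_pi t) fun h => ?_
      rw [Real.arccos_eq_pi] at h
      exact absurd ht.1 (not_lt.2 h)
  rw [setLIntegral_congr Ioo_ae_eq_Icc.symm, ← himg,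
    lintegral_image_eq_lintegral_abs_deriv_mul measurableSet_Ioo
      (fun θ _ => (Real.hasDerivAt_cos θ).hasDerivWithinAt)
      (Real.injOn_cos.mono Ioo_subset_Icc_self),
    ← lintegral_indicator measurableSet_Ioo, ← lintegral_indicator measurableSet_Ioo]
  refine lintegral_congr fun θ => ?_
  by_cases h1 : θ ∈ Ioo 0 Real.pi
  · rw [indicator_of_mem h1, indicator_of_mem (Ioo_subset_Ioo_left (by linarith [Real.pi_pos]) h1), abs_neg,
      abs_of_pos (Real.sin_pos_of_mem_Ioo h1)]
  · rw [indicator_of_notMem h1]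
    by_cases h2 : θ ∈ Ioo (-Real.pi) Real.pi
    · rw [indicator_of_mem h2, ENNReal.ofReal_of_nonpos, zero_mul]
      refine Real.sin_nonpos_of_nonpos_of_neg_pi_le ?_ h2.1.le
      by_contra h
      exact h1 ⟨not_le.1 h, h2.2⟩
    · rw [indicator_of_notMem h2]

/-- Archimedes: the projection of the surface measure of the unit sphere to an axis is uniform. -/
theorem lintegral_sphere_inner {e : Mom} (he : ‖e‖ = 1) {F : ℝ → ℝ≥0∞} (hF : Measurable F) :
    ∫⁻ ω : Dir, F (inner ℝ e (ω : Mom)) ∂(volume : Measure Mom).toSphere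
      = ENNReal.ofReal (2 * Real.pi) * ∫⁻ t in Icc (-1 : ℝ) 1, F t := by
  -- The function `F(e·x/|x|)` on the unit ball is integrated over space twice, in spherical and in
  -- cylindrical coordinates around `e`. Both results contain the same radial factor `c`, which is
  -- finite and nonzero and can be cancelled.
  obtain ⟨χ, hχdef⟩ : ∃ χ : ℝ → ℝ≥0∞, χ = (Iio 1).indicator (fun _ => 1) := ⟨_, rfl⟩
  have hχ : Measurable χ := by rw [hχdef]; exact measurable_const.indicator measurableSet_Iio
  set G : ℝ × ℝ → ℝ≥0∞ := fun w => χ w.2 * F (w.1 / w.2) with hGdef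
  have hG : Measurable G := by rw [hGdef]; fun_prop
  set c : ℝ≥0∞ := ∫⁻ r in Ioi (0 : ℝ), ENNReal.ofReal (r ^ 2) * χ r
    with hc
  have hc' : c = ∫⁻ r in Ioo (0 : ℝ) 1, ENNReal.ofReal (r ^ 2) := by
    rw [hc, ← lintegral_indicator measurableSet_Ioi, ← lintegral_indicator measurableSet_Ioo]
    refine lintegral_congr fun r => ?_
    by_cases h1 : 0 < r <;> by_cases h2 : r < 1 <;> simp [h1, h2, hχdef]
  have hcfin : c ≠ ∞ := by
    rw [hc']
    refine (lt_of_le_of_lt (setLIntegral_mono (g := fun _ => 1) measurable_const fun r hr => ?_)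
      (by simp)).ne
    rw [← ENNReal.ofReal_one]
    exact ENNReal.ofReal_le_ofReal (by nlinarith [hr.1, hr.2])
  have hcpos : c ≠ 0 := by
    rw [hc', ← pos_iff_ne_zero, setLIntegral_pos_iff (by fun_prop)]
    refine lt_of_lt_of_le (?_ : 0 < volume (Ioo (0 : ℝ) 1)) (measure_mono fun r hr => ⟨?_, hr⟩)
    · simp
    · simpa using hr.1.ne'
  have hA : ∫⁻ x : Mom, G (inner ℝ e x, ‖x‖)
      = c * ∫⁻ ω : Dir, F (inner ℝ e (ω : Mom)) ∂(volume : Measure Mom).toSphere := by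
    rw [lintegral_polar _ (by fun_prop), hc, ← lintegral_mul_const _ (by fun_prop)]
    refine setLIntegral_congr_fun measurableSet_Ioi fun r hr => ?_
    have hr0 : r ≠ 0 := (mem_Ioi.1 hr).ne'
    have : ∀ ω : Dir, G (inner ℝ e (r • (ω : Mom)), ‖r • (ω : Mom)‖)
        = χ r * F (inner ℝ e (ω : Mom)) := fun ω => by
      simp [hGdef, norm_smul, abs_of_pos (mem_Ioi.1 hr), inner_smul_right,
        mul_div_cancel_left₀ _ hr0]
    simp only [this]
    rw [lintegral_const_mul _ (by fun_prop), mul_assoc]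
  have hB : ∫⁻ x : Mom, G (inner ℝ e x, ‖x‖)
      = c * (ENNReal.ofReal (2 * Real.pi) * ∫⁻ t in Icc (-1 : ℝ) 1, F t) := by
    obtain ⟨R, hR⟩ := exists_isometry_map_eq (v := EuclideanSpace.single 0 1) (w := e) (by simp [he])
    have h1 : ∫⁻ x : Mom, G (inner ℝ e x, ‖x‖) = ∫⁻ x : Mom, G (x 0, ‖x‖) := by
      rw [← R.measurePreserving.lintegral_comp (by fun_prop)]
      refine lintegral_congr fun x => ?_
      rw [← hR, R.inner_map_map, R.norm_map]
      simp [EuclideanSpace.inner_single_left]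
    rw [h1, lintegral_cylindrical hG, ← lintegral_comp_polarCoord_symm, polarCoord_target,
      mul_left_comm]
    congr 1
    rw [Measure.volume_eq_prod, ← Measure.prod_restrict, lintegral_prod, ← lintegral_sin_mul_comp_cos, hc,
      ← lintegral_mul_const]
    · refine setLIntegral_congr_fun measurableSet_Ioi fun r hr => ?_
      have hr0 : 0 < r := hr
      rw [← lintegral_const_mul]
      · refine lintegral_congr fun θ => ?_
        have h2 : Real.sqrt ((r * Real.cos θ) ^ 2 + (r * Real.sin θ) ^ 2) = r := by
          rw [show (r * Real.cos θ) ^ 2 + (r * Real.sin θ) ^ 2 = r ^ 2 by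
            nlinarith [Real.sin_sq_add_cos_sq θ], Real.sqrt_sq hr0.le]
        simp only [polarCoord_symm_apply, h2, hGdef, mul_div_cancel_left₀ _ hr0.ne', smul_eq_mul,
          ENNReal.ofReal_mul hr0.le, ENNReal.ofReal_pow hr0.le]
        ring
      · fun_prop
    · fun_prop
    · have := continuous_polarCoord_symm.measurable
      fun_prop
  rw [hA] at hB
  exact (ENNReal.mul_right_inj hcpos hcfin).1 hB

end

end MasslessBoltzmann

/-! ### Energies after the collision and their angular averages -/

namespace MasslessBoltzmann

noncomputable section

lemma lintegral_sphere_inner_right (P : Mom) {F : ℝ → ℝ≥0∞} (hF : Measurable F) :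
    ∫⁻ ω : Dir, F (inner ℝ P (ω : Mom)) ∂(volume : Measure Mom).toSphere
      = ENNReal.ofReal (2 * Real.pi) * ∫⁻ t in Icc (-1 : ℝ) 1, F (‖P‖ * t) := by
  obtain ⟨e, he, hP⟩ : ∃ e : Mom, ‖e‖ = 1 ∧ P = ‖P‖ • e := by
    by_cases h : P = 0
    · exact ⟨EuclideanSpace.single 0 1, by simp, by simp [h]⟩
    · refine ⟨‖P‖⁻¹ • P, ?_, ?_⟩
      · rw [norm_smul, norm_inv, norm_norm, inv_mul_cancel₀ (norm_ne_zero_iff.2 h)]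
      · rw [smul_inv_smul₀ (norm_ne_zero_iff.2 h)]
  rw [← lintegral_sphere_inner he (F := fun t => F (‖P‖ * t)) (by fun_prop)]
  refine lintegral_congr fun ω => ?_
  nth_rewrite 1 [hP]
  rw [real_inner_smul_left]

lemma toSphere_univ : (volume : Measure Mom).toSphere univ = ENNReal.ofReal (4 * Real.pi) := by
  have := lintegral_sphere_inner_right 0 (F := fun _ => 1) measurable_const
  simp only [lintegral_one, Measure.restrict_apply_univ, Real.volume_Icc] at this
  rw [this, ← ENNReal.ofReal_mul (by positivity)]
  congr 1; ring

/-- The energy after the collision. -/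
lemma norm_outMom (p q : Mom) {ω : Mom} (hω : ‖ω‖ = 1) :
    ‖outMom p q ω‖ = (‖p‖ + ‖q‖ + inner ℝ (p + q) ω) / 2 := by
  have hc := neg_le_of_abs_le (abs_real_inner_le_norm (p + q) ω)
  rw [hω, mul_one] at hc
  have hn := norm_add_le p q
  have hρ := relMom_nonneg p q
  have hS := relMom_sq p q
  rw [← sq_eq_sq₀ (norm_nonneg _) (by linarith)]
  have hP : ‖p + q‖ ^ 2 = (‖p‖ + ‖q‖ + relMom p q) * (‖p‖ + ‖q‖ - relMom p q) := by linarith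
  have ho : outMom p q ω = (1 / 2 + inner ℝ (p + q) ω / 2 / (‖p‖ + ‖q‖ + relMom p q)) • (p + q)
      + (relMom p q / 2) • ω := by
    rw [outMom]; module
  rw [ho, norm_add_sq_real, norm_smul, norm_smul, mul_pow, mul_pow, inner_smul_left,
    inner_smul_right, hω, hP, Real.norm_eq_abs, Real.norm_eq_abs, sq_abs, sq_abs]
  simp only [conj_trivial]
  rcases eq_or_lt_of_le (add_nonneg (add_nonneg (norm_nonneg p) (norm_nonneg q)) hρ) with h | h
  · have h1 : ‖p‖ = 0 := by linarith [norm_nonneg p, norm_nonneg q]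
    have h2 : ‖q‖ = 0 := by linarith [norm_nonneg p, norm_nonneg q]
    have h3 : relMom p q = 0 := by linarith [norm_nonneg p, norm_nonneg q]
    rw [norm_eq_zero.1 h1, norm_eq_zero.1 h2] at h3 ⊢
    simp [h3]
  · generalize ‖p‖ + ‖q‖ = E at *
    generalize relMom p q = r at *
    generalize (inner ℝ (p + q) ω : ℝ) = c at *
    field_simp
    ring

lemma norm_outMom_dir (p q : Mom) (ω : Dir) :
    ‖outMom p q ω‖ = (‖p‖ + ‖q‖ + inner ℝ (p + q) (ω : Mom)) / 2 := norm_outMom p q (by simp)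

lemma norm_outMom'_dir (p q : Mom) (ω : Dir) :
    ‖outMom' p q ω‖ = (‖p‖ + ‖q‖ - inner ℝ (p + q) (ω : Mom)) / 2 := by
  rw [outMom', norm_outMom p q (by simp), inner_neg_right]; ring

lemma lintegral_inv_sq {a m : ℝ} (hm : |m| < a) :
    ∫⁻ t in Icc (-1 : ℝ) 1, ENNReal.ofReal (((a + m * t) ^ 2)⁻¹)
      = ENNReal.ofReal (2 / (a ^ 2 - m ^ 2)) := by
  have ha : 0 < a := (abs_nonneg m).trans_lt hm
  obtain ⟨h1, h2⟩ := abs_lt.1 hm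
  have hpos : ∀ t ∈ Icc (-1 : ℝ) 1, 0 < a + m * t := fun t ht => by
    have h3 : |m * t| ≤ |m| := by
      rw [abs_mul]; exact mul_le_of_le_one_right (abs_nonneg m) (abs_le.2 ht)
    linarith [neg_le_of_abs_le h3]
  have hcont : ContinuousOn (fun t : ℝ => ((a + m * t) ^ 2)⁻¹) (Icc (-1) 1) :=
    ContinuousOn.inv₀ (by fun_prop) fun t ht => (pow_pos (hpos t ht) 2).ne'
  have hint : ∫ t in (-1 : ℝ)..1, ((a + m * t) ^ 2)⁻¹ = 2 / (a ^ 2 - m ^ 2) := by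
    -- This primitive differs by a constant from `-1/(m(a + mt))` and, unlike it, also covers `m =
    -- 0`.
    rw [intervalIntegral.integral_eq_sub_of_hasDerivAt (f := fun t => t / (a * (a + m * t)))]
    · have e1 : a + m ≠ 0 := by linarith
      have e2 : a - m ≠ 0 := by linarith
      have e3 : a ^ 2 - m ^ 2 = (a + m) * (a - m) := by ring
      rw [e3]
      rw [mul_one, mul_neg_one, ← sub_eq_add_neg]
      field_simp
      ring
    · intro t ht
      rw [uIcc_of_le (by norm_num)] at ht
      have h0 := hpos t ht
      have hd : HasDerivAt (fun t : ℝ => a * (a + m * t)) (a * (m * 1)) t :=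
        (((hasDerivAt_id t).const_mul m).const_add a).const_mul a
      refine ((hasDerivAt_id t).div hd (by positivity)).congr_deriv ?_
      simp only [id]
      field_simp
      ring
    · exact ContinuousOn.intervalIntegrable_of_Icc (by norm_num) hcont
  rw [← hint, intervalIntegral.integral_of_le (by norm_num), ← integral_Icc_eq_integral_Ioc,
    ofReal_integral_eq_lintegral_ofReal hcont.integrableOn_Icc
      (ae_of_all _ fun t => inv_nonneg.2 (sq_nonneg _))]

lemma lintegral_one_sub_rpow_lt_top {s : ℝ} (hs : -1 < s) :
    ∫⁻ t in Icc (-1 : ℝ) 1, ENNReal.ofReal ((1 - t) ^ s) < ∞ := by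
  have h : IntervalIntegrable (fun t : ℝ => (1 - t) ^ s) volume (-1) 1 := by
    have := (intervalIntegral.intervalIntegrable_rpow' (a := 2) (b := 0) hs).comp_sub_left 1
    norm_num at this
    exact this
  have h2 := (intervalIntegrable_iff_integrableOn_Icc_of_le (by norm_num)).1 h
  exact h2.lintegral_lt_top

lemma lintegral_one_add_rpow_lt_top {s : ℝ} (hs : -1 < s) :
    ∫⁻ t in Icc (-1 : ℝ) 1, ENNReal.ofReal ((1 + t) ^ s) < ∞ := by
  have h : IntervalIntegrable (fun t : ℝ => (1 + t) ^ s) volume (-1) 1 := by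
    have := (intervalIntegral.intervalIntegrable_rpow' (a := 0) (b := 2) hs).comp_add_left 1
    norm_num at this
    exact this
  have h2 := (intervalIntegrable_iff_integrableOn_Icc_of_le (by norm_num)).1 h
  exact h2.lintegral_lt_top

/-- The average over the scattering direction of `(p' + δ)⁻²`. -/
lemma lintegral_norm_outMom_add_inv_sq (p q : Mom) {δ : ℝ} (hδ : 0 < δ) :
    ∫⁻ ω : Dir, ENNReal.ofReal (((‖outMom p q ω‖ + δ) ^ 2)⁻¹) ∂(volume : Measure Mom).toSphere
      = ENNReal.ofReal (4 * Real.pi / (relMom p q ^ 2 / 4 + (‖p‖ + ‖q‖) * δ + δ ^ 2)) := by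
  simp only [norm_outMom_dir]
  rw [lintegral_sphere_inner_right (p + q)
    (F := fun t => ENNReal.ofReal ((((‖p‖ + ‖q‖ + t) / 2 + δ) ^ 2)⁻¹)) (by fun_prop)]
  have hm : |‖p + q‖ / 2| < (‖p‖ + ‖q‖) / 2 + δ := by
    rw [abs_of_nonneg (by positivity)]
    linarith [norm_add_le p q]
  have h := lintegral_inv_sq hm
  have e1 : ((‖p‖ + ‖q‖) / 2 + δ) ^ 2 - (‖p + q‖ / 2) ^ 2
      = relMom p q ^ 2 / 4 + (‖p‖ + ‖q‖) * δ + δ ^ 2 := by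
    rw [relMom_sq]; ring
  have e2 : ∀ t, (‖p‖ + ‖q‖ + ‖p + q‖ * t) / 2 + δ = (‖p‖ + ‖q‖) / 2 + δ + ‖p + q‖ / 2 * t :=
    fun t => by ring
  simp only [e2]
  rw [h, e1, ← ENNReal.ofReal_mul (by positivity)]
  congr 1
  ring

/-- The average of an angular function over an isotropic distribution. -/
lemma lintegral_isotropic_mul_angular {e : Mom} (he : ‖e‖ = 1) {Φ Θ : ℝ → ℝ≥0∞}
    (hΦ : Measurable Φ) (hΘ : Measurable Θ) :
    ∫⁻ q : Mom, Φ ‖q‖ * Θ (inner ℝ e q / ‖q‖)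
      = (∫⁻ q : Mom, Φ ‖q‖) * (2⁻¹ * ∫⁻ t in Icc (-1 : ℝ) 1, Θ t) := by
  have h4 : ENNReal.ofReal (4 * Real.pi) = 2 * ENNReal.ofReal (2 * Real.pi) := by
    rw [← ENNReal.ofReal_ofNat 2, ← ENNReal.ofReal_mul (by norm_num)]
    congr 1; ring
  rw [lintegral_polar _ (by fun_prop), lintegral_polar _ (by fun_prop), ← lintegral_mul_const]
  · refine setLIntegral_congr_fun measurableSet_Ioi fun r hr => ?_
    have hr0 : 0 < r := hr
    have h1 : ∀ ω : Dir, ‖r • (ω : Mom)‖ = r := fun ω => by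
      simp [norm_smul, abs_of_pos hr0]
    simp only [h1, inner_smul_right, mul_div_cancel_left₀ _ hr0.ne']
    rw [lintegral_const_mul _ (by fun_prop), lintegral_sphere_inner he hΘ, lintegral_const,
      toSphere_univ, h4]
    -- The sphere has area `4π`, while the projection has density `2π` in `t`; the ratio is the
    -- factor `2⁻¹`.
    have h2 : (2 : ℝ≥0∞) * 2⁻¹ = 1 := ENNReal.mul_inv_cancel (by norm_num) (by norm_num)
    calc _ = ENNReal.ofReal (r ^ 2) * (Φ r * (ENNReal.ofReal (2 * Real.pi) *
          ∫⁻ t in Icc (-1 : ℝ) 1, Θ t)) := rfl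
      _ = ENNReal.ofReal (r ^ 2) * (Φ r * ((2 * 2⁻¹) * ENNReal.ofReal (2 * Real.pi) *
          ∫⁻ t in Icc (-1 : ℝ) 1, Θ t)) := by rw [h2, one_mul]
      _ = _ := by ring
  · refine Measurable.mul (by fun_prop) ?_
    exact Measurable.lintegral_prod_right' (f := fun z : ℝ × Dir => Φ ‖z.1 • (z.2 : Mom)‖)
      (by fun_prop)

end

end MasslessBoltzmann

/-! ### Pointwise bounds of the kernel -/

namespace MasslessBoltzmann

noncomputable section

lemma kernel_nonneg (b ε : ℝ) (p q : Mom) : 0 ≤ kernel b ε p q := by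
  unfold kernel
  split_ifs
  · exact div_nonneg (Real.rpow_nonneg (relMom_nonneg p q) _) (by positivity)
  · exact le_rfl

lemma relMom_comm (p q : Mom) : relMom p q = relMom q p := by
  rw [relMom, relMom, real_inner_comm, mul_comm ‖p‖]

lemma kernel_comm (b ε : ℝ) (p q : Mom) : kernel b ε p q = kernel b ε q p := by
  rw [kernel, kernel, relMom_comm, mul_comm ‖p‖]

lemma kernel_zero (b : ℝ) (p q : Mom) : kernel b 0 p q = relMom p q ^ (2 - b) / (‖p‖ * ‖q‖) := by
  rw [kernel, if_pos (relMom_nonneg p q)]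

lemma kernel_le_kernel_zero (b ε : ℝ) (p q : Mom) : kernel b ε p q ≤ kernel b 0 p q := by
  rw [kernel_zero, kernel]
  split_ifs
  · exact le_rfl
  · exact div_nonneg (Real.rpow_nonneg (relMom_nonneg p q) _) (by positivity)

@[fun_prop]
lemma measurable_kernel (b ε : ℝ) : Measurable fun z : Mom × Mom => kernel b ε z.1 z.2 := by
  unfold kernel
  exact Measurable.ite (measurableSet_le measurable_const measurable_relMom) (by fun_prop)
    measurable_const

/-- The weight `1 + 1/p`. -/
def wt (p : Mom) : ℝ := 1 + 1 / ‖p‖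

/-- The weight `1 + 1/p²`. -/
def wtSq (p : Mom) : ℝ := 1 + 1 / ‖p‖ ^ 2

@[fun_prop]
lemma measurable_wt : Measurable wt := by unfold wt; fun_prop

@[fun_prop]
lemma measurable_wtSq : Measurable wtSq := by unfold wtSq; fun_prop

lemma one_le_wt (p : Mom) : 1 ≤ wt p := le_add_of_nonneg_right (by positivity)

lemma one_le_wtSq (p : Mom) : 1 ≤ wtSq p := le_add_of_nonneg_right (by positivity)

lemma wt_le_wtSq (p : Mom) : wt p ≤ 2 * wtSq p := by
  have h : 1 / ‖p‖ ≤ 1 + 1 / ‖p‖ ^ 2 := by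
    rw [← one_div_pow]
    nlinarith [sq_nonneg (1 / ‖p‖ - 1)]
  have h2 : 0 ≤ 1 / ‖p‖ ^ 2 := by positivity
  unfold wt wtSq
  linarith

lemma rpow_neg_le_wt {s : ℝ} (hs0 : 0 ≤ s) (hs1 : s ≤ 1) (p : Mom) : ‖p‖ ^ (-s) ≤ wt p := by
  -- At the origin the conventions `1 / 0 = 0` and `0 ^ (-s) ∈ {0, 1}` keep the inequality true.
  rcases eq_or_lt_of_le (norm_nonneg p) with h | h
  · rw [← h, wt, ← h, div_zero, add_zero]
    exact Real.zero_rpow_le_one _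
  · rcases le_total ‖p‖ 1 with h1 | h1
    · have := Real.rpow_le_rpow_of_exponent_ge h h1 (neg_le_neg hs1)
      rw [Real.rpow_neg_one] at this
      rw [wt, one_div]; linarith
    · exact (Real.rpow_le_one_of_one_le_of_nonpos h1 (by linarith)).trans (one_le_wt p)

lemma rpow_neg_le_wtSq {s : ℝ} (hs0 : 0 ≤ s) (hs1 : s ≤ 2) (p : Mom) : ‖p‖ ^ (-s) ≤ wtSq p := by
  rcases eq_or_lt_of_le (norm_nonneg p) with h | h
  · rw [← h]
    exact (Real.zero_rpow_le_one _).trans (one_le_wtSq p)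
  · rcases le_total ‖p‖ 1 with h1 | h1
    · have := Real.rpow_le_rpow_of_exponent_ge h h1 (neg_le_neg hs1)
      rw [Real.rpow_neg h.le 2, Real.rpow_two] at this
      rw [wtSq, one_div]; linarith
    · exact (Real.rpow_le_one_of_one_le_of_nonpos h1 (by linarith)).trans (one_le_wtSq p)

variable {b : ℝ}

/-- From `ϱ² ≤ 4pq` and `2 - b > 0`. The constant is `4^(1 - b/2)`, which is at most `2` because `b
> 1`. -/
lemma kernel_zero_le (hb₁ : 1 < b) (hb₂ : b < 2) (p q : Mom) :
    kernel b 0 p q ≤ 2 * (‖p‖ ^ (-(b / 2)) * ‖q‖ ^ (-(b / 2))) := by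
  rw [kernel_zero]
  rcases eq_or_lt_of_le (mul_nonneg (norm_nonneg p) (norm_nonneg q)) with h | h
  · rw [← h, div_zero]; positivity
  · have h1 : relMom p q ^ (2 - b) ≤ 2 * (‖p‖ * ‖q‖) ^ (1 - b / 2) := by
      have h2 : relMom p q ^ (2 - b) = (relMom p q ^ 2) ^ (1 - b / 2) := by
        rw [← Real.rpow_natCast, ← Real.rpow_mul (relMom_nonneg p q)]
        congr 1; push_cast; ring
      have h3 : (4 : ℝ) ^ (1 - b / 2) ≤ 2 := by
        have : (4 : ℝ) ^ (1 - b / 2) ≤ 4 ^ (1 / 2 : ℝ) :=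
          Real.rpow_le_rpow_of_exponent_le (by norm_num) (by linarith)
        refine this.trans_eq ?_
        rw [← Real.sqrt_eq_rpow, show (4 : ℝ) = 2 ^ 2 by norm_num, Real.sqrt_sq (by norm_num)]
      rw [h2]
      refine (Real.rpow_le_rpow (sq_nonneg _) (relMom_sq_le p q) (by linarith)).trans ?_
      rw [Real.mul_rpow (by norm_num) h.le]
      gcongr
    rw [div_le_iff₀ h, ← Real.mul_rpow (norm_nonneg p) (norm_nonneg q), mul_assoc,
      ← Real.rpow_add_one h.ne', show -(b / 2) + 1 = 1 - b / 2 by ring]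
    exact h1

/-- `ϱ ≥ ε` forces `pq ≥ ε²/4`, which keeps the pair away from the singularity of the kernel. -/
lemma kernel_le_of_cutoff (hb₁ : 1 < b) (hb₂ : b < 2) {ε : ℝ} (hε : 0 < ε) (p q : Mom) :
    kernel b ε p q ≤ 2 * (ε ^ 2 / 4) ^ (-(b / 2)) := by
  by_cases h : ε ≤ relMom p q
  · refine (kernel_le_kernel_zero b ε p q).trans ((kernel_zero_le hb₁ hb₂ p q).trans ?_)
    rw [← Real.mul_rpow (norm_nonneg p) (norm_nonneg q)]
    have h1 := relMom_sq_le p q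
    have h2 : ε ^ 2 / 4 ≤ ‖p‖ * ‖q‖ := by nlinarith
    have := Real.rpow_le_rpow_of_nonpos (by positivity) h2 (by linarith : -(b / 2) ≤ 0)
    linarith
  · rw [kernel, if_neg h]; positivity

/-- The two kernels differ only where `ϱ < ε`. There the factor `ϱ^ζ` is traded for `ε^ζ`, at the
price of a more singular kernel that is still of the admissible type. -/
lemma abs_kernel_sub_le {ζ ε₁ ε₂ ε : ℝ} (hζ : 0 < ζ) (hb : b + ζ < 2) (h₁ : ε₁ ≤ ε) (h₂ : ε₂ ≤ ε)
    (hε : 0 ≤ ε) (p q : Mom) :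
    |kernel b ε₁ p q - kernel b ε₂ p q| ≤ ε ^ ζ * kernel (b + ζ) 0 p q := by
  have hρ := relMom_nonneg p q
  by_cases h : ε ≤ relMom p q
  · rw [kernel, kernel, if_pos (h₁.trans h), if_pos (h₂.trans h), sub_self, abs_zero]
    exact mul_nonneg (Real.rpow_nonneg hε _) (kernel_nonneg _ _ _ _)
  · have h3 : |kernel b ε₁ p q - kernel b ε₂ p q| ≤ kernel b 0 p q := by
      rw [abs_le]
      constructor <;> linarith [kernel_nonneg b ε₁ p q, kernel_nonneg b ε₂ p q,
        kernel_le_kernel_zero b ε₁ p q, kernel_le_kernel_zero b ε₂ p q]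
    refine h3.trans ?_
    rw [kernel_zero, kernel_zero, ← mul_div_assoc]
    gcongr
    have h4 : relMom p q ^ (2 - b) = relMom p q ^ ζ * relMom p q ^ (2 - (b + ζ)) := by
      rw [← Real.rpow_add_of_nonneg hρ hζ.le (by linarith)]
      congr 1; ring
    rw [h4]
    gcongr
    exact (not_le.1 h).le

/-- The loss term is bounded in the weight `1 + 1/p`. -/
lemma kernel_zero_mul_wt_le (hb₁ : 1 < b) (hb₂ : b < 2) (p q : Mom) :
    kernel b 0 p q * wt p ≤ 4 * (wtSq p * wt q) := by
  have h1 : ‖p‖ ^ (-(b / 2)) * wt p ≤ 2 * wtSq p := by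
    rcases eq_or_lt_of_le (norm_nonneg p) with h | h
    · rw [← h, Real.zero_rpow (by linarith), zero_mul]
      linarith [one_le_wtSq p]
    · have h2 := rpow_neg_le_wtSq (by linarith : 0 ≤ b / 2) (by linarith) p
      have h3 := rpow_neg_le_wtSq (by linarith : 0 ≤ b / 2 + 1) (by linarith) p
      rw [neg_add, Real.rpow_add h, Real.rpow_neg_one, ← one_div] at h3
      rw [wt, mul_add, mul_one]
      linarith
  have h2 := rpow_neg_le_wt (by linarith : 0 ≤ b / 2) (by linarith) q
  calc kernel b 0 p q * wt p ≤ 2 * (‖p‖ ^ (-(b / 2)) * ‖q‖ ^ (-(b / 2))) * wt p := by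
        gcongr
        · linarith [one_le_wt p]
        · exact kernel_zero_le hb₁ hb₂ p q
    _ = 2 * ((‖p‖ ^ (-(b / 2)) * wt p) * ‖q‖ ^ (-(b / 2))) := by ring
    _ ≤ 2 * ((2 * wtSq p) * wt q) := by
        gcongr
        linarith [one_le_wtSq p]
    _ = _ := by ring

/-- Here `r = (p + q + |p + q| t)/2` is the energy after the collision. The numerator `ϱ^(2-b)`
contributes `r^(1-b/2)`, which weakens `1/r` to `r^(-b/2)`; the lower bound of `r` turns this into
the integrable singularity `(1 + t)^(-b/2)` and a power of the total energy. As `b > 1`, that power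
is largest when the energy is replaced by `q`. Only one of the two momenta has to carry the stronger
weight. -/
lemma kernel_zero_div_le (hb₁ : 1 < b) (hb₂ : b < 2) (p q : Mom) {t : ℝ} (ht : t ∈ Ioc (-1 : ℝ) 1) :
    kernel b 0 p q * (1 + 1 / ((‖p‖ + ‖q‖ + ‖p + q‖ * t) / 2))
      ≤ 4 * (wt p * wtSq q) * (1 + (1 + t) ^ (-(b / 2))) := by
  have ht1 : 0 < 1 + t := by linarith [ht.1]
  have hw1 := one_le_wt p
  have hw2 := one_le_wtSq q
  have hA : kernel b 0 p q ≤ 4 * (wt p * wtSq q) := by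
    have h2 := rpow_neg_le_wt (by linarith : 0 ≤ b / 2) (by linarith) p
    have h3 := rpow_neg_le_wtSq (by linarith : 0 ≤ b / 2) (by linarith) q
    calc kernel b 0 p q ≤ 2 * (‖p‖ ^ (-(b / 2)) * ‖q‖ ^ (-(b / 2))) := kernel_zero_le hb₁ hb₂ p q
      _ ≤ 2 * (wt p * wtSq q) := by gcongr
      _ ≤ _ := by nlinarith
  have hB : kernel b 0 p q * (1 / ((‖p‖ + ‖q‖ + ‖p + q‖ * t) / 2))
      ≤ 4 * (wt p * wtSq q) * (1 + t) ^ (-(b / 2)) := by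
    have hC : (0 : ℝ) ≤ 4 * (wt p * wtSq q) * (1 + t) ^ (-(b / 2)) :=
      mul_nonneg (by positivity) (Real.rpow_nonneg ht1.le _)
    rcases eq_or_lt_of_le (norm_nonneg p) with hp | hp
    · rw [kernel_zero, ← hp]; simpa using hC
    rcases eq_or_lt_of_le (norm_nonneg q) with hq | hq
    · rw [kernel_zero, ← hq]; simpa using hC
    have hS := relMom_sq p q
    have hρ := relMom_nonneg p q
    have hn := norm_add_le p q
    have hP := norm_nonneg (p + q)
    obtain ⟨E, hE⟩ : ∃ E, E = ‖p‖ + ‖q‖ := ⟨_, rfl⟩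
    obtain ⟨r, hr⟩ : ∃ r, r = (‖p‖ + ‖q‖ + ‖p + q‖ * t) / 2 := ⟨_, rfl⟩
    have hE0 : 0 < E := by rw [hE]; positivity
    have hqE : ‖q‖ ≤ E := by linarith
    -- For `t ≥ 0` already `r ≥ E/2`; for `t ≤ 0` one has `r ≥ E(1 + t)/2` because `|p + q| ≤ E`.
    have hr1 : E * (1 + t) / 4 ≤ r := by
      rcases le_total 0 t with h | h
      · nlinarith [ht.2, mul_nonneg hP h]
      · nlinarith
    -- `ϱ² = (E - |p + q|)(E + |p + q|) ≤ 2E(E - |p + q|) ≤ 2E(E + |p + q| t) = 4Er`, since `t ≥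
    -- -1`.
    have hr2 : relMom p q ^ 2 ≤ 4 * E * r := by
      rw [hS, hr, ← hE]
      have : (E - ‖p + q‖) * (E + ‖p + q‖) ≤ (E - ‖p + q‖) * (2 * E) :=
        mul_le_mul_of_nonneg_left (by linarith) (by linarith)
      nlinarith [mul_nonneg hP ht1.le]
    have hr0 : 0 < r := lt_of_lt_of_le (by positivity) hr1
    have e1 : relMom p q ^ (2 - b) ≤ (4 * E * r) ^ (1 - b / 2) := by
      have h2 : relMom p q ^ (2 - b) = (relMom p q ^ 2) ^ (1 - b / 2) := by
        rw [← Real.rpow_natCast, ← Real.rpow_mul (relMom_nonneg p q)]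
        congr 1; push_cast; ring
      rw [h2]
      exact Real.rpow_le_rpow (sq_nonneg _) hr2 (by linarith)
    have e2 : relMom p q ^ (2 - b) * (1 / r) ≤ 4 * ‖q‖ ^ (1 - b) * (1 + t) ^ (-(b / 2)) := by
      calc relMom p q ^ (2 - b) * (1 / r) ≤ (4 * E * r) ^ (1 - b / 2) * (1 / r) := by gcongr
        _ = (4 * E) ^ (1 - b / 2) * r ^ (-(b / 2)) := by
            rw [Real.mul_rpow (by positivity) hr0.le, mul_assoc, one_div, ← Real.rpow_neg_one r,
              ← Real.rpow_add hr0]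
            congr 2; ring
        _ ≤ (4 * E) ^ (1 - b / 2) * (E * (1 + t) / 4) ^ (-(b / 2)) := by
            gcongr ?_ * ?_
            exact Real.rpow_le_rpow_of_nonpos (by positivity) hr1 (by linarith)
        _ = 4 * E ^ (1 - b) * (1 + t) ^ (-(b / 2)) := by
            rw [show E * (1 + t) / 4 = (4 : ℝ)⁻¹ * E * (1 + t) by ring,
              Real.mul_rpow (by positivity) ht1.le, Real.mul_rpow (by norm_num) hE0.le,
              Real.mul_rpow (by norm_num) hE0.le, Real.inv_rpow (by norm_num),
              ← Real.rpow_neg (by norm_num), neg_neg]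
            have h4 : (4 : ℝ) ^ (1 - b / 2) * 4 ^ (b / 2) = 4 := by
              rw [← Real.rpow_add (by norm_num)]; norm_num
            have h5 : E ^ (1 - b / 2) * E ^ (-(b / 2)) = E ^ (1 - b) := by
              rw [← Real.rpow_add hE0]; congr 1; ring
            rw [← h5]
            nth_rewrite 3 [← h4]
            ring
        _ ≤ 4 * ‖q‖ ^ (1 - b) * (1 + t) ^ (-(b / 2)) := by
            gcongr ?_ * ?_ * ?_
            exact Real.rpow_le_rpow_of_nonpos hq hqE (by linarith)
    rw [← hr, kernel_zero]
    calc relMom p q ^ (2 - b) / (‖p‖ * ‖q‖) * (1 / r)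
        = (relMom p q ^ (2 - b) * (1 / r)) / (‖p‖ * ‖q‖) := by ring
      _ ≤ (4 * ‖q‖ ^ (1 - b) * (1 + t) ^ (-(b / 2))) / (‖p‖ * ‖q‖) := by gcongr
      _ = 4 * (1 / ‖p‖ * ‖q‖ ^ (-b)) * (1 + t) ^ (-(b / 2)) := by
          rw [show 1 - b = -b + 1 by ring, Real.rpow_add_one hq.ne']
          field_simp
      _ ≤ 4 * (wt p * wtSq q) * (1 + t) ^ (-(b / 2)) := by
          gcongr
          · rw [wt]; linarith
          · exact rpow_neg_le_wtSq (by linarith) hb₂.le q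
  rw [mul_add, mul_add, mul_one, mul_one]
  exact add_le_add hA hB

/-- The angular average of the gain term is bounded in the weight `1 + 1/p`. -/
lemma exists_lintegral_kernel_wt_le (hb₁ : 1 < b) (hb₂ : b < 2) :
    ∃ C : ℝ, 0 < C ∧ ∀ p q : Mom,
      ∫⁻ ω : Dir, ENNReal.ofReal (kernel b 0 p q * wt (outMom p q ω))
        ∂(volume : Measure Mom).toSphere ≤ ENNReal.ofReal (C * (wt p * wtSq q)) := by
  have hJ := lintegral_one_add_rpow_lt_top (s := -(b / 2)) (by linarith)
  set J := ∫⁻ t in Icc (-1 : ℝ) 1, ENNReal.ofReal (1 + (1 + t) ^ (-(b / 2))) with hJdef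
  have hJfin : J < ∞ := by
    have : J ≤ ∫⁻ t in Icc (-1 : ℝ) 1, (1 + ENNReal.ofReal ((1 + t) ^ (-(b / 2)))) :=
      lintegral_mono fun t => by
        refine ENNReal.ofReal_add_le.trans ?_
        simp
    refine this.trans_lt ?_
    rw [lintegral_add_left measurable_const]
    exact ENNReal.add_lt_top.2 ⟨by simp, hJ⟩
  -- `8π` is `2π` from the projection of the sphere times `4` from the pointwise bound; the summand
  -- `1` makes positivity immediate.
  refine ⟨8 * Real.pi * J.toReal + 1, by positivity, fun p q => ?_⟩
  have hw : 0 ≤ wt p * wtSq q :=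
    mul_nonneg (zero_le_one.trans (one_le_wt p)) (zero_le_one.trans (one_le_wtSq q))
  simp only [wt, norm_outMom_dir]
  -- The endpoint `t = -1`, where the pointwise bound is not available, is removed as a null set.
  rw [lintegral_sphere_inner_right (p + q) (F := fun s => ENNReal.ofReal (kernel b 0 p q *
    (1 + 1 / ((‖p‖ + ‖q‖ + s) / 2)))) (by fun_prop), setLIntegral_congr Ioc_ae_eq_Icc.symm]
  have h1 : ∫⁻ t in Ioc (-1 : ℝ) 1, ENNReal.ofReal (kernel b 0 p q *
      (1 + 1 / ((‖p‖ + ‖q‖ + ‖p + q‖ * t) / 2)))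
      ≤ ∫⁻ t in Ioc (-1 : ℝ) 1, ENNReal.ofReal (4 * (wt p * wtSq q)) *
        ENNReal.ofReal (1 + (1 + t) ^ (-(b / 2))) := by
    refine setLIntegral_mono (by fun_prop) fun t ht => ?_
    rw [← ENNReal.ofReal_mul (by positivity)]
    exact ENNReal.ofReal_le_ofReal (kernel_zero_div_le hb₁ hb₂ p q ht)
  have hJ' : ∫⁻ t in Ioc (-1 : ℝ) 1, ENNReal.ofReal (1 + (1 + t) ^ (-(b / 2))) = J :=
    setLIntegral_congr Ioc_ae_eq_Icc
  rw [lintegral_const_mul _ (by fun_prop), hJ',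
    ← ENNReal.ofReal_toReal hJfin.ne, ← ENNReal.ofReal_mul (by positivity)] at h1
  refine (mul_le_mul_right h1 _).trans ?_
  rw [← ENNReal.ofReal_mul (by positivity)]
  refine ENNReal.ofReal_le_ofReal ?_
  change _ ≤ (8 * Real.pi * J.toReal + 1) * (wt p * wtSq q)
  nlinarith

end

end MasslessBoltzmann

/-! ### Pointwise estimates for the moments of order -2 and 2 -/

namespace MasslessBoltzmann

noncomputable section

variable {b : ℝ}

/-- The cosine of the angle between `p` and `q`. -/
def cosAngle (p q : Mom) : ℝ := inner ℝ (‖p‖⁻¹ • p) q / ‖q‖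

@[fun_prop]
lemma measurable_cosAngle : Measurable fun z : Mom × Mom => cosAngle z.1 z.2 := by
  unfold cosAngle; fun_prop

lemma relMom_sq_eq_cosAngle (p q : Mom) :
    relMom p q ^ 2 = 2 * (‖p‖ * ‖q‖) * (1 - cosAngle p q) := by
  have h : ‖p‖ * ‖q‖ * cosAngle p q = inner ℝ p q := by
    rcases eq_or_ne p 0 with rfl | hp
    · simp
    rcases eq_or_ne q 0 with rfl | hq
    · simp
    have := norm_ne_zero_iff.2 hp
    have := norm_ne_zero_iff.2 hq
    rw [cosAngle, real_inner_smul_left]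
    field_simp
  rw [relMom, Real.sq_sqrt (by linarith [real_inner_le_norm p q])]
  linarith

lemma cosAngle_mem (p q : Mom) : cosAngle p q ∈ Icc (-1 : ℝ) 1 := by
  have h1 := abs_real_inner_le_norm (‖p‖⁻¹ • p) q
  have h2 : ‖‖p‖⁻¹ • p‖ ≤ 1 := by
    rw [norm_smul, norm_inv, norm_norm]
    exact inv_mul_le_one
  rw [mem_Icc, ← abs_le, cosAngle, abs_div, abs_norm]
  exact div_le_one_of_le₀ (h1.trans (mul_le_of_le_one_left (norm_nonneg _) h2)) (norm_nonneg _)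

/-- The average over the angle between the arguments of an isotropic integrand. -/
lemma lintegral_lintegral_angular {F : Mom → ℝ≥0∞} {φ : ℝ → ℝ≥0∞}
    (hφ : Measurable φ) (hFφ : ∀ᵐ p, F p = φ ‖p‖) {B Θ : ℝ → ℝ≥0∞} (hB : Measurable B)
    (hΘ : Measurable Θ) {p : Mom} (hp : p ≠ 0) :
    ∫⁻ q, F q * B ‖q‖ * Θ (cosAngle p q)
      = (∫⁻ q, F q * B ‖q‖) * (2⁻¹ * ∫⁻ t in Icc (-1 : ℝ) 1, Θ t) := by
  have he : ‖‖p‖⁻¹ • p‖ = 1 := by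
    rw [norm_smul, norm_inv, norm_norm, inv_mul_cancel₀ (norm_ne_zero_iff.2 hp)]
  have h := lintegral_isotropic_mul_angular he (Φ := fun r => φ r * B r) (by fun_prop) hΘ
  rw [lintegral_congr_ae (g := fun q => φ ‖q‖ * B ‖q‖ * Θ (cosAngle p q)),
    lintegral_congr_ae (f := fun q => F q * B ‖q‖) (g := fun q => φ ‖q‖ * B ‖q‖)]
  · exact h
  · filter_upwards [hFφ] with q hq
    rw [hq]
  · filter_upwards [hFφ] with q hq
    rw [hq]

/-- The key estimate for the moment of order `-2`: the angular average of the regularized moment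
after the collision, minus the one before the collision. -/
lemma kernel_div_le (hb₁ : 1 < b) (hb₂ : b < 2) (ε : ℝ) (p q : Mom) {δ : ℝ} (hδ : 0 < δ) :
    kernel b ε p q * (1 / (relMom p q ^ 2 / 4 + (‖p‖ + ‖q‖) * δ + δ ^ 2))
      ≤ kernel b ε p q * ((1 / 2) * (((‖p‖ + δ) ^ 2)⁻¹ + ((‖q‖ + δ) ^ 2)⁻¹))
        + 8 * ((‖p‖ + δ) ^ (-(1 + b / 2)) * (‖q‖ + δ) ^ (-(1 + b / 2)))
          * (1 - cosAngle p q) ^ (-(b / 2)) := by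
  have hx := norm_nonneg p
  have hy := norm_nonneg q
  have hc := cosAngle_mem p q
  have hc1 : 0 ≤ 1 - cosAngle p q := by linarith [hc.2]
  have hρ := relMom_nonneg p q
  have hk := kernel_nonneg b ε p q
  have hk0 := kernel_le_kernel_zero b ε p q
  rw [kernel_zero] at hk0
  have hρ2 := relMom_sq_eq_cosAngle p q
  have hρ4 := relMom_sq_le p q
  set k := kernel b ε p q
  set x := ‖p‖
  set y := ‖q‖
  set c := cosAngle p q
  set ρ := relMom p q
  -- With this `D`, adding it to `xy` regularizes both energies at once: `xy + D = (x + δ)(y + δ)`.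
  obtain ⟨D, hD⟩ : ∃ D, D = (x + y) * δ + δ ^ 2 := ⟨_, rfl⟩
  have hD0 : 0 < D := by rw [hD]; positivity
  have hprod : x * y + D = (x + δ) * (y + δ) := by rw [hD]; ring
  rw [add_assoc, ← hD]
  have hrem : (0 : ℝ) ≤ 8 * ((x + δ) ^ (-(1 + b / 2)) * (y + δ) ^ (-(1 + b / 2)))
      * (1 - c) ^ (-(b / 2)) := by positivity
  -- For parallel momenta the kernel vanishes, as `2 - b > 0`.
  rcases eq_or_lt_of_le hρ with h0 | h0
  · have hk1 : k = 0 := by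
      refine le_antisymm (hk0.trans ?_) hk
      rw [← h0, Real.zero_rpow (by linarith), zero_div]
    rw [hk1]
    linarith
  have hxy : 0 < x * y := by nlinarith
  have hc2 : 0 < 1 - c := by
    rcases eq_or_lt_of_le hc1 with h | h
    · rw [← h, mul_zero] at hρ2; nlinarith
    · exact h
  -- The first summand is the product of the regularized inverse energies, at most the mean of their
  -- squares, and is balanced by the loss. The second summand contains the singularity in the angle.
  have h1 : 1 / (ρ ^ 2 / 4 + D) = 1 / (x * y + D)
      + (x * y - ρ ^ 2 / 4) / ((ρ ^ 2 / 4 + D) * (x * y + D)) := by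
    field_simp
    ring
  have h2 : 1 / (x * y + D) ≤ (1 / 2) * (((x + δ) ^ 2)⁻¹ + ((y + δ) ^ 2)⁻¹) := by
    rw [hprod]
    have : 1 / ((x + δ) * (y + δ)) = (x + δ)⁻¹ * (y + δ)⁻¹ := by
      rw [one_div, mul_inv]
    rw [this, ← inv_pow, ← inv_pow]
    nlinarith [sq_nonneg ((x + δ)⁻¹ - (y + δ)⁻¹)]
  -- Bounding the numerator by `xy` cancels the denominator of the kernel. It remains to distribute
  -- `ϱ^(2-b)`: one full power of `ϱ² + D` against the denominator, the power `-b/2` into energies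
  -- and angle.
  have h3 : k * ((x * y - ρ ^ 2 / 4) / ((ρ ^ 2 / 4 + D) * (x * y + D)))
      ≤ 8 * ((x + δ) ^ (-(1 + b / 2)) * (y + δ) ^ (-(1 + b / 2))) * (1 - c) ^ (-(b / 2)) := by
    have e1 : k * ((x * y - ρ ^ 2 / 4) / ((ρ ^ 2 / 4 + D) * (x * y + D)))
        ≤ ρ ^ (2 - b) / ((ρ ^ 2 / 4 + D) * (x * y + D)) := by
      calc _ ≤ ρ ^ (2 - b) / (x * y) * ((x * y) / ((ρ ^ 2 / 4 + D) * (x * y + D))) := by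
            gcongr
            · exact div_nonneg (by linarith) (by positivity)
            · nlinarith
        _ = _ := by
            rw [div_mul_div_comm, mul_comm (ρ ^ (2 - b)), mul_div_mul_left _ _ hxy.ne']
    have e2 : ρ ^ (2 - b) ≤ (ρ ^ 2 + D) * (ρ ^ 2 + D) ^ (-(b / 2)) := by
      have : ρ ^ (2 - b) = (ρ ^ 2) ^ (1 - b / 2) := by
        rw [← Real.rpow_natCast, ← Real.rpow_mul hρ]
        congr 1; push_cast; ring
      rw [this, mul_comm, ← Real.rpow_add_one (by positivity),
        show -(b / 2) + 1 = 1 - b / 2 by ring]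
      exact Real.rpow_le_rpow (sq_nonneg _) (by linarith) (by linarith)
    -- Since `ϱ² = 2xy(1 - c)` and `(1 - c)/2 ≤ 1`, both `ϱ²` and `D` dominate their share of `(1 -
    -- c)/2 * (xy + D)`.
    have e3 : (ρ ^ 2 + D) ^ (-(b / 2)) ≤ 2 * ((1 - c) ^ (-(b / 2)) * (x * y + D) ^ (-(b / 2))) := by
      have e4 : (1 - c) / 2 * (x * y + D) ≤ ρ ^ 2 + D := by
        rw [hρ2]
        nlinarith [hc.1, mul_pos hxy hc2]
      calc (ρ ^ 2 + D) ^ (-(b / 2)) ≤ ((1 - c) / 2 * (x * y + D)) ^ (-(b / 2)) :=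
            Real.rpow_le_rpow_of_nonpos (by positivity) e4 (by linarith)
        _ = 2 ^ (b / 2) * ((1 - c) ^ (-(b / 2)) * (x * y + D) ^ (-(b / 2))) := by
            rw [show (1 - c) / 2 * (x * y + D) = 2⁻¹ * ((1 - c) * (x * y + D)) by ring,
              Real.mul_rpow (by norm_num) (by positivity), Real.mul_rpow hc1 (by positivity),
              Real.inv_rpow (by norm_num), ← Real.rpow_neg (by norm_num), neg_neg]
        _ ≤ _ := by
            gcongr
            exact (Real.rpow_le_rpow_of_exponent_le (by norm_num) (by linarith : b / 2 ≤ 1)).trans_eq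
              (Real.rpow_one 2)
    have e5 : (x * y + D)⁻¹ * (x * y + D) ^ (-(b / 2))
        = (x + δ) ^ (-(1 + b / 2)) * (y + δ) ^ (-(1 + b / 2)) := by
      rw [← Real.mul_rpow (by positivity) (by positivity), ← hprod, neg_add,
        Real.rpow_add (by positivity), Real.rpow_neg_one]
    calc _ ≤ ρ ^ (2 - b) / ((ρ ^ 2 / 4 + D) * (x * y + D)) := e1
      _ ≤ ((ρ ^ 2 + D) * (2 * ((1 - c) ^ (-(b / 2)) * (x * y + D) ^ (-(b / 2)))))
          / ((ρ ^ 2 / 4 + D) * (x * y + D)) := by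
          gcongr
          exact e2.trans (by gcongr)
      _ = ((ρ ^ 2 + D) / (ρ ^ 2 / 4 + D)) * (2 * ((x * y + D)⁻¹ * (x * y + D) ^ (-(b / 2)))
          * (1 - c) ^ (-(b / 2))) := by field_simp
      -- The quotient of `ϱ² + D` and `ϱ²/4 + D` is at most `4`; with `2^(b/2) ≤ 2` this explains
      -- the constant `8`.
      _ ≤ 4 * (2 * ((x * y + D)⁻¹ * (x * y + D) ^ (-(b / 2))) * (1 - c) ^ (-(b / 2))) := by
          gcongr
          rw [div_le_iff₀ (by positivity)]
          linarith
      _ = _ := by rw [e5]; ring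
  rw [h1, mul_add]
  gcongr

/-- The growth of the truncated energy-squared moment in a collision. -/
lemma kernel_mul_min_le (hb₁ : 1 < b) (hb₂ : b < 2) {n : ℝ} (hn : 1 ≤ n) (p q : Mom) (ω : Dir) :
    kernel b 0 p q * min (‖outMom p q ω‖ ^ 2) (n ^ 2)
      ≤ 8 * ((1 + min (‖p‖ ^ 2) (n ^ 2)) * wtSq q + wtSq p * (1 + min (‖q‖ ^ 2) (n ^ 2))) := by
  have hx := norm_nonneg p
  have hy := norm_nonneg q
  have hm : ∀ x : ℝ, 0 ≤ min (x ^ 2) (n ^ 2) := fun x => le_min (sq_nonneg _) (sq_nonneg _)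
  -- The outgoing energy is at most `p + q`, hence at most twice the larger incoming one. The
  -- truncation level `n²` may be enlarged to `4n²`, so truncation and doubling are compatible.
  have h1 : min (‖outMom p q ω‖ ^ 2) (n ^ 2) ≤ 4 * (min (‖p‖ ^ 2) (n ^ 2) + min (‖q‖ ^ 2) (n ^ 2)) := by
    have h0 : ‖outMom p q ω‖ ≤ ‖p‖ + ‖q‖ := by
      rw [norm_outMom_dir]
      have h3 := le_of_abs_le (abs_real_inner_le_norm (p + q) (ω : Mom))
      have h4 : ‖(ω : Mom)‖ = 1 := by simp
      rw [h4, mul_one] at h3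
      linarith [norm_add_le p q]
    have h2 : ∀ z : ℝ, 0 ≤ z → ‖outMom p q ω‖ ≤ 2 * z →
        min (‖outMom p q ω‖ ^ 2) (n ^ 2) ≤ 4 * min (z ^ 2) (n ^ 2) := by
      intro z hz hz2
      rw [mul_min_of_nonneg _ _ (by norm_num : (0 : ℝ) ≤ 4)]
      refine min_le_min ?_ ?_
      · nlinarith [norm_nonneg (outMom p q ω)]
      · nlinarith [sq_nonneg n]
    rcases le_total ‖p‖ ‖q‖ with h | h
    · linarith [h2 ‖q‖ hy (by linarith), hm ‖p‖]
    · linarith [h2 ‖p‖ hx (by linarith), hm ‖q‖]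
  have h2 : ∀ r : Mom, ‖r‖ ^ (-(b / 2)) * min (‖r‖ ^ 2) (n ^ 2) ≤ 1 + min (‖r‖ ^ 2) (n ^ 2) := by
    intro r
    rcases eq_or_lt_of_le (norm_nonneg r) with h | h
    · rw [← h, Real.zero_rpow (by linarith), zero_mul]
      linarith [hm 0]
    rcases le_total ‖r‖ 1 with h1 | h1
    · have : ‖r‖ ^ (-(b / 2)) * ‖r‖ ^ 2 ≤ 1 := by
        rw [← Real.rpow_natCast, ← Real.rpow_add h]
        exact Real.rpow_le_one h.le h1 (by push_cast; linarith)
      have h5 : ‖r‖ ^ (-(b / 2)) * min (‖r‖ ^ 2) (n ^ 2) ≤ ‖r‖ ^ (-(b / 2)) * ‖r‖ ^ 2 := by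
        gcongr
        exact min_le_left _ _
      linarith [hm ‖r‖]
    · have := Real.rpow_le_one_of_one_le_of_nonpos h1 (by linarith : -(b / 2) ≤ 0)
      nlinarith [hm ‖r‖]
  have h3 : ∀ r : Mom, ‖r‖ ^ (-(b / 2)) ≤ wtSq r :=
    rpow_neg_le_wtSq (by linarith) (by linarith)
  have hp0 : (0 : ℝ) ≤ ‖p‖ ^ (-(b / 2)) := by positivity
  have hq0 : (0 : ℝ) ≤ ‖q‖ ^ (-(b / 2)) := by positivity
  calc _ ≤ (2 * (‖p‖ ^ (-(b / 2)) * ‖q‖ ^ (-(b / 2))))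
        * (4 * (min (‖p‖ ^ 2) (n ^ 2) + min (‖q‖ ^ 2) (n ^ 2))) := by
        gcongr
        exact kernel_zero_le hb₁ hb₂ p q
    _ = 8 * ((‖p‖ ^ (-(b / 2)) * min (‖p‖ ^ 2) (n ^ 2)) * ‖q‖ ^ (-(b / 2))
        + ‖p‖ ^ (-(b / 2)) * (‖q‖ ^ (-(b / 2)) * min (‖q‖ ^ 2) (n ^ 2))) := by ring
    _ ≤ _ := by
        have := hm ‖p‖
        have := hm ‖q‖
        have := one_le_wtSq p
        gcongr
        · exact h2 p
        · exact h3 q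
        · exact h3 p
        · exact h2 q

end

end MasslessBoltzmann

/-! ### Weak form and integral estimates of gain and loss -/

namespace MasslessBoltzmann

noncomputable section

variable {b : ℝ}

@[fun_prop]
lemma measurable_outMom_triple : Measurable fun z : Mom × Mom × Dir => outMom z.1 z.2.1 z.2.2 :=
  measurable_outMom.comp (f := fun z : Mom × Mom × Dir => (z.1, z.2.1, (z.2.2 : Mom)))
    (by fun_prop)

@[fun_prop]
lemma measurable_outMom'_triple : Measurable fun z : Mom × Mom × Dir => outMom' z.1 z.2.1 z.2.2 :=
  measurable_outMom.comp (f := fun z : Mom × Mom × Dir => (z.1, z.2.1, -(z.2.2 : Mom)))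
    (by fun_prop)

@[fun_prop]
lemma measurable_outMom_right (p : Mom) : Measurable fun x : Mom × Dir => outMom p x.1 x.2 :=
  measurable_outMom_triple.comp (f := fun x : Mom × Dir => (p, x)) (by fun_prop)

@[fun_prop]
lemma measurable_outMom'_right (p : Mom) : Measurable fun x : Mom × Dir => outMom' p x.1 x.2 :=
  measurable_outMom'_triple.comp (f := fun x : Mom × Dir => (p, x)) (by fun_prop)

@[fun_prop]
lemma measurable_outMom_dir (p q : Mom) : Measurable fun ω : Dir => outMom p q ω :=
  measurable_outMom_triple.comp (f := fun ω : Dir => (p, q, ω)) (by fun_prop)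

lemma outMom_comm (p q ω : Mom) : outMom p q ω = outMom q p ω := by
  rw [outMom, outMom, relMom_comm, add_comm p, add_comm ‖p‖]

lemma lintegral_triple_const {Ψ : Mom × Mom → ℝ≥0∞} (hΨ : Measurable Ψ) :
    ∫⁻ z, Ψ (z.1, z.2.1) ∂tripleMeasure
      = ENNReal.ofReal (4 * Real.pi) * ∫⁻ p : Mom, ∫⁻ q : Mom, Ψ (p, q) := by
  rw [lintegral_triple (Φ := fun z => Ψ (z.1, z.2.1)) (by fun_prop)]
  simp only [lintegral_const, toSphere_univ]
  rw [← lintegral_const_mul _ (by fun_prop)]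
  refine lintegral_congr fun p => ?_
  rw [lintegral_mul_const _ (by fun_prop), mul_comm]

/-- The weak form of the gain term. -/
lemma lintegral_gain_weight (b ε : ℝ) {F G W : Mom → ℝ≥0∞} (hF : Measurable F) (hG : Measurable G)
    (hW : Measurable W) :
    ∫⁻ z, ENNReal.ofReal (kernel b ε z.1 z.2.1) *
        (F (outMom z.1 z.2.1 z.2.2) * G (outMom' z.1 z.2.1 z.2.2)) * W z.1 ∂tripleMeasure
      = ∫⁻ p : Mom, ∫⁻ q : Mom, F p * G q * ∫⁻ ω : Dir, ENNReal.ofReal (kernel b ε p q) *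
          W (outMom p q ω) ∂(volume : Measure Mom).toSphere := by
  -- Apart from the invariant density `1/(pq)`, the kernel is a function of `ϱ`, which the collision
  -- does not change.
  have hk : ∀ p q : Mom, ENNReal.ofReal (kernel b ε p q) = ENNReal.ofReal (1 / (‖p‖ * ‖q‖)) *
      ENNReal.ofReal (if ε ≤ relMom p q then relMom p q ^ (2 - b) else 0) := fun p q => by
    rw [← ENNReal.ofReal_mul (by positivity), kernel]
    congr 1
    split_ifs
    · ring
    · simp
  have hkm : Measurable fun r : ℝ => ENNReal.ofReal (if ε ≤ r then r ^ (2 - b) else 0) :=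
    (Measurable.ite (measurableSet_le measurable_const measurable_id) (by fun_prop)
      measurable_const).ennreal_ofReal
  have h := lintegral_collision_swap (H := fun x : ℝ × (Mom × Mom) × Mom × Mom =>
    ENNReal.ofReal (if ε ≤ x.1 then x.1 ^ (2 - b) else 0) * (F x.2.1.1 * G x.2.1.2) * W x.2.2.1)
    (((hkm.comp measurable_fst).mul (by fun_prop)).mul (by fun_prop))
  simp only [← mul_assoc, ← hk] at h ⊢
  rw [h, lintegral_triple (by fun_prop)]
  refine lintegral_congr fun p => lintegral_congr fun q => ?_
  rw [← lintegral_const_mul _ (by fun_prop)]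
  refine lintegral_congr fun ω => ?_
  ring

/-- The weak form with weight `1`: total gain and total loss coincide. This is conservation of the
number of particles, and it controls the gain by the loss. -/
lemma lintegral_gain (b ε : ℝ) {F G : Mom → ℝ≥0∞} (hF : Measurable F) (hG : Measurable G) :
    ∫⁻ z, ENNReal.ofReal (kernel b ε z.1 z.2.1) *
        (F (outMom z.1 z.2.1 z.2.2) * G (outMom' z.1 z.2.1 z.2.2)) ∂tripleMeasure
      = ∫⁻ z, ENNReal.ofReal (kernel b ε z.1 z.2.1) * (F z.1 * G z.2.1) ∂tripleMeasure := by
  have h := lintegral_gain_weight b ε hF hG (W := fun _ => 1) measurable_const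
  simp only [mul_one, lintegral_const, toSphere_univ] at h
  rw [h, lintegral_triple_const
    (Ψ := fun x => ENNReal.ofReal (kernel b ε x.1 x.2) * (F x.1 * G x.2)) (by fun_prop),
    ← lintegral_const_mul _ (by fun_prop)]
  refine lintegral_congr fun p => ?_
  rw [← lintegral_const_mul _ (by fun_prop)]
  refine lintegral_congr fun q => ?_
  ring

/-- Null sets of momenta are not seen by the momenta after the collision. -/
lemma ae_outMom {s : Mom → Prop} (hs : ∀ᵐ p, s p) :
    ∀ᵐ z ∂tripleMeasure, s (outMom z.1 z.2.1 z.2.2) ∧ s (outMom' z.1 z.2.1 z.2.2) ∧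
      s z.1 ∧ s z.2.1 := by
  obtain ⟨N, hsN, hN, hN0⟩ := exists_measurable_superset_of_null (mem_ae_iff.1 hs)
  set χ : Mom → ℝ≥0∞ := N.indicator (fun _ => 1) with hχ
  have hχm : Measurable χ := measurable_const.indicator hN
  have hχ0 : ∫⁻ p, χ p = 0 := by rw [lintegral_indicator hN]; simp [hN0]
  have hc : ∀ p, χ p = 0 → s p := fun p hp => by
    by_contra h
    have : p ∈ N := hsN h
    simp [hχ, this] at hp
  -- The invariance of the collision measure is applied to the indicator function of a null set.
  have h1 : ∫⁻ z, ENNReal.ofReal (1 / (‖z.1‖ * ‖z.2.1‖)) * (χ z.1 + χ z.2.1) ∂tripleMeasure = 0 := by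
    rw [lintegral_triple_const (Ψ := fun x => ENNReal.ofReal (1 / (‖x.1‖ * ‖x.2‖)) * (χ x.1 + χ x.2))
      (by fun_prop)]
    have : ∀ᵐ p, ∫⁻ q : Mom, ENNReal.ofReal (1 / (‖p‖ * ‖q‖)) * (χ p + χ q) = 0 := by
      filter_upwards [(lintegral_eq_zero_iff hχm).1 hχ0] with p hp
      rw [lintegral_eq_zero_iff (by fun_prop)]
      filter_upwards [(lintegral_eq_zero_iff hχm).1 hχ0] with q hq
      simp only [Pi.zero_apply] at hp hq ⊢
      rw [hp, hq]; simp
    rw [lintegral_congr_ae this]; simp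
  have h2 := lintegral_collision_swap (H := fun x : ℝ × (Mom × Mom) × Mom × Mom =>
    χ x.2.1.1 + χ x.2.1.2) (by fun_prop)
  simp only at h2
  rw [h1, lintegral_eq_zero_iff (by fun_prop)] at h2
  rw [lintegral_eq_zero_iff (by fun_prop)] at h1
  -- The density `1/(pq)` is positive only if both momenta are nonzero, so the others are discarded
  -- as a null set.
  have h0 : ∀ᵐ z ∂tripleMeasure, z.1 ≠ 0 ∧ z.2.1 ≠ 0 := by
    have h3 : ∀ᵐ p : Mom, p ≠ 0 := by
      rw [ae_iff]; simp
    rw [tripleMeasure, collisionMeasure]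
    refine (Measure.quasiMeasurePreserving_fst.ae h3).and ?_
    exact (Measure.quasiMeasurePreserving_snd (μ := (volume : Measure Mom))
      (ν := (volume : Measure Mom).prod (volume : Measure Mom).toSphere)).ae
      ((Measure.quasiMeasurePreserving_fst (μ := (volume : Measure Mom))
        (ν := (volume : Measure Mom).toSphere)).ae h3)
  filter_upwards [h0, h1, h2] with z ⟨hp, hq⟩ e1 e2
  have hpos : ENNReal.ofReal (1 / (‖z.1‖ * ‖z.2.1‖)) ≠ 0 := by
    have := norm_pos_iff.2 hp
    have := norm_pos_iff.2 hq
    rw [ne_eq, ENNReal.ofReal_eq_zero, not_le]; positivity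
  simp only [Pi.zero_apply, mul_eq_zero, hpos, false_or, add_eq_zero] at e1 e2
  exact ⟨hc _ e2.1, hc _ e2.2, hc _ e1.1, hc _ e1.2⟩

/-- Two forms, as either factor may carry the weight of order `-2`. In the comparison of solutions
this must be the solution, while the difference is known only with weight `1 + 1/p`. -/
lemma exists_lintegral_gain_wt_le (hb₁ : 1 < b) (hb₂ : b < 2) :
    ∃ C : ℝ≥0∞, C ≠ ∞ ∧ ∀ F G : Mom → ℝ≥0∞, Measurable F → Measurable G →
      ∫⁻ z, ENNReal.ofReal (kernel b 0 z.1 z.2.1) *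
          (F (outMom z.1 z.2.1 z.2.2) * G (outMom' z.1 z.2.1 z.2.2)) * ENNReal.ofReal (wt z.1)
          ∂tripleMeasure
        ≤ C * ((∫⁻ p, F p * ENNReal.ofReal (wt p)) * ∫⁻ p, G p * ENNReal.ofReal (wtSq p)) ∧
      ∫⁻ z, ENNReal.ofReal (kernel b 0 z.1 z.2.1) *
          (F (outMom z.1 z.2.1 z.2.2) * G (outMom' z.1 z.2.1 z.2.2)) * ENNReal.ofReal (wt z.1)
          ∂tripleMeasure
        ≤ C * ((∫⁻ p, F p * ENNReal.ofReal (wtSq p)) * ∫⁻ p, G p * ENNReal.ofReal (wt p)) := by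
  obtain ⟨C, hC, h⟩ := exists_lintegral_kernel_wt_le hb₁ hb₂
  refine ⟨ENNReal.ofReal C, ENNReal.ofReal_ne_top, fun F G hF hG => ?_⟩
  rw [lintegral_gain_weight b 0 hF hG (W := fun p => ENNReal.ofReal (wt p)) (by fun_prop)]
  have hw : ∀ p, 0 ≤ wt p := fun p => zero_le_one.trans (one_le_wt p)
  have hw2 : ∀ p, 0 ≤ wtSq p := fun p => zero_le_one.trans (one_le_wtSq p)
  have key : ∀ p q : Mom, ∫⁻ ω : Dir, ENNReal.ofReal (kernel b 0 p q) *
      ENNReal.ofReal (wt (outMom p q ω)) ∂(volume : Measure Mom).toSphere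
      ≤ ENNReal.ofReal C * (ENNReal.ofReal (wt p) * ENNReal.ofReal (wtSq q)) := fun p q => by
    rw [← ENNReal.ofReal_mul (hw p), ← ENNReal.ofReal_mul hC.le]
    simpa only [ENNReal.ofReal_mul (kernel_nonneg b 0 p q)] using h p q
  have key' : ∀ p q : Mom, ∫⁻ ω : Dir, ENNReal.ofReal (kernel b 0 p q) *
      ENNReal.ofReal (wt (outMom p q ω)) ∂(volume : Measure Mom).toSphere
      ≤ ENNReal.ofReal C * (ENNReal.ofReal (wtSq p) * ENNReal.ofReal (wt q)) := fun p q => by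
    simp_rw [outMom_comm p q, kernel_comm b 0 p q]
    rw [mul_comm (ENNReal.ofReal (wtSq p))]
    exact key q p
  have e : ∀ u v : Mom → ℝ≥0∞, Measurable u → Measurable v →
      ∫⁻ p, ∫⁻ q, F p * G q * (ENNReal.ofReal C * (u p * v q))
        = ENNReal.ofReal C * ((∫⁻ p, F p * u p) * ∫⁻ q, G q * v q) := fun u v hu hv => by
    rw [← lintegral_mul_const _ (by fun_prop), ← lintegral_const_mul _ (by fun_prop)]
    refine lintegral_congr fun p => ?_
    rw [← lintegral_const_mul _ (by fun_prop), ← lintegral_const_mul _ (by fun_prop)]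
    refine lintegral_congr fun q => ?_
    ring
  constructor
  · rw [← e _ _ (by fun_prop) (by fun_prop)]
    gcongr with p q
    exact key p q
  · rw [← e _ _ (by fun_prop) (by fun_prop)]
    gcongr with p q
    exact key' p q

/-- The stronger weight necessarily falls on the function evaluated at `p`. The estimate therefore
suits the part of the loss with the difference at `q`, but not the part with the difference at `p`.
-/
lemma lintegral_loss_wt_le (hb₁ : 1 < b) (hb₂ : b < 2) {F G : Mom → ℝ≥0∞} (hF : Measurable F)
    (hG : Measurable G) :
    ∫⁻ z, ENNReal.ofReal (kernel b 0 z.1 z.2.1) * (F z.1 * G z.2.1) * ENNReal.ofReal (wt z.1)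
        ∂tripleMeasure
      ≤ ENNReal.ofReal (16 * Real.pi) *
        ((∫⁻ p, F p * ENNReal.ofReal (wtSq p)) * ∫⁻ p, G p * ENNReal.ofReal (wt p)) := by
  have h16 : ENNReal.ofReal (16 * Real.pi) = ENNReal.ofReal (4 * Real.pi) * ENNReal.ofReal 4 := by
    rw [← ENNReal.ofReal_mul (by positivity)]
    congr 1; ring
  rw [lintegral_triple_const (Ψ := fun x => ENNReal.ofReal (kernel b 0 x.1 x.2) * (F x.1 * G x.2)
    * ENNReal.ofReal (wt x.1)) (by fun_prop), h16, mul_assoc]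
  refine mul_le_mul_right ?_ _
  rw [← lintegral_mul_const _ (by fun_prop), ← lintegral_const_mul _ (by fun_prop)]
  refine lintegral_mono fun p => ?_
  rw [← lintegral_const_mul _ (by fun_prop), ← lintegral_const_mul _ (by fun_prop)]
  refine lintegral_mono fun q => ?_
  have h := ENNReal.ofReal_le_ofReal (kernel_zero_mul_wt_le hb₁ hb₂ p q)
  rw [ENNReal.ofReal_mul (kernel_nonneg b 0 p q), ENNReal.ofReal_mul (by norm_num),
    ENNReal.ofReal_mul (zero_le_one.trans (one_le_wtSq p))] at h
  calc _ = F p * G q * (ENNReal.ofReal (kernel b 0 p q) * ENNReal.ofReal (wt p)) := by ring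
    _ ≤ F p * G q * (ENNReal.ofReal 4 * (ENNReal.ofReal (wtSq p) * ENNReal.ofReal (wt q))) := by
        gcongr
    _ = _ := by ring

/-- The gain of the moment of order `-2`, regularized at zero momentum, exceeds the loss at most
by a quadratic quantity. -/
lemma exists_lintegral_gain_inv_sq_le (hb₁ : 1 < b) (hb₂ : b < 2) :
    ∃ C : ℝ≥0∞, C ≠ ∞ ∧ ∀ (ε δ : ℝ) (F : Mom → ℝ≥0∞) (φ : ℝ → ℝ≥0∞), 0 < δ → Measurable F →
      Measurable φ → (∀ᵐ p, F p = φ ‖p‖) →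
      ∫⁻ z, ENNReal.ofReal (kernel b ε z.1 z.2.1) *
          (F (outMom z.1 z.2.1 z.2.2) * F (outMom' z.1 z.2.1 z.2.2)) *
          ENNReal.ofReal (1 + ((‖z.1‖ + δ) ^ 2)⁻¹) ∂tripleMeasure
        ≤ ∫⁻ z, ENNReal.ofReal (kernel b ε z.1 z.2.1) * (F z.1 * F z.2.1) *
            ENNReal.ofReal (1 + ((‖z.1‖ + δ) ^ 2)⁻¹) ∂tripleMeasure
          + C * (∫⁻ p, F p * ENNReal.ofReal (1 + ((‖p‖ + δ) ^ 2)⁻¹)) ^ 2 := by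
  set Θ : ℝ → ℝ≥0∞ := fun t => ENNReal.ofReal ((1 - t) ^ (-(b / 2))) with hΘ
  have hΘm : Measurable Θ := by rw [hΘ]; fun_prop
  set A : ℝ≥0∞ := 2⁻¹ * ∫⁻ t in Icc (-1 : ℝ) 1, Θ t with hA
  have hAfin : A ≠ ∞ := ENNReal.mul_ne_top (by simp)
    (lintegral_one_sub_rpow_lt_top (s := -(b / 2)) (by linarith)).ne
  refine ⟨ENNReal.ofReal (4 * Real.pi) * (8 * A), ENNReal.mul_ne_top ENNReal.ofReal_ne_top
    (ENNReal.mul_ne_top (by simp) hAfin), fun ε δ F φ hδ hF hφ hFφ => ?_⟩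
  set W : Mom → ℝ := fun p => ((‖p‖ + δ) ^ 2)⁻¹ with hW
  have hWm : Measurable W := by rw [hW]; fun_prop
  have hW0 : ∀ p, 0 ≤ W p := fun p => by rw [hW]; positivity
  -- The weight of the remainder in `kernel_div_le`. Its exponent lies between `-2` and `0`, hence
  -- it is dominated by `1 + W`, uniformly in `δ`.
  set ψ : ℝ → ℝ := fun r => (r + δ) ^ (-(1 + b / 2)) with hψ
  have hψm : Measurable ψ := by rw [hψ]; fun_prop
  have hψ0 : ∀ p : Mom, 0 ≤ ψ ‖p‖ := fun p => by rw [hψ]; positivity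
  have hψW : ∀ p : Mom, ψ ‖p‖ ≤ 1 + W p := fun p => by
    have h0 : 0 < ‖p‖ + δ := by positivity
    rcases le_total (‖p‖ + δ) 1 with h1 | h1
    · have := Real.rpow_le_rpow_of_exponent_ge h0 h1 (by linarith : (-2 : ℝ) ≤ -(1 + b / 2))
      rw [Real.rpow_neg h0.le 2, Real.rpow_two] at this
      simp only [hψ, hW]; linarith
    · have := Real.rpow_le_one_of_one_le_of_nonpos h1 (by linarith : -(1 + b / 2) ≤ 0)
      have := hW0 p
      simp only [hψ]; linarith
  have hM : Measurable fun p : Mom => ENNReal.ofReal (1 + W p) := by fun_prop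
  rw [lintegral_gain_weight b ε hF hF hM, lintegral_triple_const
    (Ψ := fun x => ENNReal.ofReal (kernel b ε x.1 x.2) * (F x.1 * F x.2) * ENNReal.ofReal (1 + W x.1))
    (by fun_prop)]
  have hpt : ∀ p q : Mom, ∫⁻ ω : Dir, ENNReal.ofReal (kernel b ε p q) *
      ENNReal.ofReal (1 + W (outMom p q ω)) ∂(volume : Measure Mom).toSphere
      ≤ ENNReal.ofReal (4 * Real.pi) * (2⁻¹ * (ENNReal.ofReal (kernel b ε p q) *
          (ENNReal.ofReal (1 + W p) + ENNReal.ofReal (1 + W q)))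
        + 8 * (ENNReal.ofReal (ψ ‖p‖) * ENNReal.ofReal (ψ ‖q‖) * Θ (cosAngle p q))) := fun p q => by
    have hk := kernel_nonneg b ε p q
    have hD : 0 < relMom p q ^ 2 / 4 + (‖p‖ + ‖q‖) * δ + δ ^ 2 := by positivity
    have hc : 0 ≤ 1 - cosAngle p q := by linarith [(cosAngle_mem p q).2]
    have h1 : ∫⁻ ω : Dir, ENNReal.ofReal (kernel b ε p q) *
        ENNReal.ofReal (1 + W (outMom p q ω)) ∂(volume : Measure Mom).toSphere
        = ENNReal.ofReal (4 * Real.pi * (kernel b ε p q + kernel b ε p q *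
          (1 / (relMom p q ^ 2 / 4 + (‖p‖ + ‖q‖) * δ + δ ^ 2)))) := by
      simp_rw [ENNReal.ofReal_add zero_le_one (hW0 _)]
      rw [lintegral_const_mul _ (by fun_prop), lintegral_add_left measurable_const, hW,
        lintegral_norm_outMom_add_inv_sq p q hδ, lintegral_const, toSphere_univ,
        ENNReal.ofReal_one, one_mul, ← ENNReal.ofReal_add (by positivity) (by positivity),
        ← ENNReal.ofReal_mul hk]
      congr 1
      field_simp
    rw [h1, ENNReal.ofReal_mul (by positivity)]
    gcongr
    have h2 := kernel_div_le hb₁ hb₂ ε p q hδ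
    have h3 : kernel b ε p q + kernel b ε p q *
          (1 / (relMom p q ^ 2 / 4 + (‖p‖ + ‖q‖) * δ + δ ^ 2))
        ≤ (1 / 2) * (kernel b ε p q * ((1 + W p) + (1 + W q)))
          + 8 * (ψ ‖p‖ * ψ ‖q‖ * (1 - cosAngle p q) ^ (-(b / 2))) := by
      simp only [hW, hψ]
      linarith
    refine (ENNReal.ofReal_le_ofReal h3).trans_eq ?_
    have := hW0 p
    have := hW0 q
    have := hψ0 p
    have := hψ0 q
    rw [ENNReal.ofReal_add (by positivity) (by positivity), ENNReal.ofReal_mul (by norm_num),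
      ENNReal.ofReal_mul hk, ENNReal.ofReal_add (by positivity) (by positivity),
      ENNReal.ofReal_mul (by norm_num : (0 : ℝ) ≤ 8), ENNReal.ofReal_mul (by positivity),
      ENNReal.ofReal_mul (hψ0 p)]
    simp [hΘ]
  have hstep : ∫⁻ p, ∫⁻ q, F p * F q * ∫⁻ ω : Dir, ENNReal.ofReal (kernel b ε p q) *
      ENNReal.ofReal (1 + W (outMom p q ω)) ∂(volume : Measure Mom).toSphere
      ≤ ENNReal.ofReal (4 * Real.pi) * ∫⁻ p, ∫⁻ q, (2⁻¹ * (ENNReal.ofReal (kernel b ε p q) *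
          (F p * F q) * ENNReal.ofReal (1 + W p)) + 2⁻¹ * (ENNReal.ofReal (kernel b ε p q) *
          (F p * F q) * ENNReal.ofReal (1 + W q)) + 8 * (F p * ENNReal.ofReal (ψ ‖p‖)) *
          (F q * ENNReal.ofReal (ψ ‖q‖) * Θ (cosAngle p q))) := by
    rw [← lintegral_const_mul _ (by fun_prop)]
    refine lintegral_mono fun p => ?_
    rw [← lintegral_const_mul _ (by fun_prop)]
    refine lintegral_mono fun q => (mul_le_mul_right (hpt p q) _).trans_eq ?_
    ring
  refine hstep.trans ?_
  -- The kernel is symmetric, so the two halves of the mean of the weights at `p` and `q` add up to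
  -- exactly the loss term.
  have hsym : ∫⁻ p, ∫⁻ q, ENNReal.ofReal (kernel b ε p q) * (F p * F q) * ENNReal.ofReal (1 + W q)
      = ∫⁻ p, ∫⁻ q, ENNReal.ofReal (kernel b ε p q) * (F p * F q) * ENNReal.ofReal (1 + W p) := by
    rw [lintegral_lintegral_swap (by fun_prop)]
    refine lintegral_congr fun p => lintegral_congr fun q => ?_
    rw [kernel_comm, mul_comm (F q)]
  -- Isotropy enters here: the angular factor separates and integrates to the constant `A`, finite
  -- because `b/2 < 1`.
  have hang : ∫⁻ p, ∫⁻ q, 8 * (F p * ENNReal.ofReal (ψ ‖p‖)) *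
          (F q * ENNReal.ofReal (ψ ‖q‖) * Θ (cosAngle p q))
      = 8 * A * (∫⁻ p, F p * ENNReal.ofReal (ψ ‖p‖)) ^ 2 := by
    rw [sq, ← mul_assoc, ← lintegral_const_mul _ (by fun_prop)]
    refine lintegral_congr_ae ?_
    have h3 : ∀ᵐ p : Mom, p ≠ 0 := by
      rw [ae_iff]; simp
    filter_upwards [h3] with p hp
    rw [lintegral_const_mul _ (by fun_prop), lintegral_lintegral_angular hφ hFφ
      (B := fun r => ENNReal.ofReal (ψ r)) (by fun_prop) hΘm hp]
    ring
  have hlast : ∫⁻ p, F p * ENNReal.ofReal (ψ ‖p‖) ≤ ∫⁻ p, F p * ENNReal.ofReal (1 + W p) := by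
    gcongr with p
    exact hψW p
  have hsplit : ∫⁻ p, ∫⁻ q, (2⁻¹ * (ENNReal.ofReal (kernel b ε p q) *
          (F p * F q) * ENNReal.ofReal (1 + W p)) + 2⁻¹ * (ENNReal.ofReal (kernel b ε p q) *
          (F p * F q) * ENNReal.ofReal (1 + W q)) + 8 * (F p * ENNReal.ofReal (ψ ‖p‖)) *
          (F q * ENNReal.ofReal (ψ ‖q‖) * Θ (cosAngle p q)))
      = 2⁻¹ * (∫⁻ p, ∫⁻ q, ENNReal.ofReal (kernel b ε p q) * (F p * F q) * ENNReal.ofReal (1 + W p))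
        + 2⁻¹ * (∫⁻ p, ∫⁻ q, ENNReal.ofReal (kernel b ε p q) * (F p * F q) * ENNReal.ofReal (1 + W q))
        + ∫⁻ p, ∫⁻ q, 8 * (F p * ENNReal.ofReal (ψ ‖p‖)) *
          (F q * ENNReal.ofReal (ψ ‖q‖) * Θ (cosAngle p q)) := by
    rw [← lintegral_const_mul _ (by fun_prop), ← lintegral_const_mul _ (by fun_prop),
      ← lintegral_add_left (by fun_prop), ← lintegral_add_left (by fun_prop)]
    refine lintegral_congr fun p => ?_
    rw [← lintegral_const_mul _ (by fun_prop), ← lintegral_const_mul _ (by fun_prop),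
      ← lintegral_add_left (by fun_prop), ← lintegral_add_left (by fun_prop)]
  rw [hsplit, hsym, hang, ← add_mul, ENNReal.inv_two_add_inv_two, one_mul, mul_add, ← mul_assoc (ENNReal.ofReal (4 * Real.pi)) (8 * A)]
  gcongr

end

end MasslessBoltzmann

/-! ### Collision rates and the weak form of the operator -/

namespace MasslessBoltzmann

noncomputable section

variable {b : ℝ}

/-- For the moment of order `2` it suffices to bound the gain, linearly in that moment; the
truncation keeps the weight bounded. The constant is `4π` times the `8` of `kernel_mul_min_le`,
doubled by its two symmetric terms. -/
lemma lintegral_gain_min_le (hb₁ : 1 < b) (hb₂ : b < 2) (ε : ℝ) {n : ℝ} (hn : 1 ≤ n)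
    {F : Mom → ℝ≥0∞} (hF : Measurable F) :
    ∫⁻ z, ENNReal.ofReal (kernel b ε z.1 z.2.1) *
        (F (outMom z.1 z.2.1 z.2.2) * F (outMom' z.1 z.2.1 z.2.2)) *
        ENNReal.ofReal (min (‖z.1‖ ^ 2) (n ^ 2)) ∂tripleMeasure
      ≤ ENNReal.ofReal (64 * Real.pi) *
        ((∫⁻ p, F p * ENNReal.ofReal (1 + min (‖p‖ ^ 2) (n ^ 2))) *
          ∫⁻ p, F p * ENNReal.ofReal (wtSq p)) := by
  set W : Mom → ℝ := fun p => min (‖p‖ ^ 2) (n ^ 2) with hW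
  have hWm : Measurable W := by rw [hW]; fun_prop
  have hW0 : ∀ p, 0 ≤ W p := fun p => le_min (sq_nonneg _) (sq_nonneg _)
  have hw2 : ∀ p, 0 ≤ wtSq p := fun p => zero_le_one.trans (one_le_wtSq p)
  rw [lintegral_gain_weight b ε hF hF (W := fun p => ENNReal.ofReal (W p)) (by fun_prop)]
  have hpt : ∀ p q : Mom, ∫⁻ ω : Dir, ENNReal.ofReal (kernel b ε p q) *
      ENNReal.ofReal (W (outMom p q ω)) ∂(volume : Measure Mom).toSphere
      ≤ ENNReal.ofReal (32 * Real.pi) * (ENNReal.ofReal (1 + W p) * ENNReal.ofReal (wtSq q) +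
        ENNReal.ofReal (wtSq p) * ENNReal.ofReal (1 + W q)) := fun p q => by
    have hp := hW0 p
    have hq := hW0 q
    have hp2 := hw2 p
    have hq2 := hw2 q
    have e : ENNReal.ofReal (32 * Real.pi) * (ENNReal.ofReal (1 + W p) * ENNReal.ofReal (wtSq q) +
        ENNReal.ofReal (wtSq p) * ENNReal.ofReal (1 + W q))
        = ∫⁻ ω : Dir, ENNReal.ofReal (8 * ((1 + W p) * wtSq q + wtSq p * (1 + W q)))
          ∂(volume : Measure Mom).toSphere := by
      rw [lintegral_const, toSphere_univ, ← ENNReal.ofReal_mul (by positivity),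
        ← ENNReal.ofReal_mul (by positivity), ← ENNReal.ofReal_mul (by positivity),
        ← ENNReal.ofReal_add (by positivity) (by positivity),
        ← ENNReal.ofReal_mul (by positivity)]
      congr 1; ring
    rw [e]
    refine lintegral_mono fun ω => ?_
    rw [← ENNReal.ofReal_mul (kernel_nonneg _ _ _ _)]
    refine ENNReal.ofReal_le_ofReal ((mul_le_mul_of_nonneg_right
      (kernel_le_kernel_zero b ε p q) (hW0 _)).trans ?_)
    exact kernel_mul_min_le hb₁ hb₂ hn p q ω
  calc _ ≤ ∫⁻ p, ∫⁻ q, ENNReal.ofReal (32 * Real.pi) *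
        ((F p * ENNReal.ofReal (1 + W p)) * (F q * ENNReal.ofReal (wtSq q)) +
        (F p * ENNReal.ofReal (wtSq p)) * (F q * ENNReal.ofReal (1 + W q))) := by
        refine lintegral_mono fun p => lintegral_mono fun q =>
          (mul_le_mul_right (hpt p q) _).trans_eq ?_
        ring
    _ = ∫⁻ p, ENNReal.ofReal (32 * Real.pi) *
        ((F p * ENNReal.ofReal (1 + W p)) * (∫⁻ q, F q * ENNReal.ofReal (wtSq q)) +
        (F p * ENNReal.ofReal (wtSq p)) * (∫⁻ q, F q * ENNReal.ofReal (1 + W q))) := by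
        refine lintegral_congr fun p => ?_
        rw [lintegral_const_mul _ (by fun_prop), lintegral_add_left (by fun_prop),
          lintegral_const_mul _ (by fun_prop), lintegral_const_mul _ (by fun_prop)]
    _ = ENNReal.ofReal (32 * Real.pi) *
        ((∫⁻ p, F p * ENNReal.ofReal (1 + W p)) * (∫⁻ q, F q * ENNReal.ofReal (wtSq q)) +
        (∫⁻ p, F p * ENNReal.ofReal (wtSq p)) * (∫⁻ q, F q * ENNReal.ofReal (1 + W q))) := by
        rw [lintegral_const_mul _ (by fun_prop), lintegral_add_left (by fun_prop),
          lintegral_mul_const _ (by fun_prop), lintegral_mul_const _ (by fun_prop)]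
    _ = _ := by
        rw [show 64 * Real.pi = 32 * Real.pi + 32 * Real.pi by ring,
          ENNReal.ofReal_add (by positivity) (by positivity)]
        ring

/-- Total collision rate. -/
lemma lintegral_kernel_le {k : ℝ} (hk : 0 ≤ k) {s : ℝ} {ε : ℝ}
    (h : ∀ p q, kernel b ε p q ≤ k * (‖p‖ ^ s * ‖q‖ ^ s)) {F G : Mom → ℝ≥0∞} (hF : Measurable F)
    (hG : Measurable G) :
    ∫⁻ z, ENNReal.ofReal (kernel b ε z.1 z.2.1) * (F z.1 * G z.2.1) ∂tripleMeasure
      ≤ ENNReal.ofReal (4 * Real.pi * k) * ((∫⁻ p, F p * ENNReal.ofReal (‖p‖ ^ s)) *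
        ∫⁻ p, G p * ENNReal.ofReal (‖p‖ ^ s)) := by
  rw [lintegral_triple_const (Ψ := fun x => ENNReal.ofReal (kernel b ε x.1 x.2) * (F x.1 * G x.2))
    (by fun_prop), ENNReal.ofReal_mul (p := 4 * Real.pi) (by positivity), mul_assoc]
  refine mul_le_mul_right ?_ _
  rw [← lintegral_mul_const _ (by fun_prop), ← lintegral_const_mul _ (by fun_prop)]
  refine lintegral_mono fun p => ?_
  rw [← lintegral_const_mul _ (by fun_prop), ← lintegral_const_mul _ (by fun_prop)]
  refine lintegral_mono fun q => ?_
  have h1 := ENNReal.ofReal_le_ofReal (h p q)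
  rw [ENNReal.ofReal_mul hk, ENNReal.ofReal_mul (by positivity)] at h1
  refine (mul_le_mul_left h1 (F p * G q)).trans_eq ?_
  ring

/-- Convergence of the loss term of an isotropic function at almost every momentum implies
that the moment of order `-b/2` is finite. -/
lemma lintegral_rpow_lt_top_of_loss (hb₁ : 1 < b) (hb₂ : b < 2) {F : Mom → ℝ≥0∞}
    (hF : Measurable F) {φ : ℝ → ℝ≥0∞} (hφ : Measurable φ) (hFφ : ∀ᵐ p, F p = φ ‖p‖)
    (hfin : ∀ᵐ p, ∫⁻ q, ENNReal.ofReal (kernel b 0 p q) * (F p * F q) < ∞) :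
    ∫⁻ p, F p * ENNReal.ofReal (‖p‖ ^ (-(b / 2))) < ∞ := by
  by_cases h0 : F =ᵐ[volume] 0
  · rw [lintegral_congr_ae (g := fun _ => 0)]
    · simp
    · filter_upwards [h0] with p hp
      simp [hp]
  have h3 : ∀ᵐ p : Mom, p ≠ 0 := by
    rw [ae_iff]; simp
  -- A single good momentum suffices: one with `F p ≠ 0` and a finite loss integral.
  obtain ⟨p, hFp, hp, hp0⟩ : ∃ p, F p ≠ 0 ∧
      (∫⁻ q, ENNReal.ofReal (kernel b 0 p q) * (F p * F q) < ∞) ∧ p ≠ 0 :=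
    ((not_eventually.1 h0).and_eventually (hfin.and h3)).exists
  set Θ : ℝ → ℝ≥0∞ := fun t => ENNReal.ofReal ((2 * (1 - t)) ^ (1 - b / 2)) with hΘ
  have hΘm : Measurable Θ := by rw [hΘ]; fun_prop
  have hΘ0 : (2⁻¹ * ∫⁻ t in Icc (-1 : ℝ) 1, Θ t) ≠ 0 := by
    refine mul_ne_zero (by simp) ?_
    rw [← pos_iff_ne_zero, setLIntegral_pos_iff hΘm]
    refine lt_of_lt_of_le (?_ : 0 < volume (Ioo (-1 : ℝ) 1))
      (measure_mono fun t ht => ⟨?_, ht.1.le, ht.2.le⟩)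
    · simp
    · have : 0 < 1 - t := by linarith [ht.2]
      simp only [hΘ, Function.mem_support, ne_eq, ENNReal.ofReal_eq_zero, not_le]
      positivity
  have h4 := lintegral_lintegral_angular hφ hFφ (B := fun r => ENNReal.ofReal (r ^ (-(b / 2))))
    (by fun_prop) hΘm hp0
  have hn : 0 < ‖p‖ := norm_pos_iff.2 hp0
  -- The kernel factors into powers of the two energies and a function of the angle. For isotropic
  -- `F` the loss integral at `p` is thus a nonzero multiple of the moment of order `-b/2`.
  have hker : ∀ q, ENNReal.ofReal (kernel b 0 p q) * (F p * F q)
      = F p * ENNReal.ofReal (‖p‖ ^ (-(b / 2))) *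
        (F q * ENNReal.ofReal (‖q‖ ^ (-(b / 2))) * Θ (cosAngle p q)) := fun q => by
    have hc : 0 ≤ 1 - cosAngle p q := by linarith [(cosAngle_mem p q).2]
    have : kernel b 0 p q = ‖p‖ ^ (-(b / 2)) * ‖q‖ ^ (-(b / 2)) *
        (2 * (1 - cosAngle p q)) ^ (1 - b / 2) := by
      have e1 : relMom p q ^ (2 - b) = (relMom p q ^ 2) ^ (1 - b / 2) := by
        rw [← Real.rpow_natCast, ← Real.rpow_mul (relMom_nonneg p q)]
        congr 1; push_cast; ring
      rcases eq_or_lt_of_le (norm_nonneg q) with hq | hq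
      · rw [kernel_zero, ← hq, Real.zero_rpow (by linarith)]; simp
      rw [kernel_zero, e1, relMom_sq_eq_cosAngle,
        show 2 * (‖p‖ * ‖q‖) * (1 - cosAngle p q) = ‖p‖ * ‖q‖ * (2 * (1 - cosAngle p q)) by ring,
        Real.mul_rpow (by positivity) (by positivity), Real.mul_rpow hn.le hq.le,
        show 1 - b / 2 = -(b / 2) + 1 by ring, Real.rpow_add_one hn.ne', Real.rpow_add_one hq.ne']
      field_simp
    rw [this, ENNReal.ofReal_mul (by positivity), ENNReal.ofReal_mul (by positivity)]
    ring
  simp_rw [hker] at hp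
  rw [lintegral_const_mul _ (by fun_prop), h4] at hp
  have hpre : F p * ENNReal.ofReal (‖p‖ ^ (-(b / 2))) ≠ 0 :=
    mul_ne_zero hFp (by rw [ne_eq, ENNReal.ofReal_eq_zero, not_le]; positivity)
  by_contra h
  rw [not_lt_top_iff] at h
  rw [h, ENNReal.top_mul hΘ0, ENNReal.mul_top hpre] at hp
  exact lt_irrefl _ hp

/-- The gain is integrable because the equally large loss is, by `lintegral_gain`. -/
lemma integrable_gain_triple {ε : ℝ} {f g : Mom → ℝ} (hf : Measurable f) (hg : Measurable g)
    (h : ∫⁻ z, ENNReal.ofReal (kernel b ε z.1 z.2.1) * (‖f z.1‖ₑ * ‖g z.2.1‖ₑ) ∂tripleMeasure < ∞) :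
    Integrable (fun z : Mom × Mom × Dir => kernel b ε z.1 z.2.1 *
      (f (outMom z.1 z.2.1 z.2.2) * g (outMom' z.1 z.2.1 z.2.2))) tripleMeasure := by
  refine ⟨(by fun_prop : Measurable _).aestronglyMeasurable, ?_⟩
  rw [hasFiniteIntegral_iff_enorm]
  rw [← lintegral_gain b ε (F := fun p => ‖f p‖ₑ) (G := fun p => ‖g p‖ₑ) (by fun_prop)
    (by fun_prop)] at h
  simpa only [enorm_mul, Real.enorm_of_nonneg (kernel_nonneg _ _ _ _)] using h

lemma integrable_loss_triple {ε : ℝ} {f g : Mom → ℝ} (hf : Measurable f) (hg : Measurable g)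
    (h : ∫⁻ z, ENNReal.ofReal (kernel b ε z.1 z.2.1) * (‖f z.1‖ₑ * ‖g z.2.1‖ₑ) ∂tripleMeasure < ∞) :
    Integrable (fun z : Mom × Mom × Dir => kernel b ε z.1 z.2.1 * (f z.1 * g z.2.1))
      tripleMeasure := by
  refine ⟨(by fun_prop : Measurable _).aestronglyMeasurable, ?_⟩
  rw [hasFiniteIntegral_iff_enorm]
  simpa only [enorm_mul, Real.enorm_of_nonneg (kernel_nonneg _ _ _ _)] using h

/-- The weak form of the collision operator. -/
lemma integral_collisionOp_mul (C₁ : ℝ) {ε : ℝ} {f : Mom → ℝ} (hf : Measurable f)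
    (hf0 : ∀ᵐ p, 0 ≤ f p)
    (h : ∫⁻ z, ENNReal.ofReal (kernel b ε z.1 z.2.1) * (‖f z.1‖ₑ * ‖f z.2.1‖ₑ) ∂tripleMeasure < ∞)
    {W : Mom → ℝ} (hW : Measurable W) (hW0 : ∀ p, 0 ≤ W p) {M : ℝ} (hWM : ∀ p, W p ≤ M) :
    ∫ p, collisionOp C₁ b ε f p * W p
      = C₁ * ((∫⁻ z, ENNReal.ofReal (kernel b ε z.1 z.2.1) *
          (‖f (outMom z.1 z.2.1 z.2.2)‖ₑ * ‖f (outMom' z.1 z.2.1 z.2.2)‖ₑ) *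
          ENNReal.ofReal (W z.1) ∂tripleMeasure).toReal
        - (∫⁻ z, ENNReal.ofReal (kernel b ε z.1 z.2.1) * (‖f z.1‖ₑ * ‖f z.2.1‖ₑ) *
          ENNReal.ofReal (W z.1) ∂tripleMeasure).toReal) := by
  have hG := integrable_gain_triple hf hf h
  have hL := integrable_loss_triple hf hf h
  have hWb : ∀ᵐ z : Mom × Mom × Dir ∂tripleMeasure, ‖W z.1‖ ≤ M := ae_of_all _ fun z => by
    rw [Real.norm_of_nonneg (hW0 _)]; exact hWM _
  have hGW := hG.mul_bdd (c := M) (g := fun z : Mom × Mom × Dir => W z.1)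
    (by fun_prop : Measurable fun z : Mom × Mom × Dir => W z.1).aestronglyMeasurable hWb
  have hLW := hL.mul_bdd (c := M) (g := fun z : Mom × Mom × Dir => W z.1)
    (by fun_prop : Measurable fun z : Mom × Mom × Dir => W z.1).aestronglyMeasurable hWb
  have e1 : ∫ p, collisionOp C₁ b ε f p * W p
      = C₁ * ∫ p, ∫ x, ((fun z : Mom × Mom × Dir => kernel b ε z.1 z.2.1 *
          (f (outMom z.1 z.2.1 z.2.2) * f (outMom' z.1 z.2.1 z.2.2)) * W z.1) (p, x)
        - (fun z : Mom × Mom × Dir => kernel b ε z.1 z.2.1 * (f z.1 * f z.2.1) * W z.1) (p, x))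
        ∂collisionMeasure := by
    rw [← integral_const_mul]
    refine integral_congr_ae (ae_of_all _ fun p => ?_)
    simp only [collisionOp, ← sub_mul]
    rw [integral_mul_const, ← mul_assoc]
    rfl
  have hout := ae_outMom hf0
  rw [e1, ← integral_prod (μ := (volume : Measure Mom)) (ν := collisionMeasure)
    (fun z : Mom × Mom × Dir => (fun z : Mom × Mom × Dir => kernel b ε z.1 z.2.1 *
          (f (outMom z.1 z.2.1 z.2.2) * f (outMom' z.1 z.2.1 z.2.2)) * W z.1) z
        - (fun z : Mom × Mom × Dir => kernel b ε z.1 z.2.1 * (f z.1 * f z.2.1) * W z.1) z)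
      (hGW.sub hLW), integral_sub hGW hLW, integral_eq_lintegral_of_nonneg_ae,
    integral_eq_lintegral_of_nonneg_ae]
  · congr 3
    · refine lintegral_congr_ae ?_
      filter_upwards [hout] with z hz
      rw [ENNReal.ofReal_mul, ENNReal.ofReal_mul (kernel_nonneg _ _ _ _), ENNReal.ofReal_mul hz.1,
        Real.enorm_of_nonneg hz.1, Real.enorm_of_nonneg hz.2.1]
      exact mul_nonneg (kernel_nonneg _ _ _ _) (mul_nonneg hz.1 hz.2.1)
    · refine lintegral_congr_ae ?_
      filter_upwards [hout] with z hz
      rw [ENNReal.ofReal_mul, ENNReal.ofReal_mul (kernel_nonneg _ _ _ _), ENNReal.ofReal_mul hz.2.2.1,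
        Real.enorm_of_nonneg hz.2.2.1, Real.enorm_of_nonneg hz.2.2.2]
      exact mul_nonneg (kernel_nonneg _ _ _ _) (mul_nonneg hz.2.2.1 hz.2.2.2)
  · filter_upwards [hout] with z hz
    exact mul_nonneg (mul_nonneg (kernel_nonneg _ _ _ _) (mul_nonneg hz.2.2.1 hz.2.2.2)) (hW0 _)
  · exact hLW.aestronglyMeasurable
  · filter_upwards [hout] with z hz
    exact mul_nonneg (mul_nonneg (kernel_nonneg _ _ _ _) (mul_nonneg hz.1 hz.2.1)) (hW0 _)
  · exact hGW.aestronglyMeasurable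

end

end MasslessBoltzmann

/-! ### Moments of solutions and differential inequalities -/

namespace MasslessBoltzmann

noncomputable section

variable {b : ℝ}

lemma measurable_L1 (f : L1) : Measurable (f : Mom → ℝ) := (Lp.stronglyMeasurable f).measurable

lemma integrable_mul_of_bounded (f : L1) {W : Mom → ℝ} (hW : Measurable W) {M : ℝ}
    (hM : ∀ p, |W p| ≤ M) : Integrable fun p => f p * W p :=
  (L1.integrable_coeFn f).mul_bdd (c := M) hW.aestronglyMeasurable (ae_of_all _ hM)

/-- Integration against a bounded function as a functional on `L¹`. -/
lemma exists_integral_functional {W : Mom → ℝ} (hW : Measurable W) {M : ℝ}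
    (hM : ∀ p, |W p| ≤ M) : ∃ Λ : L1 →L[ℝ] ℝ, ∀ f : L1, Λ f = ∫ p, f p * W p := by
  refine ⟨LinearMap.mkContinuous
    { toFun := fun f => ∫ p, f p * W p
      map_add' := fun f g => ?_
      map_smul' := fun c f => ?_ } M fun f => ?_, fun f => rfl⟩
  · rw [← integral_add (integrable_mul_of_bounded f hW hM) (integrable_mul_of_bounded g hW hM)]
    refine integral_congr_ae ?_
    filter_upwards [Lp.coeFn_add f g] with p hp
    rw [hp, Pi.add_apply, add_mul]
  · rw [RingHom.id_apply, smul_eq_mul, ← integral_const_mul]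
    refine integral_congr_ae ?_
    filter_upwards [Lp.coeFn_smul c f] with p hp
    rw [hp, Pi.smul_apply, smul_eq_mul, mul_assoc]
  · simp only [LinearMap.coe_mk, AddHom.coe_mk]
    rw [L1.norm_eq_integral_norm, ← integral_const_mul]
    refine (norm_integral_le_integral_norm _).trans (integral_mono_of_nonneg
      (ae_of_all _ fun p => norm_nonneg _) ((L1.integrable_coeFn f).norm.const_mul M)
      (ae_of_all _ fun p => ?_))
    dsimp only
    rw [norm_mul, mul_comm]
    exact mul_le_mul_of_nonneg_right (hM p) (norm_nonneg _)

lemma coeFn_nonneg {f : L1} (hf : 0 ≤ f) : ∀ᵐ p, 0 ≤ f p := (Lp.coeFn_nonneg f).2 hf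

lemma IsIsotropic.exists_enorm {f : L1} (hf : IsIsotropic f) :
    ∃ φ : ℝ → ℝ≥0∞, Measurable φ ∧ ∀ᵐ p, ‖f p‖ₑ = φ ‖p‖ := by
  obtain ⟨φ, hφ, h⟩ := hf
  refine ⟨fun r => ‖φ r‖ₑ, by fun_prop, ?_⟩
  filter_upwards [h] with p hp
  rw [hp]

lemma integral_mul_eq_toReal {f : L1} (hf : 0 ≤ f) {W : Mom → ℝ} (hW : Measurable W)
    (hW0 : ∀ p, 0 ≤ W p) :
    ∫ p, f p * W p = (∫⁻ p, ‖f p‖ₑ * ENNReal.ofReal (W p)).toReal := by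
  rw [integral_eq_lintegral_of_nonneg_ae]
  · congr 1
    refine lintegral_congr_ae ?_
    filter_upwards [coeFn_nonneg hf] with p hp
    rw [ENNReal.ofReal_mul hp, Real.enorm_of_nonneg hp]
  · filter_upwards [coeFn_nonneg hf] with p hp
    exact mul_nonneg hp (hW0 p)
  · exact ((measurable_L1 f).mul hW).aestronglyMeasurable

lemma lintegral_enorm_ne_top (f : L1) : ∫⁻ p, ‖f p‖ₑ ≠ ∞ :=
  (L1.integrable_coeFn f).hasFiniteIntegral.ne

lemma lintegral_enorm_mul_ne_top (f : L1) {W : Mom → ℝ} {M : ℝ} (hM : ∀ p, W p ≤ M) :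
    ∫⁻ p, ‖f p‖ₑ * ENNReal.ofReal (W p) ≠ ∞ := by
  refine (lt_of_le_of_lt (lintegral_mono fun p => mul_le_mul_right
    (ENNReal.ofReal_le_ofReal (hM p)) _) ?_).ne
  rw [lintegral_mul_const _ (measurable_L1 f).enorm]
  exact ENNReal.mul_lt_top (lintegral_enorm_ne_top f).lt_top ENNReal.ofReal_lt_top

/-- The total collision rate of an integrable isotropic function with convergent loss term
is finite. -/
lemma lintegral_kernel_lt_top (hb₁ : 1 < b) (hb₂ : b < 2) {ε : ℝ} (hε : 0 ≤ ε) {f : L1}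
    (hiso : IsIsotropic f)
    (hloss : ∀ᵐ p, Integrable (lossIntegrand b ε f p) collisionMeasure) :
    ∫⁻ z, ENNReal.ofReal (kernel b ε z.1 z.2.1) * (‖f z.1‖ₑ * ‖f z.2.1‖ₑ) ∂tripleMeasure < ∞ := by
  have hf := measurable_L1 f
  rcases eq_or_lt_of_le hε with h0 | h0
  · subst h0
    obtain ⟨φ, hφ, hfφ⟩ := hiso.exists_enorm
    have h1 : ∫⁻ p, ‖f p‖ₑ * ENNReal.ofReal (‖p‖ ^ (-(b / 2))) < ∞ := by
      refine lintegral_rpow_lt_top_of_loss hb₁ hb₂ (by fun_prop) hφ hfφ ?_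
      filter_upwards [hloss] with p hp
      have h2 := hp.hasFiniteIntegral
      rw [hasFiniteIntegral_iff_enorm, collisionMeasure, lintegral_prod _ (by
        unfold lossIntegrand; fun_prop)] at h2
      simp only [lossIntegrand, enorm_mul, Real.enorm_of_nonneg (kernel_nonneg _ _ _ _),
        lintegral_const, toSphere_univ] at h2
      rw [lintegral_mul_const _ (by fun_prop)] at h2
      by_contra h3
      rw [not_lt_top_iff] at h3
      rw [h3, ENNReal.top_mul] at h2
      · exact lt_irrefl _ h2
      · rw [ne_eq, ENNReal.ofReal_eq_zero, not_le]; positivity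
    refine (lintegral_kernel_le (by norm_num) (kernel_zero_le hb₁ hb₂) (F := fun p => ‖f p‖ₑ)
      (G := fun p => ‖f p‖ₑ) (by fun_prop) (by fun_prop)).trans_lt ?_
    exact ENNReal.mul_lt_top ENNReal.ofReal_lt_top (ENNReal.mul_lt_top h1 h1)
  -- With cut-off the kernel is bounded, and exponent `0` reduces the claim to finite mass.
  · refine (lintegral_kernel_le (k := 2 * (ε ^ 2 / 4) ^ (-(b / 2))) (s := 0) (by positivity)
      (fun p q => ?_) (F := fun p => ‖f p‖ₑ) (G := fun p => ‖f p‖ₑ) (by fun_prop)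
      (by fun_prop)).trans_lt ?_
    · simpa using kernel_le_of_cutoff hb₁ hb₂ h0 p q
    · have h1 := (lintegral_enorm_ne_top f).lt_top
      simp only [Real.rpow_zero, ENNReal.ofReal_one, mul_one]
      exact ENNReal.mul_lt_top ENNReal.ofReal_lt_top (ENNReal.mul_lt_top h1 h1)

namespace IsSolution

variable {C₁ ε T : ℝ} {f₀ : L1} {f : ℝ → L1}

lemma hasDerivWithinAt (S : IsSolution C₁ b ε (Icc 0 T) f₀ f) {s : ℝ} (hs : s ∈ Icc 0 T) :
    HasDerivWithinAt f (derivWithin f (Icc 0 T) s) (Icc 0 T) s :=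
  (S.contDiffOn.differentiableOn one_ne_zero s hs).hasDerivWithinAt

lemma hasDerivWithinAt_Ici (S : IsSolution C₁ b ε (Icc 0 T) f₀ f) {s : ℝ} (hs : s ∈ Ico 0 T) :
    HasDerivWithinAt f (derivWithin f (Icc 0 T) s) (Ici s) s :=
  (S.hasDerivWithinAt (Ico_subset_Icc_self hs)).mono_of_mem_nhdsWithin
    (mem_of_superset (Icc_mem_nhdsGE hs.2) (Icc_subset_Icc_left hs.1))

lemma lintegral_kernel_lt_top (hb₁ : 1 < b) (hb₂ : b < 2) (hε : 0 ≤ ε)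
    (S : IsSolution C₁ b ε (Icc 0 T) f₀ f) {s : ℝ} (hs : s ∈ Icc 0 T) :
    ∫⁻ z, ENNReal.ofReal (kernel b ε z.1 z.2.1) * (‖f s z.1‖ₑ * ‖f s z.2.1‖ₑ) ∂tripleMeasure < ∞ :=
  MasslessBoltzmann.lintegral_kernel_lt_top hb₁ hb₂ hε (S.isotropic s hs) (S.integrable_loss s hs)

/-- The evolution of a moment along a solution. The weight has to be bounded for the functional to
be continuous on `L¹`; unbounded weights are reached by regularization. -/
lemma integral_deriv_mul (hb₁ : 1 < b) (hb₂ : b < 2) (hε : 0 ≤ ε)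
    (S : IsSolution C₁ b ε (Icc 0 T) f₀ f) {s : ℝ} (hs : s ∈ Icc 0 T) {W : Mom → ℝ}
    (hW : Measurable W) (hW0 : ∀ p, 0 ≤ W p) {M : ℝ} (hWM : ∀ p, W p ≤ M) :
    ∫ p, (derivWithin f (Icc 0 T) s : L1) p * W p
      = C₁ * ((∫⁻ z, ENNReal.ofReal (kernel b ε z.1 z.2.1) *
          (‖f s (outMom z.1 z.2.1 z.2.2)‖ₑ * ‖f s (outMom' z.1 z.2.1 z.2.2)‖ₑ) *
          ENNReal.ofReal (W z.1) ∂tripleMeasure).toReal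
        - (∫⁻ z, ENNReal.ofReal (kernel b ε z.1 z.2.1) * (‖f s z.1‖ₑ * ‖f s z.2.1‖ₑ) *
          ENNReal.ofReal (W z.1) ∂tripleMeasure).toReal) := by
  rw [← integral_collisionOp_mul C₁ (measurable_L1 (f s)) (coeFn_nonneg (S.nonneg s hs))
    (S.lintegral_kernel_lt_top hb₁ hb₂ hε hs) hW hW0 hWM]
  refine integral_congr_ae ?_
  filter_upwards [S.equation s hs] with p hp
  rw [hp]

end IsSolution

/-- A quadratic differential inequality. -/
lemma le_two_mul_of_deriv_le_sq {y y' : ℝ → ℝ} {T C : ℝ} (hy : ContinuousOn y (Icc 0 T))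
    (hd : ∀ s ∈ Ico 0 T, HasDerivWithinAt y (y' s) (Ici s) s) (hpos : ∀ s ∈ Icc 0 T, 0 < y s)
    (hC : ∀ s ∈ Ico 0 T, y' s ≤ C * y s ^ 2) (hC0 : 0 ≤ C) (hT : C * y 0 * T ≤ 1 / 2) {s : ℝ}
    (hs : s ∈ Icc 0 T) : y s ≤ 2 * y 0 := by
  -- The function `-1/y` has derivative `y'/y² ≤ C`; the smallness of `T` prevents `1/y` from losing
  -- more than half of its initial value.
  have h := image_le_of_deriv_right_le_deriv_boundary (f := fun s => -(y s)⁻¹)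
    (f' := fun s => y' s / y s ^ 2) (B := fun s => -(y 0)⁻¹ + C * s) (B' := fun _ => C * 1)
    (a := 0) (b := T) (hy.inv₀ fun s hs => (hpos s hs).ne').neg
    (fun s hs => by
      refine ((hd s hs).inv (hpos s (Ico_subset_Icc_self hs)).ne').neg.congr_deriv ?_
      ring)
    (by simp) (by fun_prop)
    (fun s hs => (((hasDerivAt_id s).const_mul C).const_add _).hasDerivWithinAt)
    (fun s hs => by
      rw [mul_one, div_le_iff₀ (pow_pos (hpos s (Ico_subset_Icc_self hs)) 2)]
      exact hC s hs) hs
  have h0 := hpos 0 ⟨le_rfl, hs.1.trans hs.2⟩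
  have h1 := hpos s hs
  have h2 : C * s ≤ C * T := mul_le_mul_of_nonneg_left hs.2 hC0
  have h3 : C * T ≤ (y 0)⁻¹ / 2 := by
    rw [le_div_iff₀ two_pos, ← one_div, le_div_iff₀ h0]; linarith
  have h4 : (2 * y 0)⁻¹ ≤ (y s)⁻¹ := by
    rw [mul_inv]; linarith
  exact (inv_le_inv₀ (by positivity) h1).1 h4

/-- A linear differential inequality. -/
lemma le_exp_mul_of_deriv_le {y y' : ℝ → ℝ} {T K : ℝ} (hy : ContinuousOn y (Icc 0 T))
    (hd : ∀ s ∈ Ico 0 T, HasDerivWithinAt y (y' s) (Ici s) s)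
    (hK : ∀ s ∈ Ico 0 T, y' s ≤ K * y s) {s : ℝ} (hs : s ∈ Icc 0 T) :
    y s ≤ y 0 * Real.exp (K * s) := by
  have hexp : ∀ s, HasDerivAt (fun s => Real.exp (-(K * s))) (Real.exp (-(K * s)) * -(K * 1)) s :=
    fun s => ((hasDerivAt_id s).const_mul K).neg.exp
  have h := image_le_of_deriv_right_le_deriv_boundary (f := fun s => y s * Real.exp (-(K * s)))
    (f' := fun s => y' s * Real.exp (-(K * s)) + y s * (Real.exp (-(K * s)) * -(K * 1)))
    (B := fun _ => y 0) (B' := fun _ => 0)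
    (a := 0) (b := T) (hy.mul (by fun_prop))
    (fun s hs => (hd s hs).mul (hexp s).hasDerivWithinAt)
    (by simp) (by fun_prop)
    (fun s hs => hasDerivWithinAt_const _ _ _)
    (fun s hs => by
      have := hK s hs
      have := Real.exp_pos (-(K * s))
      nlinarith) hs
  rwa [Real.exp_neg, ← div_eq_mul_inv, div_le_iff₀ (Real.exp_pos _)] at h

end

end MasslessBoltzmann

/-! ### A priori bounds of the moments -/

namespace MasslessBoltzmann

noncomputable section

variable {b : ℝ}

lemma ae_ne_zero : ∀ᵐ p : Mom, p ≠ 0 := by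
  rw [ae_iff]; simp

/-- The moment with weight `1 + 1/p²` is the limit of regularized moments. -/
lemma lintegral_wtSq_le_of_forall {F : Mom → ℝ≥0∞} (hF : Measurable F) {A : ℝ≥0∞}
    (h : ∀ δ > (0 : ℝ), ∫⁻ p, F p * ENNReal.ofReal (1 + ((‖p‖ + δ) ^ 2)⁻¹) ≤ A) :
    ∫⁻ p, F p * ENNReal.ofReal (wtSq p) ≤ A := by
  have h1 : ∫⁻ p, F p * ENNReal.ofReal (wtSq p) ≤ ∫⁻ p, liminf (fun n : ℕ => F p *
      ENNReal.ofReal (1 + ((‖p‖ + 1 / ((n : ℝ) + 1)) ^ 2)⁻¹)) atTop := by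
    refine lintegral_mono_ae ?_
    filter_upwards [ae_ne_zero] with p hp
    have hp' : ‖p‖ ≠ 0 := norm_ne_zero_iff.2 hp
    have h2 : Tendsto (fun n : ℕ => 1 + ((‖p‖ + 1 / ((n : ℝ) + 1)) ^ 2)⁻¹) atTop (𝓝 (wtSq p)) := by
      rw [wtSq, one_div (‖p‖ ^ 2)]
      refine tendsto_const_nhds.add (Tendsto.inv₀ (Tendsto.pow ?_ 2) (pow_ne_zero 2 hp'))
      simpa using (tendsto_const_nhds (x := ‖p‖)).add (tendsto_one_div_add_atTop_nhds_zero_nat (𝕜 := ℝ))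
    by_cases hFp : F p = ∞
    · have h4 : ∀ n : ℕ, F p * ENNReal.ofReal (1 + ((‖p‖ + 1 / ((n : ℝ) + 1)) ^ 2)⁻¹) = ∞ := fun n => by
        rw [hFp, ENNReal.top_mul]
        rw [ne_eq, ENNReal.ofReal_eq_zero, not_le]; positivity
      simp_rw [h4]
      simp
    · have h3 := ENNReal.Tendsto.const_mul (a := F p) ((ENNReal.continuous_ofReal.tendsto _).comp h2)
        (Or.inr hFp)
      exact h3.liminf_eq.ge
  refine h1.trans ((lintegral_liminf_le fun n => by fun_prop).trans ?_)
  refine liminf_le_of_frequently_le' (Frequently.of_forall fun n => h _ (by positivity))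

lemma lintegral_normSq_le_of_forall {F : Mom → ℝ≥0∞} (hF : Measurable F) {A : ℝ≥0∞}
    (h : ∀ n : ℕ, ∫⁻ p, F p * ENNReal.ofReal (min (‖p‖ ^ 2) (((n : ℝ) + 1) ^ 2)) ≤ A) :
    ∫⁻ p, F p * ENNReal.ofReal (‖p‖ ^ 2) ≤ A := by
  have h1 : ∫⁻ p, F p * ENNReal.ofReal (‖p‖ ^ 2) ≤ ∫⁻ p, liminf (fun n : ℕ => F p *
      ENNReal.ofReal (min (‖p‖ ^ 2) (((n : ℝ) + 1) ^ 2))) atTop := by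
    refine lintegral_mono fun p => ?_
    refine (Tendsto.liminf_eq (tendsto_const_nhds.congr' ?_)).ge
    filter_upwards [eventually_ge_atTop ⌈‖p‖⌉₊] with n hn
    have : ‖p‖ ≤ (n : ℝ) + 1 := (Nat.ceil_le.1 hn).trans (by linarith)
    rw [min_eq_left (by gcongr)]
  refine h1.trans ((lintegral_liminf_le fun n => by fun_prop).trans ?_)
  exact liminf_le_of_frequently_le' (Frequently.of_forall h)

lemma lintegral_mul_ofReal_ne_top {α : Type*} [MeasurableSpace α] {μ : Measure α} {G : α → ℝ≥0∞}
    (hG : Measurable G) (hfin : ∫⁻ x, G x ∂μ ≠ ∞) {W : α → ℝ} {M : ℝ} (hM : ∀ x, W x ≤ M) :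
    ∫⁻ x, G x * ENNReal.ofReal (W x) ∂μ ≠ ∞ := by
  have h : ∫⁻ x, G x * ENNReal.ofReal (W x) ∂μ ≤ ∫⁻ x, G x * ENNReal.ofReal M ∂μ := by
    gcongr with x
    exact hM x
  rw [lintegral_mul_const _ hG] at h
  exact ne_top_of_le_ne_top (ENNReal.mul_ne_top hfin ENNReal.ofReal_ne_top) h

lemma toReal_sub_le_of_le_add {G L X C : ℝ≥0∞} (hL : L ≠ ∞) (hX : X ≠ ∞) (hC : C ≠ ∞)
    (h : G ≤ L + C * X ^ 2) : G.toReal - L.toReal ≤ C.toReal * X.toReal ^ 2 := by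
  have hCX := ENNReal.mul_ne_top hC (ENNReal.pow_ne_top (n := 2) hX)
  have h2 := ENNReal.toReal_mono (ENNReal.add_ne_top.2 ⟨hL, hCX⟩) h
  rw [ENNReal.toReal_add hL hCX, ENNReal.toReal_mul, ENNReal.toReal_pow] at h2
  linarith

/-- A priori bound of the moment of order `-2`, for short times. -/
theorem exists_moment_bound (hb₁ : 1 < b) (hb₂ : b < 2) {C₁ : ℝ} (hC₁ : 0 < C₁) :
    ∃ C : ℝ, 0 < C ∧ ∀ {ε T Y : ℝ} {f₀ : L1} {f : ℝ → L1}, 0 ≤ ε →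
      IsSolution C₁ b ε (Icc 0 T) f₀ f → 0 ≤ Y →
      ∫⁻ p, ‖f₀ p‖ₑ * ENNReal.ofReal (wtSq p) ≤ ENNReal.ofReal Y → C * (1 + Y) * T ≤ 1 / 2 →
      ∀ s ∈ Icc 0 T, ∫⁻ p, ‖f s p‖ₑ * ENNReal.ofReal (wtSq p) ≤ ENNReal.ofReal (2 * (1 + Y)) := by
  obtain ⟨C, hC, hgain⟩ := exists_lintegral_gain_inv_sq_le hb₁ hb₂
  refine ⟨C₁ * C.toReal + 1, by positivity, fun {ε T Y f₀ f} hε S hY hf₀ hT s hs => ?_⟩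
  -- For `δ > 0` the weight is bounded and the moment is differentiable in time. The bound obtained
  -- does not depend on `δ`, and Fatou's lemma removes the regularization.
  refine lintegral_wtSq_le_of_forall (measurable_L1 (f s)).enorm fun δ hδ => ?_
  set W : Mom → ℝ := fun p => 1 + ((‖p‖ + δ) ^ 2)⁻¹ with hW
  have hWm : Measurable W := by rw [hW]; fun_prop
  have hW0 : ∀ p, 0 ≤ W p := fun p => by rw [hW]; positivity
  have hWM : ∀ p, W p ≤ 1 + (δ ^ 2)⁻¹ := fun p => by
    simp only [hW]
    gcongr
    linarith [norm_nonneg p]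
  have hWabs : ∀ p, |W p| ≤ 1 + (δ ^ 2)⁻¹ := fun p => by rw [abs_of_nonneg (hW0 p)]; exact hWM p
  obtain ⟨Λ, hΛ⟩ := exists_integral_functional hWm hWabs
  have hpos : ∀ s ∈ Icc 0 T, 0 ≤ Λ (f s) := fun s hs => by
    rw [hΛ, integral_mul_eq_toReal (S.nonneg s hs) hWm hW0]
    exact ENNReal.toReal_nonneg
  have hT0 : 0 ≤ T := hs.1.trans hs.2
  have h00 : (0 : ℝ) ∈ Icc 0 T := ⟨le_rfl, hT0⟩
  have hdiff : ∀ s ∈ Ico 0 T, Λ (derivWithin f (Icc 0 T) s) ≤ C₁ * C.toReal * (1 + Λ (f s)) ^ 2 := by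
    intro s hs
    have hs' := Ico_subset_Icc_self hs
    obtain ⟨φ, hφ, hfφ⟩ := (S.isotropic s hs').exists_enorm
    have hk := S.lintegral_kernel_lt_top hb₁ hb₂ hε hs'
    have h1 := hgain ε δ (fun p => ‖f s p‖ₑ) φ hδ (measurable_L1 (f s)).enorm hφ hfφ
    have hLfin : ∫⁻ z, ENNReal.ofReal (kernel b ε z.1 z.2.1) * (‖f s z.1‖ₑ * ‖f s z.2.1‖ₑ) *
        ENNReal.ofReal (W z.1) ∂tripleMeasure ≠ ∞ := by
      have := measurable_L1 (f s)
      exact lintegral_mul_ofReal_ne_top (by fun_prop) hk.ne fun z => hWM z.1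
    have hXfin := lintegral_enorm_mul_ne_top (f s) hWM
    have hX : Λ (f s) = (∫⁻ p, ‖f s p‖ₑ * ENNReal.ofReal (W p)).toReal := by
      rw [hΛ, integral_mul_eq_toReal (S.nonneg s hs') hWm hW0]
    have h2 := toReal_sub_le_of_le_add hLfin hXfin hC h1
    rw [← hX] at h2
    rw [hΛ, S.integral_deriv_mul hb₁ hb₂ hε hs' hWm hW0 hWM, mul_assoc]
    have h3 : C.toReal * Λ (f s) ^ 2 ≤ C.toReal * (1 + Λ (f s)) ^ 2 := by
      have := hpos s hs'
      gcongr
      linarith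
    exact mul_le_mul_of_nonneg_left (h2.trans h3) hC₁.le
  have h0 : 1 + Λ (f 0) ≤ 1 + Y := by
    rw [hΛ, integral_mul_eq_toReal (S.nonneg 0 h00) hWm hW0, S.initial]
    gcongr
    refine ENNReal.toReal_le_of_le_ofReal hY (le_trans (lintegral_mono_ae ?_) hf₀)
    filter_upwards [ae_ne_zero] with p hp
    have : 0 < ‖p‖ := norm_pos_iff.2 hp
    gcongr
    simp only [hW, wtSq, one_div]
    gcongr
    linarith
  -- The summand `1` keeps the quantity strictly positive, even for the zero solution.
  have hb := le_two_mul_of_deriv_le_sq (y := fun s => 1 + Λ (f s))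
    (y' := fun s => Λ (derivWithin f (Icc 0 T) s)) (T := T) (C := C₁ * C.toReal)
    (continuousOn_const.add (Λ.continuous.comp_continuousOn S.contDiffOn.continuousOn))
    (fun s hs => (Λ.hasFDerivAt.comp_hasDerivWithinAt s (S.hasDerivWithinAt_Ici hs)).const_add 1)
    (fun s hs => by have := hpos s hs; positivity) hdiff (by positivity)
    (by
      refine le_trans ?_ hT
      have := hpos 0 h00
      gcongr
      linarith) hs
  have hfin := lintegral_enorm_mul_ne_top (f s) hWM
  rw [← ENNReal.ofReal_toReal hfin, ← integral_mul_eq_toReal (S.nonneg s hs) hWm hW0, ← hΛ]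
  refine ENNReal.ofReal_le_ofReal ?_
  linarith

/-- Propagation of the moment of order `2`. -/
theorem exists_moment_two_bound (hb₁ : 1 < b) (hb₂ : b < 2) {C₁ : ℝ} (hC₁ : 0 < C₁)
    {ε T A : ℝ} {f₀ : L1} {f : ℝ → L1} (hε : 0 ≤ ε) (S : IsSolution C₁ b ε (Icc 0 T) f₀ f)
    (hA : 0 ≤ A) (hfA : ∀ s ∈ Icc 0 T, ∫⁻ p, ‖f s p‖ₑ * ENNReal.ofReal (wtSq p) ≤ ENNReal.ofReal A)
    (hf₀ : ∫⁻ p, ‖f₀ p‖ₑ * ENNReal.ofReal (‖p‖ ^ 2) ≠ ∞) :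
    ∃ B : ℝ, ∀ s ∈ Icc 0 T, ∫⁻ p, ‖f s p‖ₑ * ENNReal.ofReal (‖p‖ ^ 2) ≤ ENNReal.ofReal B := by
  set K : ℝ := C₁ * (64 * Real.pi * A) with hK
  have hK0 : 0 ≤ K := by positivity
  set Y : ℝ := (∫⁻ p, ‖f₀ p‖ₑ * ENNReal.ofReal (‖p‖ ^ 2)).toReal with hY
  refine ⟨(A + Y) * Real.exp (K * T), fun s hs => ?_⟩
  refine lintegral_normSq_le_of_forall (measurable_L1 (f s)).enorm fun n => ?_
  set N : ℝ := (n : ℝ) + 1 with hN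
  have hN1 : 1 ≤ N := by rw [hN]; linarith [n.cast_nonneg (α := ℝ)]
  set W : Mom → ℝ := fun p => min (‖p‖ ^ 2) (N ^ 2) with hW
  have hWm : Measurable W := by rw [hW]; fun_prop
  have hW0 : ∀ p, 0 ≤ W p := fun p => le_min (sq_nonneg _) (sq_nonneg _)
  have hWM : ∀ p, W p ≤ N ^ 2 := fun p => min_le_right _ _
  have hWabs : ∀ p, |W p| ≤ N ^ 2 := fun p => by rw [abs_of_nonneg (hW0 p)]; exact hWM p
  obtain ⟨Λ, hΛ⟩ := exists_integral_functional hWm hWabs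
  have hΛ' : ∀ s ∈ Icc 0 T, Λ (f s) = (∫⁻ p, ‖f s p‖ₑ * ENNReal.ofReal (W p)).toReal := fun s hs => by
    rw [hΛ, integral_mul_eq_toReal (S.nonneg s hs) hWm hW0]
  have h00 : (0 : ℝ) ∈ Icc 0 T := ⟨le_rfl, hs.1.trans hs.2⟩
  -- The loss is discarded. In the gain one factor is bounded by the known moment `A`, and `A`
  -- bounds the mass as well, so the inequality is linear with `K` independent of the truncation.
  have hdiff : ∀ s ∈ Ico 0 T, Λ (derivWithin f (Icc 0 T) s) ≤ K * (A + Λ (f s)) := by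
    intro s hs
    have hs' := Ico_subset_Icc_self hs
    have hm := measurable_L1 (f s)
    have h1 := lintegral_gain_min_le hb₁ hb₂ ε hN1 (F := fun p => ‖f s p‖ₑ) hm.enorm
    have hXfin := lintegral_enorm_mul_ne_top (f s) hWM
    have h2 : ∫⁻ p, ‖f s p‖ₑ * ENNReal.ofReal (1 + W p) ≤ ENNReal.ofReal (A + Λ (f s)) := by
      rw [hΛ' s hs', ENNReal.ofReal_add hA ENNReal.toReal_nonneg, ENNReal.ofReal_toReal hXfin]
      have : ∀ p, ‖f s p‖ₑ * ENNReal.ofReal (1 + W p) = ‖f s p‖ₑ + ‖f s p‖ₑ * ENNReal.ofReal (W p) := by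
        intro p
        rw [ENNReal.ofReal_add zero_le_one (hW0 p), ENNReal.ofReal_one, mul_add, mul_one]
      simp_rw [this]
      rw [lintegral_add_left hm.enorm]
      gcongr
      refine le_trans (lintegral_mono fun p => ?_) (hfA s hs')
      refine le_mul_of_one_le_right (zero_le) ?_
      rw [← ENNReal.ofReal_one]
      exact ENNReal.ofReal_le_ofReal (one_le_wtSq p)
    have h3 := h1.trans (mul_le_mul_right (mul_le_mul' h2 (hfA s hs')) _)
    have hAΛ : 0 ≤ A + Λ (f s) := by
      rw [hΛ' s hs']; positivity
    rw [← ENNReal.ofReal_mul hAΛ, ← ENNReal.ofReal_mul (by positivity)] at h3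
    have h4 := ENNReal.toReal_le_of_le_ofReal (by positivity) h3
    rw [hΛ, S.integral_deriv_mul hb₁ hb₂ hε hs' hWm hW0 hWM, hK, mul_assoc]
    refine mul_le_mul_of_nonneg_left ?_ hC₁.le
    refine (sub_le_self _ ENNReal.toReal_nonneg).trans (h4.trans_eq ?_)
    ring
  have hb := le_exp_mul_of_deriv_le (y := fun s => A + Λ (f s))
    (y' := fun s => Λ (derivWithin f (Icc 0 T) s)) (T := T) (K := K)
    (continuousOn_const.add (Λ.continuous.comp_continuousOn S.contDiffOn.continuousOn))
    (fun s hs => (Λ.hasFDerivAt.comp_hasDerivWithinAt s (S.hasDerivWithinAt_Ici hs)).const_add A)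
    hdiff hs
  have h0 : Λ (f 0) ≤ Y := by
    rw [hΛ' 0 h00, S.initial, hY]
    refine ENNReal.toReal_mono hf₀ (lintegral_mono fun p => ?_)
    gcongr
    exact min_le_left _ _
  rw [← ENNReal.ofReal_toReal (lintegral_enorm_mul_ne_top (f s) hWM), ← hΛ' s hs]
  refine ENNReal.ofReal_le_ofReal ?_
  calc Λ (f s) ≤ A + Λ (f s) := by linarith
    _ ≤ (A + Λ (f 0)) * Real.exp (K * s) := hb
    _ ≤ (A + Y) * Real.exp (K * T) := by
        have : 0 ≤ Λ (f 0) := by rw [hΛ' 0 h00]; exact ENNReal.toReal_nonneg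
        gcongr
        exact hs.2

end

end MasslessBoltzmann

/-! ### The difference of two collision operators -/

namespace MasslessBoltzmann

noncomputable section

variable {b : ℝ}

/-- Telescoping of the products and of the kernel. The term `k fq (fp - gp)` is added on the left
since it is the dissipative part of the loss, to be used with its sign and not in absolute value. -/
lemma enorm_sub_add_dissipation_le {k k' k₀ R κ fo fo' fp fq go go' gp gq : ℝ} (hk₀ : |k| ≤ k₀)
    (hR : 0 ≤ R) (hκ : 0 ≤ κ) (hk : |k - k'| ≤ R * κ) :
    ‖k * (fo * fo') - k * (fp * fq) - (k' * (go * go') - k' * (gp * gq)) +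
        k * fq * (fp - gp)‖ₑ
      ≤ ENNReal.ofReal k₀ * (‖fo - go‖ₑ * ‖fo'‖ₑ) + ENNReal.ofReal k₀ * (‖go‖ₑ * ‖fo' - go'‖ₑ) +
        ENNReal.ofReal R * (ENNReal.ofReal κ * (‖go‖ₑ * ‖go'‖ₑ)) +
        ENNReal.ofReal k₀ * (‖gp‖ₑ * ‖fq - gq‖ₑ) +
        ENNReal.ofReal R * (ENNReal.ofReal κ * (‖gp‖ₑ * ‖gq‖ₑ)) := by
  have hk0 : 0 ≤ k₀ := (abs_nonneg k).trans hk₀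
  simp only [Real.enorm_eq_ofReal_abs]
  rw [← ENNReal.ofReal_mul (abs_nonneg _), ← ENNReal.ofReal_mul (abs_nonneg _),
    ← ENNReal.ofReal_mul (abs_nonneg _), ← ENNReal.ofReal_mul (abs_nonneg _),
    ← ENNReal.ofReal_mul (abs_nonneg _), ← ENNReal.ofReal_mul hk0, ← ENNReal.ofReal_mul hk0,
    ← ENNReal.ofReal_mul hk0, ← ENNReal.ofReal_mul hκ, ← ENNReal.ofReal_mul hκ,
    ← ENNReal.ofReal_mul hR, ← ENNReal.ofReal_mul hR,
    ← ENNReal.ofReal_add (by positivity) (by positivity),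
    ← ENNReal.ofReal_add (by positivity) (by positivity),
    ← ENNReal.ofReal_add (by positivity) (by positivity),
    ← ENNReal.ofReal_add (by positivity) (by positivity)]
  refine ENNReal.ofReal_le_ofReal ?_
  have e : k * (fo * fo') - k * (fp * fq) - (k' * (go * go') - k' * (gp * gq)) + k * fq * (fp - gp)
      = k * ((fo - go) * fo') + k * (go * (fo' - go')) + (k - k') * (go * go')
        + -(k * (gp * (fq - gq))) + -((k - k') * (gp * gq)) := by ring
  rw [e]
  refine (abs_add_le _ _).trans (add_le_add ((abs_add_le _ _).trans (add_le_add
    ((abs_add_le _ _).trans (add_le_add ((abs_add_le _ _).trans (add_le_add ?_ ?_)) ?_)) ?_)) ?_)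
  · rw [abs_mul, abs_mul]; gcongr
  · rw [abs_mul, abs_mul]; gcongr
  · rw [abs_mul, abs_mul go, ← mul_assoc R]; gcongr
  · rw [abs_neg, abs_mul, abs_mul]; gcongr
  · rw [abs_neg, abs_mul, abs_mul gp, ← mul_assoc R]; gcongr

lemma lintegral_wt_le {F : Mom → ℝ≥0∞} {A : ℝ}
    (hF : ∫⁻ p, F p * ENNReal.ofReal (wtSq p) ≤ ENNReal.ofReal A) :
    ∫⁻ p, F p * ENNReal.ofReal (wt p) ≤ ENNReal.ofReal (2 * A) := by
  rw [ENNReal.ofReal_mul two_pos.le]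
  refine le_trans ?_ (mul_le_mul_right hF _)
  rw [← lintegral_const_mul' _ _ ENNReal.ofReal_ne_top]
  refine lintegral_mono fun p => ?_
  refine (mul_le_mul_right (ENNReal.ofReal_le_ofReal (wt_le_wtSq p)) (F p)).trans_eq ?_
  rw [ENNReal.ofReal_mul two_pos.le]
  ring

/-- Total collision rate in terms of moments. -/
lemma lintegral_kernel_le_wt (hb₁ : 1 < b) (hb₂ : b < 2) (ε : ℝ) {F G : Mom → ℝ≥0∞}
    (hF : Measurable F) (hG : Measurable G) :
    ∫⁻ z, ENNReal.ofReal (kernel b ε z.1 z.2.1) * (F z.1 * G z.2.1) ∂tripleMeasure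
      ≤ ENNReal.ofReal (8 * Real.pi) * ((∫⁻ p, F p * ENNReal.ofReal (wt p)) *
        ∫⁻ p, G p * ENNReal.ofReal (wt p)) := by
  refine (lintegral_kernel_le two_pos.le (s := -(b / 2)) (fun p q =>
    (kernel_le_kernel_zero b ε p q).trans (kernel_zero_le hb₁ hb₂ p q)) hF hG).trans ?_
  rw [show 4 * Real.pi * 2 = 8 * Real.pi by ring]
  gcongr with p p <;> exact rpow_neg_le_wt (by linarith) (by linarith) p

lemma lintegral_kernel_lt_top_of_moment (hb₁ : 1 < b) (hb₂ : b < 2) (ε : ℝ) {f g : L1} {A : ℝ}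
    (hf : ∫⁻ p, ‖f p‖ₑ * ENNReal.ofReal (wtSq p) ≤ ENNReal.ofReal A)
    (hg : ∫⁻ p, ‖g p‖ₑ * ENNReal.ofReal (wtSq p) ≤ ENNReal.ofReal A) :
    ∫⁻ z, ENNReal.ofReal (kernel b ε z.1 z.2.1) * (‖f z.1‖ₑ * ‖g z.2.1‖ₑ) ∂tripleMeasure < ∞ :=
  (lintegral_kernel_le_wt hb₁ hb₂ ε (measurable_L1 f).enorm (measurable_L1 g).enorm).trans_lt
    (ENNReal.mul_lt_top ENNReal.ofReal_lt_top (ENNReal.mul_lt_top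
      ((lintegral_wt_le hf).trans_lt ENNReal.ofReal_lt_top)
      ((lintegral_wt_le hg).trans_lt ENNReal.ofReal_lt_top)))

/-- The difference of two collision operators, up to a dissipative term. -/
theorem exists_collisionOp_sub_le {b' : ℝ} (hb₁ : 1 < b) (hb₂ : b < 2) (hb'₁ : 1 < b')
    (hb'₂ : b' < 2) {C₁ : ℝ} (hC₁ : 0 < C₁) :
    ∃ C : ℝ, 0 < C ∧ ∀ {ε ε' R A : ℝ} {f g : L1}, 0 ≤ f → 0 ≤ R → 0 ≤ A →
      (∀ p q, |kernel b ε p q - kernel b ε' p q| ≤ R * kernel b' 0 p q) →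
      ∫⁻ p, ‖f p‖ₑ * ENNReal.ofReal (wtSq p) ≤ ENNReal.ofReal A →
      ∫⁻ p, ‖g p‖ₑ * ENNReal.ofReal (wtSq p) ≤ ENNReal.ofReal A →
      ∃ Λ r : Mom → ℝ, Measurable Λ ∧ (∀ p, 0 ≤ Λ p) ∧
        (∀ᵐ p, collisionOp C₁ b ε f p - collisionOp C₁ b ε' g p = r p - Λ p * (f p - g p)) ∧
        ∫⁻ p, ‖r p‖ₑ * ENNReal.ofReal (wt p)
          ≤ ENNReal.ofReal (C * A) * (∫⁻ p, ‖f p - g p‖ₑ * ENNReal.ofReal (wt p))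
            + ENNReal.ofReal (C * R * A ^ 2) ∧
        ∫⁻ p, ‖Λ p * (f p - g p)‖ₑ
          ≤ ENNReal.ofReal (C * A) * ∫⁻ p, ‖f p - g p‖ₑ * ENNReal.ofReal (wt p) := by
  obtain ⟨c, hc, hcb⟩ := exists_lintegral_gain_wt_le hb₁ hb₂
  obtain ⟨d, hd, hdb⟩ := exists_lintegral_gain_wt_le hb'₁ hb'₂
  set c' := c.toReal with hc'
  set d' := d.toReal with hd'
  have hcc : c = ENNReal.ofReal c' := (ENNReal.ofReal_toReal hc).symm
  have hdd : d = ENNReal.ofReal d' := (ENNReal.ofReal_toReal hd).symm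
  have hc0 : 0 ≤ c' := ENNReal.toReal_nonneg
  have hd0 : 0 ≤ d' := ENNReal.toReal_nonneg
  -- One constant for three bounds, with coefficients `2c' + 16π` for the difference, `2d' + 32π`
  -- for the change of kernel, and `16π` for the dissipative term.
  refine ⟨C₁ * (2 * c' + 2 * d' + 48 * Real.pi), by positivity,
    fun {ε ε' R A f g} hf0 hR hA hker hf hg => ?_⟩
  have hfm := measurable_L1 f
  have hgm := measurable_L1 g
  set u := ∫⁻ p, ‖f p - g p‖ₑ * ENNReal.ofReal (wt p) with hu
  have hff := lintegral_kernel_lt_top_of_moment hb₁ hb₂ ε hf hf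
  have hgg := lintegral_kernel_lt_top_of_moment hb₁ hb₂ ε' hg hg
  have hgf := lintegral_kernel_lt_top_of_moment hb₁ hb₂ ε hg hf
  -- The collision frequency of a particle of momentum `p` in the gas `f`. As `f ≥ 0`, the maximum
  -- does not change its value and only makes the sign evident.
  set Λ : Mom → ℝ := fun p => C₁ * max 0 (∫ x, kernel b ε p x.1 * f x.1 ∂collisionMeasure) with hΛ
  have hf0' : ∀ᵐ x ∂collisionMeasure, 0 ≤ f x.1 := by
    have := Measure.quasiMeasurePreserving_fst (μ := (volume : Measure Mom))
      (ν := (volume : Measure Mom).toSphere)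
    exact this.ae (coeFn_nonneg hf0)
  have hΛ' : ∀ p, Λ p = C₁ * ∫ x, kernel b ε p x.1 * f x.1 ∂collisionMeasure := fun p => by
    simp only [hΛ]
    rw [max_eq_right]
    refine integral_nonneg_of_ae ?_
    filter_upwards [hf0'] with x hx
    exact mul_nonneg (kernel_nonneg _ _ _ _) hx
  set r : Mom → ℝ := fun p => collisionOp C₁ b ε f p - collisionOp C₁ b ε' g p
    + Λ p * (f p - g p) with hr
  set Φ : Mom × Mom × Dir → ℝ≥0∞ := fun z =>
      ENNReal.ofReal (kernel b 0 z.1 z.2.1) * (‖f (outMom z.1 z.2.1 z.2.2) -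
        g (outMom z.1 z.2.1 z.2.2)‖ₑ * ‖f (outMom' z.1 z.2.1 z.2.2)‖ₑ) +
      ENNReal.ofReal (kernel b 0 z.1 z.2.1) * (‖g (outMom z.1 z.2.1 z.2.2)‖ₑ *
        ‖f (outMom' z.1 z.2.1 z.2.2) - g (outMom' z.1 z.2.1 z.2.2)‖ₑ) +
      ENNReal.ofReal R * (ENNReal.ofReal (kernel b' 0 z.1 z.2.1) *
        (‖g (outMom z.1 z.2.1 z.2.2)‖ₑ * ‖g (outMom' z.1 z.2.1 z.2.2)‖ₑ)) +
      ENNReal.ofReal (kernel b 0 z.1 z.2.1) * (‖g z.1‖ₑ * ‖f z.2.1 - g z.2.1‖ₑ) +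
      ENNReal.ofReal R * (ENNReal.ofReal (kernel b' 0 z.1 z.2.1) * (‖g z.1‖ₑ * ‖g z.2.1‖ₑ)) with hΦ
  have hΛm : Measurable Λ := by
    have h := StronglyMeasurable.integral_prod_right' (ν := collisionMeasure)
      (f := fun z : Mom × Mom × Dir => kernel b ε z.1 z.2.1 * f z.2.1)
      (by fun_prop : Measurable _).stronglyMeasurable
    exact (measurable_const.max h.measurable).const_mul C₁
  refine ⟨Λ, r, hΛm, fun p => mul_nonneg hC₁.le (le_max_left _ _), ae_of_all _ fun p => ?_, ?_, ?_⟩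
  · simp only [hr]; ring
  · have hr' : ∀ᵐ p, ‖r p‖ₑ ≤ ENNReal.ofReal C₁ * ∫⁻ x, Φ (p, x) ∂collisionMeasure := by
      filter_upwards [(integrable_gain_triple hfm hfm hff).prod_right_ae,
        (integrable_loss_triple hfm hfm hff).prod_right_ae,
        (integrable_gain_triple hgm hgm hgg).prod_right_ae,
        (integrable_loss_triple hgm hgm hgg).prod_right_ae,
        (integrable_loss_triple hgm hfm hgf).prod_right_ae] with p h1 h2 h3 h4 h5
      change Integrable (gainIntegrand b ε f p) collisionMeasure at h1
      change Integrable (lossIntegrand b ε f p) collisionMeasure at h2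
      change Integrable (gainIntegrand b ε' g p) collisionMeasure at h3
      change Integrable (lossIntegrand b ε' g p) collisionMeasure at h4
      have e : r p = C₁ * ∫ x, (gainIntegrand b ε f p x - lossIntegrand b ε f p x
          - (gainIntegrand b ε' g p x - lossIntegrand b ε' g p x)
          + kernel b ε p x.1 * f x.1 * (f p - g p)) ∂collisionMeasure := by
        have h6 : Integrable (fun x => kernel b ε p x.1 * f x.1 * (f p - g p)) collisionMeasure := by
          refine (h2.sub h5).congr (ae_of_all _ fun x => ?_)
          simp only [Pi.sub_apply, lossIntegrand]; ring
        have h7 : Integrable (fun x => gainIntegrand b ε f p x - lossIntegrand b ε f p x)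
          collisionMeasure := h1.sub h2
        have h8 : Integrable (fun x => gainIntegrand b ε' g p x - lossIntegrand b ε' g p x)
          collisionMeasure := h3.sub h4
        have h9 : Integrable (fun x => gainIntegrand b ε f p x - lossIntegrand b ε f p x -
          (gainIntegrand b ε' g p x - lossIntegrand b ε' g p x)) collisionMeasure := h7.sub h8
        rw [integral_add h9 h6, integral_mul_const, integral_sub h7 h8]
        simp only [hr, hΛ', collisionOp]
        ring
      rw [e, enorm_mul, Real.enorm_of_nonneg hC₁.le]
      refine mul_le_mul_right ((enorm_integral_le_lintegral_enorm _).trans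
        (lintegral_mono fun x => ?_)) _
      refine enorm_sub_add_dissipation_le ?_ hR (kernel_nonneg _ _ _ _) (hker p x.1)
      rw [abs_of_nonneg (kernel_nonneg _ _ _ _)]
      exact kernel_le_kernel_zero _ _ _ _
    have hΦm : Measurable Φ := by rw [hΦ]; fun_prop
    have hstep : ∫⁻ p, ‖r p‖ₑ * ENNReal.ofReal (wt p)
        ≤ ENNReal.ofReal C₁ * ∫⁻ z, Φ z * ENNReal.ofReal (wt z.1) ∂tripleMeasure := by
      rw [lintegral_prod _ (by fun_prop), ← lintegral_const_mul' _ _ ENNReal.ofReal_ne_top]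
      refine lintegral_mono_ae ?_
      filter_upwards [hr'] with p hp
      refine (mul_le_mul_left hp _).trans_eq ?_
      rw [mul_assoc, lintegral_mul_const _ (by fun_prop)]
    have hfw := lintegral_wt_le hf
    have hgw := lintegral_wt_le hg
    have hum : Measurable fun p => ‖f p - g p‖ₑ := by fun_prop
    -- In every term the difference carries the weight `1 + 1/p` and the solution the weight `1 +
    -- 1/p²`.
    have t1 := (hcb (fun p => ‖f p - g p‖ₑ) (fun p => ‖f p‖ₑ) hum hfm.enorm).1
    have t2 := (hcb (fun p => ‖g p‖ₑ) (fun p => ‖f p - g p‖ₑ) hgm.enorm hum).2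
    have t3 := (hdb (fun p => ‖g p‖ₑ) (fun p => ‖g p‖ₑ) hgm.enorm hgm.enorm).1
    have t4 := lintegral_loss_wt_le hb₁ hb₂ hgm.enorm hum
    have t5 := lintegral_loss_wt_le hb'₁ hb'₂ hgm.enorm hgm.enorm
    have s1 := t1.trans (mul_le_mul_right (mul_le_mul_right hf u) c)
    have s2 := t2.trans (mul_le_mul_right (mul_le_mul_left hg u) c)
    have s3 := t3.trans (mul_le_mul_right (mul_le_mul' hgw hg) d)
    have s4 := t4.trans (mul_le_mul_right (mul_le_mul_left hg u) _)
    have s5 := t5.trans (mul_le_mul_right (mul_le_mul' hg hgw) _)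
    have hsum : ∫⁻ z, Φ z * ENNReal.ofReal (wt z.1) ∂tripleMeasure
        ≤ c * (u * ENNReal.ofReal A) + c * (ENNReal.ofReal A * u) +
          ENNReal.ofReal R * (d * (ENNReal.ofReal (2 * A) * ENNReal.ofReal A)) +
          ENNReal.ofReal (16 * Real.pi) * (ENNReal.ofReal A * u) +
          ENNReal.ofReal R * (ENNReal.ofReal (16 * Real.pi) *
            (ENNReal.ofReal A * ENNReal.ofReal (2 * A))) := by
      simp only [hΦ, add_mul, mul_assoc (ENNReal.ofReal R)]
      rw [lintegral_add_left (by fun_prop), lintegral_add_left (by fun_prop),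
        lintegral_add_left (by fun_prop), lintegral_add_left (by fun_prop),
        lintegral_const_mul _ (by fun_prop), lintegral_const_mul _ (by fun_prop)]
      exact add_le_add (add_le_add (add_le_add (add_le_add s1 s2) (mul_le_mul_right s3 _)) s4)
        (mul_le_mul_right s5 _)
    refine hstep.trans ((mul_le_mul_right hsum _).trans ?_)
    have e1 : ENNReal.ofReal C₁ * (c * (u * ENNReal.ofReal A) + c * (ENNReal.ofReal A * u) +
          ENNReal.ofReal R * (d * (ENNReal.ofReal (2 * A) * ENNReal.ofReal A)) +
          ENNReal.ofReal (16 * Real.pi) * (ENNReal.ofReal A * u) +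
          ENNReal.ofReal R * (ENNReal.ofReal (16 * Real.pi) *
            (ENNReal.ofReal A * ENNReal.ofReal (2 * A))))
        = ENNReal.ofReal (C₁ * (2 * c' + 16 * Real.pi) * A) * u
          + ENNReal.ofReal (C₁ * R * (2 * d' + 32 * Real.pi) * A ^ 2) := by
      rw [hcc, hdd]
      rw [show C₁ * (2 * c' + 16 * Real.pi) * A = C₁ * (c' * A + c' * A + 16 * Real.pi * A) by ring,
        show C₁ * R * (2 * d' + 32 * Real.pi) * A ^ 2
          = C₁ * (R * (d' * (2 * A * A)) + R * (16 * Real.pi * (A * (2 * A)))) by ring,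
        ENNReal.ofReal_mul hC₁.le, ENNReal.ofReal_mul hC₁.le,
        ENNReal.ofReal_add (by positivity) (by positivity),
        ENNReal.ofReal_add (by positivity) (by positivity),
        ENNReal.ofReal_add (by positivity) (by positivity),
        ENNReal.ofReal_mul hc0, ENNReal.ofReal_mul (p := 16 * Real.pi) (by positivity),
        ENNReal.ofReal_mul hR, ENNReal.ofReal_mul hR,
        ENNReal.ofReal_mul hd0, ENNReal.ofReal_mul (p := 16 * Real.pi) (by positivity),
        ENNReal.ofReal_mul (p := 2 * A) (by positivity),
        ENNReal.ofReal_mul hA]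
      ring
    rw [e1]
    refine add_le_add (mul_le_mul_left (ENNReal.ofReal_le_ofReal ?_) _) (ENNReal.ofReal_le_ofReal ?_)
    · exact mul_le_mul_of_nonneg_right (mul_le_mul_of_nonneg_left (by linarith [Real.pi_pos]) hC₁.le) hA
    · rw [show C₁ * (2 * c' + 2 * d' + 48 * Real.pi) * R = C₁ * R * (2 * c' + 2 * d' + 48 * Real.pi)
        by ring]
      exact mul_le_mul_of_nonneg_right (mul_le_mul_of_nonneg_left (by linarith [Real.pi_pos])
        (by positivity)) (by positivity)
  -- The dissipative term is bounded in plain `L¹` only: the factor `p^(-b/2)` of the kernel uses up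
  -- the weight of the difference.
  · have hum : Measurable fun p => ‖f p - g p‖ₑ := by fun_prop
    have h1 : ∀ p, ‖Λ p * (f p - g p)‖ₑ ≤ ENNReal.ofReal C₁ * ∫⁻ x, ENNReal.ofReal (kernel b ε p x.1)
        * (‖f p - g p‖ₑ * ‖f x.1‖ₑ) ∂collisionMeasure := fun p => by
      rw [hΛ', mul_assoc, ← integral_mul_const, enorm_mul, Real.enorm_of_nonneg hC₁.le]
      refine mul_le_mul_right ((enorm_integral_le_lintegral_enorm _).trans_eq
        (lintegral_congr fun x => ?_)) _
      rw [enorm_mul, enorm_mul, Real.enorm_of_nonneg (kernel_nonneg _ _ _ _)]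
      ring
    have h2 := lintegral_kernel_le_wt hb₁ hb₂ ε hum hfm.enorm
    rw [lintegral_prod _ (by fun_prop)] at h2
    have hfw := lintegral_wt_le hf
    calc _ ≤ ∫⁻ p, ENNReal.ofReal C₁ * ∫⁻ x, ENNReal.ofReal (kernel b ε p x.1)
        * (‖f p - g p‖ₑ * ‖f x.1‖ₑ) ∂collisionMeasure := lintegral_mono h1
      _ = ENNReal.ofReal C₁ * ∫⁻ p, ∫⁻ x, ENNReal.ofReal (kernel b ε p x.1)
        * (‖f p - g p‖ₑ * ‖f x.1‖ₑ) ∂collisionMeasure :=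
          lintegral_const_mul' _ _ ENNReal.ofReal_ne_top
      _ ≤ ENNReal.ofReal C₁ * (ENNReal.ofReal (8 * Real.pi) * (u * ENNReal.ofReal (2 * A))) :=
          mul_le_mul_right (h2.trans (mul_le_mul_right (mul_le_mul_right hfw _) _)) _
      _ = ENNReal.ofReal (C₁ * (8 * Real.pi * (2 * A))) * u := by
          rw [ENNReal.ofReal_mul hC₁.le, ENNReal.ofReal_mul (p := 8 * Real.pi) (by positivity)]
          ring
      _ ≤ _ := by
          refine mul_le_mul_left (ENNReal.ofReal_le_ofReal ?_) _
          rw [mul_assoc C₁ (_ + _) A]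
          refine mul_le_mul_of_nonneg_left ?_ hC₁.le
          nlinarith [Real.pi_pos, mul_nonneg hc0 hA, mul_nonneg hd0 hA, mul_nonneg Real.pi_pos.le hA]

end

end MasslessBoltzmann

/-! ### Gronwall estimates for dissipative evolutions -/

namespace MasslessBoltzmann

noncomputable section

variable {b : ℝ}

lemma lintegral_mul_le_of_forall_min {F : Mom → ℝ≥0∞} (hF : Measurable F) {W : Mom → ℝ}
    (hW : Measurable W) {A : ℝ≥0∞}
    (h : ∀ n : ℕ, ∫⁻ p, F p * ENNReal.ofReal (min (W p) n) ≤ A) :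
    ∫⁻ p, F p * ENNReal.ofReal (W p) ≤ A := by
  have h1 : ∫⁻ p, F p * ENNReal.ofReal (W p) ≤ ∫⁻ p, liminf (fun n : ℕ => F p *
      ENNReal.ofReal (min (W p) n)) atTop := by
    refine lintegral_mono fun p => ?_
    refine (Tendsto.liminf_eq (tendsto_const_nhds.congr' ?_)).ge
    filter_upwards [eventually_ge_atTop ⌈W p⌉₊] with n hn
    rw [min_eq_left (Nat.ceil_le.1 hn)]
  refine h1.trans ((lintegral_liminf_le fun n => by fun_prop).trans ?_)
  exact liminf_le_of_frequently_le' (Frequently.of_forall h)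

lemma enorm_L1 (f : L1) : ∫⁻ p, ‖f p‖ₑ = ENNReal.ofReal ‖f‖ := by
  rw [ofReal_norm, Lp.enorm_def, eLpNorm_one_eq_lintegral_enorm]

/-- One implicit Euler step. With `e` the error, `(1 + τΛ)u = w + e + τr`, and the factor `1 + τΛ ≥
1` can be dropped, however large `Λ` is. The error is small in `L¹` only, which is why `W` has to be
bounded. -/
lemma lintegral_enorm_le_of_dissipative {u w v : L1} {r Λ : Mom → ℝ} (hΛ : ∀ p, 0 ≤ Λ p)
    (hv : ∀ᵐ p, v p = r p - Λ p * u p) {τ : ℝ} (hτ : 0 ≤ τ) {W : Mom → ℝ} (hWm : Measurable W)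
    {M : ℝ} (hWM : ∀ p, W p ≤ M) (hWw : ∀ p, W p ≤ wt p) :
    ∫⁻ p, ‖u p‖ₑ * ENNReal.ofReal (W p) ≤ (∫⁻ p, ‖w p‖ₑ * ENNReal.ofReal (W p))
      + ENNReal.ofReal (M * ‖u - w - τ • v‖)
      + ENNReal.ofReal τ * ∫⁻ p, ‖r p‖ₑ * ENNReal.ofReal (wt p) := by
  set e := u - w - τ • v with he
  have hpt : ∀ᵐ p, ‖u p‖ₑ * ENNReal.ofReal (W p) ≤ ‖w p‖ₑ * ENNReal.ofReal (W p)
      + ENNReal.ofReal M * ‖e p‖ₑ + ENNReal.ofReal τ * (‖r p‖ₑ * ENNReal.ofReal (wt p)) := by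
    filter_upwards [hv, Lp.coeFn_sub (u - w) (τ • v), Lp.coeFn_sub u w, Lp.coeFn_smul τ v]
      with p h1 h2 h3 h4
    have he' : e p = u p - w p - τ * (r p - Λ p * u p) := by
      rw [he, h2, Pi.sub_apply, h3, Pi.sub_apply, h4, Pi.smul_apply, h1, smul_eq_mul]
    have h5 : |u p| ≤ |w p| + |e p| + τ * |r p| := by
      have h6 : (1 + τ * Λ p) * u p = w p + e p + τ * r p := by rw [he']; ring
      have h7 : 0 ≤ τ * Λ p := mul_nonneg hτ (hΛ p)
      have h8 : |u p| ≤ |(1 + τ * Λ p) * u p| := by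
        rw [abs_mul, abs_of_nonneg (by linarith : 0 ≤ 1 + τ * Λ p)]
        nlinarith [mul_nonneg h7 (abs_nonneg (u p))]
      rw [h6] at h8
      refine h8.trans ((abs_add_le _ _).trans (add_le_add (abs_add_le _ _) ?_))
      rw [abs_mul, abs_of_nonneg hτ]
    have h9 : ‖u p‖ₑ ≤ ‖w p‖ₑ + ‖e p‖ₑ + ENNReal.ofReal τ * ‖r p‖ₑ := by
      simp only [Real.enorm_eq_ofReal_abs]
      rw [← ENNReal.ofReal_mul hτ, ← ENNReal.ofReal_add (abs_nonneg _) (abs_nonneg _),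
        ← ENNReal.ofReal_add (by positivity) (by positivity)]
      exact ENNReal.ofReal_le_ofReal h5
    calc _ ≤ (‖w p‖ₑ + ‖e p‖ₑ + ENNReal.ofReal τ * ‖r p‖ₑ) * ENNReal.ofReal (W p) :=
          mul_le_mul_left h9 _
      _ = ‖w p‖ₑ * ENNReal.ofReal (W p) + ENNReal.ofReal (W p) * ‖e p‖ₑ
          + ENNReal.ofReal τ * (‖r p‖ₑ * ENNReal.ofReal (W p)) := by ring
      _ ≤ _ := by
          gcongr
          · exact hWM p
          · exact hWw p
  have hu := measurable_L1 w
  have hem := measurable_L1 e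
  have h0M : ENNReal.ofReal (M * ‖e‖) = ENNReal.ofReal M * ∫⁻ p, ‖e p‖ₑ := by
    rw [enorm_L1, ENNReal.ofReal_mul' (norm_nonneg _)]
  refine (lintegral_mono_ae hpt).trans_eq ?_
  rw [lintegral_add_left (by fun_prop), lintegral_add_left (by fun_prop),
    lintegral_const_mul _ (by fun_prop), lintegral_const_mul' _ _ ENNReal.ofReal_ne_top, h0M]

/-- Integrated form of a dissipative differential inequality in a weighted `L¹` space. -/
lemma lintegral_enorm_wt_le_of_dissipative {h v : ℝ → L1} {T : ℝ} {P P' : ℝ → ℝ}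
    (hder : ∀ s ∈ Icc 0 T, HasDerivWithinAt h (v s) (Icc 0 T) s) (h0 : h 0 = 0)
    (hP : ∀ s, HasDerivAt P (P' s) s) (hP' : ∀ s, 0 ≤ P' s) (hP0 : P 0 = 0)
    (hv : ∀ s ∈ Icc 0 T, ∃ Λ r : Mom → ℝ, (∀ p, 0 ≤ Λ p) ∧
      (∀ᵐ p, v s p = r p - Λ p * h s p) ∧
      ∫⁻ p, ‖r p‖ₑ * ENNReal.ofReal (wt p) ≤ ENNReal.ofReal (P' s)) {s : ℝ} (hs : s ∈ Icc 0 T) :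
    ∫⁻ p, ‖h s p‖ₑ * ENNReal.ofReal (wt p) ≤ ENNReal.ofReal (P s) := by
  refine lintegral_mul_le_of_forall_min (measurable_L1 (h s)).enorm measurable_wt fun n => ?_
  set W : Mom → ℝ := fun p => min (wt p) n with hW
  have hWm : Measurable W := by rw [hW]; fun_prop
  have hWM : ∀ p, W p ≤ n := fun p => min_le_right _ _
  have hWw : ∀ p, W p ≤ wt p := fun p => min_le_left _ _
  set N : L1 → ℝ := fun u => (∫⁻ p, ‖u p‖ₑ * ENNReal.ofReal (W p)).toReal with hN
  have hfin : ∀ u : L1, ∫⁻ p, ‖u p‖ₑ * ENNReal.ofReal (W p) ≠ ∞ := fun u =>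
    lintegral_enorm_mul_ne_top u hWM
  have hstep : ∀ {u w v : L1} {r Λ : Mom → ℝ} {τ ρ : ℝ}, (∀ p, 0 ≤ Λ p) →
      (∀ᵐ p, v p = r p - Λ p * u p) → 0 ≤ τ → 0 ≤ ρ →
      ∫⁻ p, ‖r p‖ₑ * ENNReal.ofReal (wt p) ≤ ENNReal.ofReal ρ →
      N u ≤ N w + n * ‖u - w - τ • v‖ + τ * ρ := by
    intro u w v r Λ τ ρ hΛ hv hτ hρ hr
    have h1 := (lintegral_enorm_le_of_dissipative (w := w) hΛ hv hτ hWm hWM hWw).trans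
      (add_le_add_right (mul_le_mul_right hr _) _)
    rw [← ENNReal.ofReal_toReal (hfin w), ← ENNReal.ofReal_mul hτ,
      ← ENNReal.ofReal_add ENNReal.toReal_nonneg (by positivity),
      ← ENNReal.ofReal_add (by positivity) (by positivity)] at h1
    exact ENNReal.toReal_le_of_le_ofReal (by positivity) h1
  -- The Euler step with `τ = 0` is the Lipschitz estimate.
  have hlip : LipschitzWith n N := by
    refine LipschitzWith.of_le_add_mul n fun u w => ?_
    have := hstep (u := u) (w := w) (v := 0) (r := fun _ => 0) (Λ := fun _ => 0) (τ := 0) (ρ := 0)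
      (fun _ => le_rfl) (ae_of_all _ fun p => by simp)
      le_rfl le_rfl (by simp)
    rw [dist_eq_norm]
    simpa using this
  have hcont : ContinuousOn h (Icc 0 T) := fun s hs => (hder s hs).continuousWithinAt
  -- Time is reversed: a right difference quotient in `t` is a backward one at `s - t`. The
  -- derivative is thereby taken at the later time, as the implicit step requires.
  have key := image_le_of_liminf_slope_right_le_deriv_boundary
    (f := fun t => N (h s) - N (h (s - t))) (B := fun t => P s - P (s - t))
    (B' := fun t => P' (s - t)) (a := 0) (b := s)
    (continuousOn_const.sub (hlip.continuous.comp_continuousOn (hcont.comp (by fun_prop)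
      fun t ht => ⟨by linarith [ht.2], by linarith [ht.1, hs.2]⟩)))
    (by simp)
    (continuousOn_const.sub ((continuous_iff_continuousAt.2 fun s => (hP s).continuousAt).comp
      (by fun_prop : Continuous fun t => s - t)).continuousOn)
    (fun t _ => by
      have := ((hP (s - t)).scomp t ((hasDerivAt_id t).const_sub s)).const_sub (P s)
      exact (this.congr_deriv (by simp)).hasDerivWithinAt)
    (fun t ht ρ hρ => by
      set y := s - t with hy
      have hyT : y ∈ Icc 0 T := ⟨by linarith [ht.2], by linarith [ht.1, hs.2]⟩
      obtain ⟨Λ, r, hΛ, hvr, hr⟩ := hv y hyT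
      -- The error bound is multiplied by `n`, the bound of the truncated weight; this choice keeps
      -- `n * c` below `ρ - P' y`.
      set c := (ρ - P' y) / (2 * (n + 1)) with hc
      have hc0 : 0 < c := div_pos (sub_pos.2 hρ) (by positivity)
      have ho := (hasDerivWithinAt_iff_isLittleO.1 (hder y hyT)).def hc0
      have ht' : Tendsto (fun z => s - z) (𝓝[>] t) (𝓝[Icc 0 T] y) := by
        refine tendsto_nhdsWithin_iff.2 ⟨?_, ?_⟩
        · exact ((continuous_const.sub continuous_id).tendsto t).mono_left nhdsWithin_le_nhds
        · filter_upwards [Ioo_mem_nhdsGT ht.2] with z hz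
          exact ⟨by linarith [hz.2], by linarith [hz.1, ht.1, hs.2]⟩
      refine ((ht'.eventually ho).and self_mem_nhdsWithin).frequently.mono ?_
      rintro z ⟨hz, hz' : t < z⟩
      have hτ : 0 < z - t := sub_pos.2 hz'
      have h1 := hstep (w := h (s - z)) hΛ hvr hτ.le (hP' y) hr
      have h2 : ‖h y - h (s - z) - (z - t) • v y‖ ≤ c * (z - t) := by
        have e1 : h (s - z) - h y - (s - z - y) • v y = -(h y - h (s - z) - (z - t) • v y) := by
          rw [show s - z - y = -(z - t) by rw [hy]; ring, neg_smul]
          abel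
        rw [e1, norm_neg, show s - z - y = -(z - t) by rw [hy]; ring, norm_neg,
          Real.norm_of_nonneg hτ.le] at hz
        exact hz
      rw [slope_def_field, div_lt_iff₀ hτ]
      have h3 : (n : ℝ) * c < ρ - P' y := by
        rw [hc, mul_div_assoc', div_lt_iff₀ (by positivity)]
        have := sub_pos.2 hρ
        nlinarith [n.cast_nonneg (α := ℝ)]
      have h4 := mul_le_mul_of_nonneg_left h2 (n.cast_nonneg (α := ℝ))
      nlinarith)
    (right_mem_Icc.2 hs.1)
  have hz : N 0 = 0 := by
    simp only [hN]
    simp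
  simp only [sub_self, h0, hz, hP0, sub_zero] at key
  rw [← ENNReal.ofReal_toReal (hfin (h s))]
  exact ENNReal.ofReal_le_ofReal key

/-- A Gronwall inequality in a weighted `L¹` space for dissipative evolutions. -/
lemma lintegral_enorm_wt_le_exp {h v : ℝ → L1} {T c d A : ℝ} (hc : 0 < c) (hd : 0 ≤ d)
    (hA : 0 ≤ A) (hder : ∀ s ∈ Icc 0 T, HasDerivWithinAt h (v s) (Icc 0 T) s) (h0 : h 0 = 0)
    (hfin : ∀ s ∈ Icc 0 T, ∫⁻ p, ‖h s p‖ₑ * ENNReal.ofReal (wt p) ≤ ENNReal.ofReal A)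
    (hv : ∀ s ∈ Icc 0 T, ∃ Λ r : Mom → ℝ, (∀ p, 0 ≤ Λ p) ∧
      (∀ᵐ p, v s p = r p - Λ p * h s p) ∧
      ∫⁻ p, ‖r p‖ₑ * ENNReal.ofReal (wt p)
        ≤ ENNReal.ofReal c * (∫⁻ p, ‖h s p‖ₑ * ENNReal.ofReal (wt p)) + ENNReal.ofReal d)
    {s : ℝ} (hs : s ∈ Icc 0 T) :
    ∫⁻ p, ‖h s p‖ₑ * ENNReal.ofReal (wt p) ≤ ENNReal.ofReal (2 * d * T * Real.exp (2 * c * T)) := by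
  set U : ℝ → ℝ := fun s => (∫⁻ p, ‖h s p‖ₑ * ENNReal.ofReal (wt p)).toReal with hU
  have hne : ∀ s ∈ Icc 0 T, ∫⁻ p, ‖h s p‖ₑ * ENNReal.ofReal (wt p) ≠ ∞ := fun s hs =>
    ((hfin s hs).trans_lt ENNReal.ofReal_lt_top).ne
  have hU0 : ∀ s, 0 ≤ U s := fun s => ENNReal.toReal_nonneg
  have hUA : ∀ s ∈ Icc 0 T, U s ≤ A := fun s hs => ENNReal.toReal_le_of_le_ofReal hA (hfin s hs)
  -- The weighted norm is not known to be continuous in time, so the usual Gronwall lemma does not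
  -- apply. The supremum of `exp(-2cs) U(s)` is used instead; it is finite by the a priori bound
  -- `A`.
  set V : Set ℝ := (fun s => Real.exp (-(2 * c * s)) * U s) '' Icc 0 T with hV
  have hbdd : BddAbove V := by
    refine ⟨A, ?_⟩
    rintro _ ⟨s, hs, rfl⟩
    have : Real.exp (-(2 * c * s)) ≤ 1 := Real.exp_le_one_iff.2 (by have := hs.1; simp; positivity)
    calc _ ≤ 1 * A := mul_le_mul this (hUA s hs) (hU0 s) zero_le_one
      _ = A := one_mul A
  set S := sSup V with hS
  have hUS : ∀ s ∈ Icc 0 T, U s ≤ S * Real.exp (2 * c * s) := fun s hs => by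
    have := le_csSup hbdd ⟨s, hs, rfl⟩
    dsimp only at this
    rw [Real.exp_neg, inv_mul_le_iff₀ (Real.exp_pos _)] at this
    linarith
  have hT : 0 ≤ T := hs.1.trans hs.2
  have h00 : (0 : ℝ) ∈ Icc 0 T := ⟨le_rfl, hT⟩
  have hS0 : 0 ≤ S := by
    have := hUS 0 h00
    have h1 := hU0 0
    simp at this
    linarith
  have hexp : ∀ s, HasDerivAt (fun s => Real.exp (2 * c * s)) (Real.exp (2 * c * s) * (2 * c * 1)) s :=
    fun s => ((hasDerivAt_id s).const_mul (2 * c)).exp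
  have hmain : ∀ s ∈ Icc 0 T, U s ≤ S / 2 * (Real.exp (2 * c * s) - 1) + d * s := fun s hs => by
    have h1 := lintegral_enorm_wt_le_of_dissipative hder h0
      (P := fun s => S / 2 * (Real.exp (2 * c * s) - 1) + d * s)
      (P' := fun s => S / 2 * (Real.exp (2 * c * s) * (2 * c * 1)) + d * 1)
      (fun s => (((hexp s).sub_const 1).const_mul _).add ((hasDerivAt_id s).const_mul d))
      (fun s => by positivity) (by simp)
      (fun s hs => by
        obtain ⟨Λ, r, h1, h2, h3⟩ := hv s hs
        refine ⟨Λ, r, h1, h2, h3.trans ?_⟩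
        rw [← ENNReal.ofReal_toReal (hne s hs), ← ENNReal.ofReal_mul hc.le,
          ← ENNReal.ofReal_add (mul_nonneg hc.le ENNReal.toReal_nonneg) hd]
        refine ENNReal.ofReal_le_ofReal ?_
        have := mul_le_mul_of_nonneg_left (hUS s hs) hc.le
        simp only [hU] at this
        linarith) hs
    refine ENNReal.toReal_le_of_le_ofReal ?_ h1
    have : 1 ≤ Real.exp (2 * c * s) := Real.one_le_exp (by have := hs.1; positivity)
    have h2 := hs.1
    have h3 : 0 ≤ Real.exp (2 * c * s) - 1 := by linarith
    positivity
  -- The rate `2c`, twice the natural one, produces the factor `1/2` that lets `S` be absorbed.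
  have hSle : S ≤ S / 2 + d * T := by
    refine csSup_le ⟨_, 0, h00, rfl⟩ ?_
    rintro _ ⟨s, hs, rfl⟩
    dsimp only
    rw [Real.exp_neg, inv_mul_le_iff₀ (Real.exp_pos _)]
    have h1 : 1 ≤ Real.exp (2 * c * s) := Real.one_le_exp (by have := hs.1; positivity)
    have h2 : d * s ≤ d * T := mul_le_mul_of_nonneg_left hs.2 hd
    have h3 : 0 ≤ d * T := mul_nonneg hd hT
    nlinarith [hmain s hs]
  rw [← ENNReal.ofReal_toReal (hne s hs)]
  refine ENNReal.ofReal_le_ofReal ((hUS s hs).trans ?_)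
  have h1 : Real.exp (2 * c * s) ≤ Real.exp (2 * c * T) := by
    refine Real.exp_le_exp.2 ?_
    have := hs.2
    gcongr
  have h2 : S ≤ 2 * d * T := by linarith
  gcongr

end

end MasslessBoltzmann

/-! ### Stability and uniqueness -/

namespace MasslessBoltzmann

noncomputable section

variable {b : ℝ}

lemma weightedDist_eq (f g : L1) :
    weightedDist f g = ∫⁻ p, ‖f p - g p‖ₑ * ENNReal.ofReal (wt p) := by
  refine lintegral_congr fun p => ?_
  rw [ENNReal.ofReal_mul (abs_nonneg _), Real.enorm_eq_ofReal_abs, wt]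

lemma weightedDist_eq_sub (f g : L1) :
    weightedDist f g = ∫⁻ p, ‖(f - g : L1) p‖ₑ * ENNReal.ofReal (wt p) := by
  rw [weightedDist_eq]
  refine lintegral_congr_ae ?_
  filter_upwards [Lp.coeFn_sub f g] with p hp
  rw [hp, Pi.sub_apply]

lemma weightedDist_le_of_moment {f g : L1} {A : ℝ} (hA : 0 ≤ A)
    (hf : ∫⁻ p, ‖f p‖ₑ * ENNReal.ofReal (wtSq p) ≤ ENNReal.ofReal A)
    (hg : ∫⁻ p, ‖g p‖ₑ * ENNReal.ofReal (wtSq p) ≤ ENNReal.ofReal A) :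
    weightedDist f g ≤ ENNReal.ofReal (4 * A) := by
  have hfm := measurable_L1 f
  rw [weightedDist_eq]
  calc _ ≤ ∫⁻ p, (‖f p‖ₑ * ENNReal.ofReal (wt p) + ‖g p‖ₑ * ENNReal.ofReal (wt p)) := by
        refine lintegral_mono fun p => ?_
        rw [← add_mul]
        exact mul_le_mul_left enorm_sub_le _
    _ ≤ ENNReal.ofReal (2 * A) + ENNReal.ofReal (2 * A) := by
        rw [lintegral_add_left (by fun_prop)]
        exact add_le_add (lintegral_wt_le hf) (lintegral_wt_le hg)
    _ = _ := by
        rw [← ENNReal.ofReal_add (by positivity) (by positivity)]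
        congr 1; ring

/-- Stability of solutions with respect to the cut-off. -/
theorem exists_weightedDist_le {b' : ℝ} (hb₁ : 1 < b) (hb₂ : b < 2) (hb'₁ : 1 < b') (hb'₂ : b' < 2)
    {C₁ : ℝ} (hC₁ : 0 < C₁) :
    ∃ C : ℝ, 0 < C ∧ ∀ {ε ε' R A T : ℝ} {f₀ : L1} {f g : ℝ → L1}, 0 ≤ R → 0 < A →
      (∀ p q, |kernel b ε p q - kernel b ε' p q| ≤ R * kernel b' 0 p q) →
      IsSolution C₁ b ε (Icc 0 T) f₀ f → IsSolution C₁ b ε' (Icc 0 T) f₀ g →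
      (∀ s ∈ Icc 0 T, ∫⁻ p, ‖f s p‖ₑ * ENNReal.ofReal (wtSq p) ≤ ENNReal.ofReal A) →
      (∀ s ∈ Icc 0 T, ∫⁻ p, ‖g s p‖ₑ * ENNReal.ofReal (wtSq p) ≤ ENNReal.ofReal A) →
      ∀ s ∈ Icc 0 T, weightedDist (f s) (g s)
        ≤ ENNReal.ofReal (2 * (C * R * A ^ 2) * T * Real.exp (2 * (C * A) * T)) := by
  obtain ⟨C, hC, h⟩ := exists_collisionOp_sub_le hb₁ hb₂ hb'₁ hb'₂ hC₁
  refine ⟨C, hC, fun {ε ε' R A T f₀ f g} hR hA hker Sf Sg hf hg s hs => ?_⟩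
  rw [weightedDist_eq_sub]
  refine lintegral_enorm_wt_le_exp (h := fun s => f s - g s)
    (v := fun s => derivWithin f (Icc 0 T) s - derivWithin g (Icc 0 T) s) (A := 4 * A)
    (by positivity) (by positivity) (by positivity)
    (fun s hs => (Sf.hasDerivWithinAt hs).sub (Sg.hasDerivWithinAt hs))
    (by rw [Sf.initial, Sg.initial, sub_self])
    (fun s hs => by
      rw [← weightedDist_eq_sub]
      exact weightedDist_le_of_moment hA.le (hf s hs) (hg s hs))
    (fun s hs => ?_) hs
  obtain ⟨Λ, r, -, h1, h2, h3, -⟩ := h (Sf.nonneg s hs) hR hA.le hker (hf s hs) (hg s hs)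
  refine ⟨Λ, r, h1, ?_, ?_⟩
  · filter_upwards [h2, Lp.coeFn_sub (f s) (g s), Sf.equation s hs, Sg.equation s hs,
      Lp.coeFn_sub (derivWithin f (Icc 0 T) s) (derivWithin g (Icc 0 T) s)] with p e1 e2 e3 e4 e5
    rw [e5, Pi.sub_apply, e3, e4, e1, e2, Pi.sub_apply]
  · rw [← weightedDist_eq_sub, weightedDist_eq]
    exact h3

lemma eq_of_weightedDist_eq_zero {f g : L1} (h : weightedDist f g = 0) : f = g := by
  rw [weightedDist_eq_sub] at h
  have h1 : ∫⁻ p, ‖(f - g : L1) p‖ₑ = 0 := by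
    refine le_antisymm (le_trans (lintegral_mono fun p => ?_) h.le) (zero_le)
    refine le_mul_of_one_le_right (zero_le) ?_
    rw [← ENNReal.ofReal_one]
    exact ENNReal.ofReal_le_ofReal (one_le_wt p)
  rw [enorm_L1, ENNReal.ofReal_eq_zero] at h1
  exact sub_eq_zero.1 (norm_le_zero_iff.1 h1)

/-- Uniqueness of solutions with bounded moment of order `-2`. -/
lemma IsSolution.eqOn_of_moment (hb₁ : 1 < b) (hb₂ : b < 2) {C₁ : ℝ} (hC₁ : 0 < C₁)
    {ε A T : ℝ} {f₀ : L1} {f g : ℝ → L1} (hA : 0 < A)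
    (Sf : IsSolution C₁ b ε (Icc 0 T) f₀ f) (Sg : IsSolution C₁ b ε (Icc 0 T) f₀ g)
    (hf : ∀ s ∈ Icc 0 T, ∫⁻ p, ‖f s p‖ₑ * ENNReal.ofReal (wtSq p) ≤ ENNReal.ofReal A)
    (hg : ∀ s ∈ Icc 0 T, ∫⁻ p, ‖g s p‖ₑ * ENNReal.ofReal (wtSq p) ≤ ENNReal.ofReal A) :
    EqOn f g (Icc 0 T) := fun s hs => by
  obtain ⟨C, hC, h⟩ := exists_weightedDist_le hb₁ hb₂ hb₁ hb₂ hC₁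
  -- Equal kernels allow `R = 0`, and the stability bound becomes zero.
  have := h (ε := ε) (ε' := ε) le_rfl hA (fun p q => by simp) Sf Sg hf hg s hs
  refine eq_of_weightedDist_eq_zero (le_antisymm (this.trans_eq ?_) zero_le)
  simp

lemma IsSolution.restrict {C₁ ε T : ℝ} {f₀ : L1} {f : ℝ → L1} (hT : 0 < T)
    (S : IsSolution C₁ b ε (Ici 0) f₀ f) : IsSolution C₁ b ε (Icc 0 T) f₀ f where
  contDiffOn := S.contDiffOn.mono Icc_subset_Ici_self
  initial := S.initial
  nonneg s hs := S.nonneg s hs.1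
  isotropic s hs := S.isotropic s hs.1
  integrable_gain s hs := S.integrable_gain s hs.1
  integrable_loss s hs := S.integrable_loss s hs.1
  equation s hs := by
    rw [derivWithin_subset Icc_subset_Ici_self (uniqueDiffOn_Icc hT s hs)
      (S.contDiffOn.differentiableOn one_ne_zero s hs.1)]
    exact S.equation s hs.1

end

end MasslessBoltzmann

/-! ### Wild sums and global solutions of quadratic equations -/

namespace MasslessBoltzmann

noncomputable section

section WildSum

variable {E : Type*} [NormedAddCommGroup E] [NormedSpace ℝ E]

/-- The Cauchy product of two series for a continuous bilinear map. -/
lemma bilinear_tsum_eq_tsum_sum_antidiagonal [CompleteSpace E] (Γ : E →L[ℝ] E →L[ℝ] E) {x y : ℕ → E}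
    (hx : Summable fun n => ‖x n‖) (hy : Summable fun n => ‖y n‖) :
    Γ (∑' n, x n) (∑' n, y n)
      = ∑' n, ∑ kl ∈ Finset.HasAntidiagonal.antidiagonal n, Γ (x kl.1) (y kl.2) := by
  have hs : Summable fun kl : ℕ × ℕ => Γ (x kl.1) (y kl.2) := by
    refine Summable.of_norm_bounded ((hx.mul_of_nonneg hy (fun _ => norm_nonneg _)
      (fun _ => norm_nonneg _)).mul_left ‖Γ‖) fun kl => ?_
    rw [← mul_assoc]
    exact Γ.le_opNorm₂ _ _
  have h1 : Γ (∑' n, x n) (∑' n, y n) = ∑' kl : ℕ × ℕ, Γ (x kl.1) (y kl.2) := by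
    rw [hs.tsum_prod, Γ.map_tsum hx.of_norm]
    have h2 : Summable fun n => Γ (x n) := hx.of_norm.mapL Γ
    have h3 := (ContinuousLinearMap.apply ℝ E (∑' n, y n)).map_tsum h2
    simp only [ContinuousLinearMap.apply_apply] at h3
    rw [h3]
    refine tsum_congr fun n => ?_
    exact (Γ (x n)).map_tsum hy.of_norm
  rw [h1, ← Finset.HasAntidiagonal.sigmaAntidiagonalEquivProd.tsum_eq (fun kl : ℕ × ℕ => Γ (x kl.1) (y kl.2))]
  have hs' := (Finset.HasAntidiagonal.sigmaAntidiagonalEquivProd (A := ℕ)).summable_iff.2 hs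
  refine (hs'.tsum_sigma' fun n => (hasSum_fintype _).summable).trans ?_
  refine tsum_congr fun n => ?_
  rw [tsum_fintype, ← Finset.sum_coe_sort (Finset.HasAntidiagonal.antidiagonal n)]
  rfl

/-- The coefficients of the Wild sum of the equation `∂ₛ f = a⁻¹ Γ(f,f) - a f`. -/
def wildCoeff (Γ : E →L[ℝ] E →L[ℝ] E) (a : ℝ) (f₀ : E) : ℕ → E
  | 0 => f₀
  | n + 1 => ((n + 1 : ℝ) * a)⁻¹ • ∑ k : Fin (n + 1),
      Γ (wildCoeff Γ a f₀ k) (wildCoeff Γ a f₀ (n - k))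

lemma wildCoeff_succ (Γ : E →L[ℝ] E →L[ℝ] E) (a : ℝ) (f₀ : E) (n : ℕ) :
    wildCoeff Γ a f₀ (n + 1) = ((n + 1 : ℝ) * a)⁻¹ • ∑ kl ∈ Finset.HasAntidiagonal.antidiagonal n,
      Γ (wildCoeff Γ a f₀ kl.1) (wildCoeff Γ a f₀ kl.2) := by
  rw [wildCoeff, Finset.Nat.sum_antidiagonal_eq_sum_range_succ
    (fun k l => Γ (wildCoeff Γ a f₀ k) (wildCoeff Γ a f₀ l)), Finset.sum_range]

/-- The generating function of the Wild coefficients. -/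
def wildSeries (Γ : E →L[ℝ] E →L[ℝ] E) (a : ℝ) (f₀ : E) (t : ℝ) : E :=
  ∑' n, t ^ n • wildCoeff Γ a f₀ n

variable {Γ : E →L[ℝ] E →L[ℝ] E} {a m : ℝ} {f₀ : E}

lemma summable_wildSeries (hm : ∀ n, ‖wildCoeff Γ a f₀ n‖ ≤ m) {t : ℝ} (ht : |t| < 1) :
    Summable fun n => ‖t ^ n • wildCoeff Γ a f₀ n‖ := by
  refine Summable.of_nonneg_of_le (fun n => norm_nonneg _) (fun n => ?_)
    ((summable_geometric_of_lt_one (abs_nonneg t) ht).mul_right m)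
  rw [norm_smul, norm_pow, Real.norm_eq_abs]
  exact mul_le_mul_of_nonneg_left (hm n) (by positivity)

/-- Comparison of coefficients: the recursion defining `wildCoeff` is that of the power series
solution of `g' = a⁻¹ Γ(g, g)`. The coefficients are bounded, so the radius of convergence is at
least one. -/
lemma hasDerivAt_wildSeries [CompleteSpace E] (ha : a ≠ 0) (hm : ∀ n, ‖wildCoeff Γ a f₀ n‖ ≤ m) {t : ℝ}
    (ht : |t| < 1) :
    HasDerivAt (wildSeries Γ a f₀) (a⁻¹ • Γ (wildSeries Γ a f₀ t) (wildSeries Γ a f₀ t)) t := by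
  -- On `(-ρ, ρ)` with `|t| < ρ < 1` the differentiated series has a summable majorant.
  obtain ⟨ρ, hρ, hρ1⟩ := exists_between ht
  have hρ0 : 0 < ρ := (abs_nonneg t).trans_lt hρ
  have hsum : Summable fun n : ℕ => (n : ℝ) * ρ ^ (n - 1) * m := by
    refine Summable.mul_right m ((summable_nat_add_iff 1).1 ?_)
    have h1 := summable_pow_mul_geometric_of_norm_lt_one (R := ℝ) 1
      (by rwa [Real.norm_eq_abs, abs_of_pos hρ0] : ‖ρ‖ < 1)
    have h2 := h1.add (summable_geometric_of_lt_one hρ0.le hρ1)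
    refine h2.congr fun n => ?_
    simp only [pow_one, Nat.add_sub_cancel]
    push_cast
    ring
  have h := hasDerivAt_tsum_of_isPreconnected (t := Ioo (-ρ) ρ)
    (g := fun n t => t ^ n • wildCoeff Γ a f₀ n)
    (g' := fun n t => ((n : ℝ) * t ^ (n - 1)) • wildCoeff Γ a f₀ n) (y₀ := 0) (y := t) hsum isOpen_Ioo
    isPreconnected_Ioo (fun n y _ => (hasDerivAt_pow n y).smul_const _)
    (fun n y hy => by
      have hy' : |y| ≤ ρ := abs_le.2 ⟨hy.1.le, hy.2.le⟩
      rw [norm_smul, norm_mul, norm_pow, Real.norm_natCast, Real.norm_eq_abs]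
      have := hm n
      gcongr)
    ⟨by linarith, hρ0⟩ (summable_wildSeries hm (by simp)).of_norm (abs_lt.1 hρ)
  refine h.congr_deriv ?_
  have hsum' : Summable fun n : ℕ => ((n : ℝ) * t ^ (n - 1)) • wildCoeff Γ a f₀ n := by
    refine Summable.of_norm_bounded hsum fun n => ?_
    rw [norm_smul, norm_mul, norm_pow, Real.norm_natCast, Real.norm_eq_abs]
    have := hm n
    gcongr
  rw [wildSeries, bilinear_tsum_eq_tsum_sum_antidiagonal Γ (summable_wildSeries hm ht)
    (summable_wildSeries hm ht), hsum'.tsum_eq_zero_add, ← tsum_const_smul'']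
  simp only [Nat.cast_zero, zero_mul, zero_smul, zero_add]
  refine tsum_congr fun n => ?_
  rw [wildCoeff_succ, smul_smul, Finset.smul_sum, Finset.smul_sum]
  refine Finset.sum_congr rfl fun kl hkl => ?_
  rw [map_smul, map_smul, smul_apply, smul_smul, smul_smul,
    ← Finset.HasAntidiagonal.mem_antidiagonal.1 hkl]
  congr 1
  have : ((kl.1 + kl.2 : ℕ) : ℝ) + 1 ≠ 0 := by positivity
  push_cast at this ⊢
  rw [pow_add]
  field_simp

/-- Global solutions of a quadratic equation in a cone on which the norm is linear, if the
quadratic map becomes positive after adding a multiple of the identity. -/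
theorem exists_global_solution [CompleteSpace E] (B : E →L[ℝ] E →L[ℝ] E) (I : E →L[ℝ] ℝ) {P : Set E}
    (hPc : IsClosed P) (hPadd : ∀ f ∈ P, ∀ g ∈ P, f + g ∈ P)
    (hPsmul : ∀ c : ℝ, 0 ≤ c → ∀ f ∈ P, c • f ∈ P) (hI : ∀ f ∈ P, I f = ‖f‖)
    (hIB : ∀ f ∈ P, ∀ g ∈ P, I (B f g) = 0) {κ : ℝ} (hκ : 0 < κ)
    (hB : ∀ f ∈ P, ∀ g ∈ P, B f g + (κ * I g) • f ∈ P) {f₀ : E} (hf₀ : f₀ ∈ P) :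
    ∃ f : ℝ → E, f 0 = f₀ ∧ ∀ s, 0 ≤ s → f s ∈ P ∧ HasDerivAt f (B (f s) (f s)) s := by
  rcases eq_or_ne f₀ 0 with h0 | h0
  · subst h0
    refine ⟨fun _ => 0, rfl, fun s _ => ⟨hf₀, ?_⟩⟩
    simpa using hasDerivAt_const s (0 : E)
  set m := ‖f₀‖ with hm
  have hm0 : 0 < m := norm_pos_iff.2 h0
  -- On elements with `I g = m` the map `Γ` adds `a f` to `B f g`. It maps the cone into itself, and
  -- the compensating linear term is `-a f`.
  set a := κ * m with ha
  have ha0 : 0 < a := mul_pos hκ hm0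
  set Γ : E →L[ℝ] E →L[ℝ] E := B + κ • ((ContinuousLinearMap.lsmul ℝ ℝ).comp I).flip with hΓ
  have hΓa : ∀ f g, Γ f g = B f g + (κ * I g) • f := fun f g => by
    simp [hΓ, mul_smul]
  have hsumP : ∀ (s : Finset (ℕ × ℕ)) (x : ℕ × ℕ → E), (∀ i ∈ s, x i ∈ P) → ∑ i ∈ s, x i ∈ P := by
    intro s x hx
    refine Finset.sum_induction x (· ∈ P) (fun f g hf hg => hPadd f hf g hg) ?_ hx
    simpa using hPsmul 0 le_rfl f₀ hf₀
  -- Each of the `n + 1` products has `I`-value `a m`, and division by `(n + 1)a` restores `m`. On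
  -- the cone `I` is the norm, so the coefficients stay bounded.
  have hw : ∀ n, wildCoeff Γ a f₀ n ∈ P ∧ I (wildCoeff Γ a f₀ n) = m := by
    intro n
    induction n using Nat.strong_induction_on with
    | _ n ih =>
      rcases n with _ | n
      · rw [wildCoeff]
        exact ⟨hf₀, hI f₀ hf₀⟩
      · have ih1 : ∀ kl ∈ Finset.HasAntidiagonal.antidiagonal n, (wildCoeff Γ a f₀ kl.1 ∈ P ∧
            I (wildCoeff Γ a f₀ kl.1) = m) ∧ (wildCoeff Γ a f₀ kl.2 ∈ P ∧
            I (wildCoeff Γ a f₀ kl.2) = m) := fun kl hkl => by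
          have := Finset.HasAntidiagonal.mem_antidiagonal.1 hkl
          exact ⟨ih _ (by omega), ih _ (by omega)⟩
        rw [wildCoeff_succ]
        constructor
        · refine hPsmul _ (by positivity) _ (hsumP _ _ fun kl hkl => ?_)
          rw [hΓa]
          exact hB _ (ih1 kl hkl).1.1 _ (ih1 kl hkl).2.1
        · rw [map_smul, map_sum, Finset.sum_congr rfl (g := fun _ => a * m)]
          · rw [Finset.sum_const, Finset.Nat.card_antidiagonal, nsmul_eq_mul, smul_eq_mul]
            push_cast
            field_simp
          · intro kl hkl
            obtain ⟨⟨h1, h2⟩, h3, h4⟩ := ih1 kl hkl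
            rw [hΓa, map_add, hIB _ h1 _ h3, map_smul, h2, h4, smul_eq_mul, zero_add]
  have hwm : ∀ n, ‖wildCoeff Γ a f₀ n‖ ≤ m := fun n => by
    rw [← hI _ (hw n).1, (hw n).2]
  have hgP : ∀ t, 0 ≤ t → t < 1 → wildSeries Γ a f₀ t ∈ P ∧ I (wildSeries Γ a f₀ t) = m * (1 - t)⁻¹ := by
    intro t ht0 ht1
    have hs := (summable_wildSeries hwm (by rwa [abs_of_nonneg ht0] : |t| < 1)).of_norm
    constructor
    · refine hPc.mem_of_tendsto hs.hasSum.tendsto_sum_nat (Eventually.of_forall fun n => ?_)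
      refine Finset.sum_induction _ (· ∈ P) (fun f g hf hg => hPadd f hf g hg) ?_
        fun k _ => hPsmul _ (pow_nonneg ht0 k) _ (hw k).1
      simpa using hPsmul 0 le_rfl f₀ hf₀
    · rw [wildSeries, I.map_tsum hs]
      simp only [map_smul, (hw _).2, smul_eq_mul]
      rw [tsum_mul_right, tsum_geometric_of_lt_one ht0 ht1, mul_comm]
  -- The time change `t = 1 - exp(-as)` maps `[0, ∞)` to `[0, 1)`, and the prefactor produces the
  -- term `-a f`. As the series has `I`-value `m/(1 - t)`, the solution keeps `I`-value `m`.
  refine ⟨fun s => Real.exp (-(a * s)) • wildSeries Γ a f₀ (1 - Real.exp (-(a * s))), ?_,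
    fun s hs => ?_⟩
  · simp only [mul_zero, neg_zero, Real.exp_zero, sub_self, one_smul, wildSeries]
    rw [tsum_eq_single 0 fun n hn => by simp [hn]]
    simp [wildCoeff]
  · set e := Real.exp (-(a * s)) with he
    have he0 : 0 < e := Real.exp_pos _
    have he1 : e ≤ 1 := Real.exp_le_one_iff.2 (by rw [neg_nonpos]; positivity)
    obtain ⟨h1, h2⟩ := hgP (1 - e) (by linarith) (by linarith)
    refine ⟨hPsmul _ he0.le _ h1, ?_⟩
    have hde : HasDerivAt (fun s => Real.exp (-(a * s))) (e * -(a * 1)) s :=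
      ((hasDerivAt_id s).const_mul a).neg.exp
    have hg := hasDerivAt_wildSeries (Γ := Γ) ha0.ne' hwm
      (by rw [abs_of_nonneg] <;> linarith : |1 - e| < 1)
    have h3 := hde.smul (hg.scomp s (hde.const_sub 1))
    refine h3.congr_deriv ?_
    set G := wildSeries Γ a f₀ (1 - e) with hG
    have h4 : B (e • G) (e • G) = (e * e) • Γ G G - (a * e) • G := by
      rw [hΓa, h2, map_smul, map_smul, smul_apply, smul_smul, smul_add, smul_smul,
        show e * e * (κ * (m * (1 - (1 - e))⁻¹)) = a * e by rw [sub_sub_cancel, ha]; field_simp,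
        add_sub_cancel_right]
    rw [h4, smul_smul, smul_smul, mul_one, sub_eq_add_neg, ← neg_smul]
    congr 2
    · rw [← he]; field_simp
    · ring

end WildSum

end

end MasslessBoltzmann

/-! ### The cut-off operator as a bounded bilinear map -/

namespace MasslessBoltzmann

noncomputable section

variable {b : ℝ}

/-- The polarized integrand of the collision operator. -/
def collisionIntegrand (b ε : ℝ) (f g : Mom → ℝ) (z : Mom × Mom × Dir) : ℝ :=
  kernel b ε z.1 z.2.1 * (f (outMom z.1 z.2.1 z.2.2) * g (outMom' z.1 z.2.1 z.2.2))
    - kernel b ε z.1 z.2.1 * (f z.1 * g z.2.1)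

/-- A bound of the kernel with cut-off. -/
def kernelBound (b ε : ℝ) : ℝ := 2 * (ε ^ 2 / 4) ^ (-(b / 2))

lemma kernelBound_pos {ε : ℝ} (hε : 0 < ε) : 0 < kernelBound b ε := by
  unfold kernelBound; positivity

lemma lintegral_kernel_le_of_cutoff (hb₁ : 1 < b) (hb₂ : b < 2) {ε : ℝ} (hε : 0 < ε) (f g : L1) :
    ∫⁻ z, ENNReal.ofReal (kernel b ε z.1 z.2.1) * (‖f z.1‖ₑ * ‖g z.2.1‖ₑ) ∂tripleMeasure
      ≤ ENNReal.ofReal (4 * Real.pi * kernelBound b ε * ‖f‖ * ‖g‖) := by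
  have hk := kernelBound_pos (b := b) hε
  refine (lintegral_kernel_le (k := kernelBound b ε) (s := 0) hk.le
      (fun p q => ?_) (measurable_L1 f).enorm (measurable_L1 g).enorm).trans_eq ?_
  · simpa [kernelBound] using kernel_le_of_cutoff hb₁ hb₂ hε p q
  · simp only [Real.rpow_zero, ENNReal.ofReal_one, mul_one, enorm_L1]
    rw [← ENNReal.ofReal_mul (norm_nonneg _), ← ENNReal.ofReal_mul (by positivity), ← mul_assoc]

lemma integrable_collisionIntegrand {ε : ℝ} {f g : Mom → ℝ} (hf : Measurable f) (hg : Measurable g)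
    (h : ∫⁻ z, ENNReal.ofReal (kernel b ε z.1 z.2.1) * (‖f z.1‖ₑ * ‖g z.2.1‖ₑ) ∂tripleMeasure < ∞) :
    Integrable (collisionIntegrand b ε f g) tripleMeasure :=
  (integrable_gain_triple hf hg h).sub (integrable_loss_triple hf hg h)

lemma lintegral_enorm_collisionIntegrand_le {ε : ℝ} {f g : Mom → ℝ} (hf : Measurable f)
    (hg : Measurable g) :
    ∫⁻ z, ‖collisionIntegrand b ε f g z‖ₑ ∂tripleMeasure
      ≤ 2 * ∫⁻ z, ENNReal.ofReal (kernel b ε z.1 z.2.1) * (‖f z.1‖ₑ * ‖g z.2.1‖ₑ) ∂tripleMeasure := by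
  have h1 := lintegral_gain b ε (F := fun p => ‖f p‖ₑ) (G := fun p => ‖g p‖ₑ) hf.enorm hg.enorm
  calc _ ≤ ∫⁻ z, (ENNReal.ofReal (kernel b ε z.1 z.2.1) *
        (‖f (outMom z.1 z.2.1 z.2.2)‖ₑ * ‖g (outMom' z.1 z.2.1 z.2.2)‖ₑ) +
        ENNReal.ofReal (kernel b ε z.1 z.2.1) * (‖f z.1‖ₑ * ‖g z.2.1‖ₑ)) ∂tripleMeasure := by
        refine lintegral_mono fun z => enorm_sub_le.trans_eq ?_
        rw [enorm_mul, enorm_mul, enorm_mul, enorm_mul, Real.enorm_of_nonneg (kernel_nonneg _ _ _ _)]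
    _ = _ := by
        rw [lintegral_add_right _ (by fun_prop), h1, two_mul]

lemma measurable_collisionIntegrand {ε : ℝ} {f g : Mom → ℝ} (hf : Measurable f)
    (hg : Measurable g) : Measurable (collisionIntegrand b ε f g) := by
  unfold collisionIntegrand; fun_prop

/-- The collision operator with cut-off is a bounded quadratic map on `L¹`. -/
theorem exists_collision_bilinear (hb₁ : 1 < b) (hb₂ : b < 2) {C₁ ε : ℝ} (hε : 0 < ε) :
    ∃ B : L1 →L[ℝ] L1 →L[ℝ] L1, ∀ f g : L1, ∀ᵐ p,
      B f g p = C₁ * ∫ x, collisionIntegrand b ε f g (p, x) ∂collisionMeasure := by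
  have hint : ∀ f g : L1, Integrable (collisionIntegrand b ε f g) tripleMeasure := fun f g =>
    integrable_collisionIntegrand (measurable_L1 f) (measurable_L1 g)
      ((lintegral_kernel_le_of_cutoff hb₁ hb₂ hε f g).trans_lt ENNReal.ofReal_lt_top)
  have hint' : ∀ f g : L1, ∀ᵐ p : Mom, Integrable (fun x => collisionIntegrand b ε f g (p, x))
      collisionMeasure := fun f g => (hint f g).prod_right_ae
  have hint2 : ∀ f g : L1, Integrable fun p : Mom => C₁ * ∫ x, collisionIntegrand b ε f g (p, x)
      ∂collisionMeasure := fun f g => ((hint f g).integral_prod_left).const_mul C₁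
  set A : L1 → L1 → L1 := fun f g => (hint2 f g).toL1 _ with hA
  have hAe : ∀ f g : L1, ∀ᵐ p, A f g p = C₁ * ∫ x, collisionIntegrand b ε f g (p, x)
      ∂collisionMeasure := fun f g => (hint2 f g).coeFn_toL1
  have hadd : ∀ f f' g g' : L1, ∀ h k : L1, ∀ c d : ℝ,
      (∀ᵐ z ∂tripleMeasure, collisionIntegrand b ε h k z
        = c * collisionIntegrand b ε f g z + d * collisionIntegrand b ε f' g' z) →
      A h k = c • A f g + d • A f' g' := by
    intro f f' g g' h k c d hz
    refine Lp.ext ?_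
    filter_upwards [hAe h k, hAe f g, hAe f' g', hint' f g, hint' f' g', Lp.coeFn_add (c • A f g)
      (d • A f' g'), Lp.coeFn_smul c (A f g), Lp.coeFn_smul d (A f' g'),
      Measure.ae_ae_of_ae_prod hz] with p h1 h2 h3 h4 h5 h6 h7 h8 h9
    rw [h6, Pi.add_apply, h7, h8, Pi.smul_apply, Pi.smul_apply, h1, h2, h3, integral_congr_ae h9,
      integral_add (h4.const_mul c) (h5.const_mul d), integral_const_mul, integral_const_mul,
      smul_eq_mul, smul_eq_mul]
    ring
  -- Elements of `L¹` are added and scaled only almost everywhere; at the outgoing momenta this is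
  -- justified by `ae_outMom`.
  have hadd' : ∀ f f' : L1, ∀ᵐ z ∂tripleMeasure, (f + f' : L1) (outMom z.1 z.2.1 z.2.2)
      = f (outMom z.1 z.2.1 z.2.2) + f' (outMom z.1 z.2.1 z.2.2) ∧
      (f + f' : L1) (outMom' z.1 z.2.1 z.2.2)
      = f (outMom' z.1 z.2.1 z.2.2) + f' (outMom' z.1 z.2.1 z.2.2) ∧
      (f + f' : L1) z.1 = f z.1 + f' z.1 ∧ (f + f' : L1) z.2.1 = f z.2.1 + f' z.2.1 := fun f f' =>
    ae_outMom (Lp.coeFn_add f f')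
  have hsmul' : ∀ (c : ℝ) (f : L1), ∀ᵐ z ∂tripleMeasure, (c • f : L1) (outMom z.1 z.2.1 z.2.2)
      = c * f (outMom z.1 z.2.1 z.2.2) ∧
      (c • f : L1) (outMom' z.1 z.2.1 z.2.2) = c * f (outMom' z.1 z.2.1 z.2.2) ∧
      (c • f : L1) z.1 = c * f z.1 ∧ (c • f : L1) z.2.1 = c * f z.2.1 := fun c f =>
    ae_outMom (Lp.coeFn_smul c f)
  have hnorm : ∀ f g : L1, ‖A f g‖ ≤ (|C₁| * (8 * Real.pi * kernelBound b ε)) * ‖f‖ * ‖g‖ := by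
    intro f g
    have hk := kernelBound_pos (b := b) hε
    have h1 := lintegral_kernel_le_of_cutoff hb₁ hb₂ hε f g
    have h2 := lintegral_enorm_collisionIntegrand_le (b := b) (ε := ε) (measurable_L1 f) (measurable_L1 g)
    have hm := measurable_collisionIntegrand (b := b) (ε := ε) (measurable_L1 f) (measurable_L1 g)
    rw [lintegral_prod _ (by fun_prop)] at h2
    have h3 : ENNReal.ofReal ‖A f g‖ ≤ ENNReal.ofReal |C₁| *
        ENNReal.ofReal (8 * Real.pi * kernelBound b ε * ‖f‖ * ‖g‖) := by
      rw [← enorm_L1]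
      calc ∫⁻ p, ‖A f g p‖ₑ ≤ ∫⁻ p, ENNReal.ofReal |C₁| * ∫⁻ x, ‖collisionIntegrand b ε f g (p, x)‖ₑ
            ∂collisionMeasure := by
            refine lintegral_mono_ae ?_
            filter_upwards [hAe f g] with p hp
            rw [hp, enorm_mul, Real.enorm_eq_ofReal_abs]
            exact mul_le_mul_right (enorm_integral_le_lintegral_enorm _) _
        _ = ENNReal.ofReal |C₁| * ∫⁻ p, ∫⁻ x, ‖collisionIntegrand b ε f g (p, x)‖ₑ
            ∂collisionMeasure := lintegral_const_mul' _ _ ENNReal.ofReal_ne_top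
        _ ≤ _ := by
            refine mul_le_mul_right (h2.trans ((mul_le_mul_right h1 2).trans_eq ?_)) _
            rw [show 8 * Real.pi * kernelBound b ε * ‖f‖ * ‖g‖
              = 2 * (4 * Real.pi * kernelBound b ε * ‖f‖ * ‖g‖) by ring,
              ENNReal.ofReal_mul two_pos.le, ENNReal.ofReal_ofNat]
    rw [← ENNReal.ofReal_mul (abs_nonneg _), ENNReal.ofReal_le_ofReal_iff (by positivity)] at h3
    refine h3.trans_eq ?_
    ring
  refine ⟨LinearMap.mkContinuous₂ (LinearMap.mk₂ ℝ A ?_ ?_ ?_ ?_) _ hnorm, fun f g => hAe f g⟩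
  · intro f f' g
    have := hadd f f' g g (f + f') g 1 1 (by
      filter_upwards [hadd' f f'] with z hz
      simp only [collisionIntegrand]
      rw [hz.1, hz.2.2.1]; ring)
    rw [this, one_smul, one_smul]
  · intro c f g
    have := hadd f f g g (c • f) g c 0 (by
      filter_upwards [hsmul' c f] with z hz
      simp only [collisionIntegrand]
      rw [hz.1, hz.2.2.1]; ring)
    rw [this, zero_smul, add_zero]
  · intro f g g'
    have := hadd f f g g' f (g + g') 1 1 (by
      filter_upwards [hadd' g g'] with z hz
      simp only [collisionIntegrand]
      rw [hz.2.1, hz.2.2.2]; ring)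
    rw [this, one_smul, one_smul]
  · intro c f g
    have := hadd f f g g f (c • g) c 0 (by
      filter_upwards [hsmul' c g] with z hz
      simp only [collisionIntegrand]
      rw [hz.2.1, hz.2.2.2]; ring)
    rw [this, zero_smul, add_zero]

end

end MasslessBoltzmann

/-! ### Propagation of isotropy -/

namespace MasslessBoltzmann

noncomputable section

variable {b : ℝ}

/-- A function which is invariant under isometries depends on the norm only. -/
lemma exists_eq_comp_norm {β : Type*} [MeasurableSpace β] {G : Mom → β} (hG : Measurable G)
    (h : ∀ (R : Mom ≃ₗᵢ[ℝ] Mom) p, G (R p) = G p) :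
    ∃ φ : ℝ → β, Measurable φ ∧ ∀ p, G p = φ ‖p‖ := by
  refine ⟨fun r => G (r • EuclideanSpace.single 0 1), hG.comp (by fun_prop), fun p => ?_⟩
  obtain ⟨R, hR⟩ := exists_isometry_map_eq (v := p) (w := ‖p‖ • (EuclideanSpace.single 0 1 : Mom))
    (by simp [norm_smul])
  dsimp only
  rw [← hR, h]

lemma relMom_map (R : Mom ≃ₗᵢ[ℝ] Mom) (p q : Mom) : relMom (R p) (R q) = relMom p q := by
  simp [relMom]

lemma kernel_map (b ε : ℝ) (R : Mom ≃ₗᵢ[ℝ] Mom) (p q : Mom) :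
    kernel b ε (R p) (R q) = kernel b ε p q := by
  simp [kernel, relMom_map]

/-- After the average over `ω` the integrand involves only the kernel and the lengths of `p`, `q`
and `p + q`. A simultaneous rotation of `p` and `q` leaves these unchanged. -/
lemma lintegral_gain_map (ε : ℝ) {φ ψ : ℝ → ℝ≥0∞} (hφ : Measurable φ) (hψ : Measurable ψ)
    (R : Mom ≃ₗᵢ[ℝ] Mom) (p : Mom) :
    ∫⁻ x, ENNReal.ofReal (kernel b ε (R p) x.1) * (φ ‖outMom (R p) x.1 x.2‖ * ψ ‖outMom' (R p) x.1 x.2‖)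
        ∂collisionMeasure
      = ∫⁻ x, ENNReal.ofReal (kernel b ε p x.1) * (φ ‖outMom p x.1 x.2‖ * ψ ‖outMom' p x.1 x.2‖)
        ∂collisionMeasure := by
  have h1 : ∀ p : Mom, ∫⁻ x, ENNReal.ofReal (kernel b ε p x.1) *
      (φ ‖outMom p x.1 x.2‖ * ψ ‖outMom' p x.1 x.2‖) ∂collisionMeasure
      = ∫⁻ q : Mom, ENNReal.ofReal (kernel b ε p q) * (ENNReal.ofReal (2 * Real.pi) *
        ∫⁻ t in Icc (-1 : ℝ) 1, φ ((‖p‖ + ‖q‖ + ‖p + q‖ * t) / 2) * ψ ((‖p‖ + ‖q‖ - ‖p + q‖ * t) / 2)) := by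
    intro p
    rw [collisionMeasure, lintegral_prod _ (by fun_prop)]
    refine lintegral_congr fun q => ?_
    simp only [norm_outMom_dir, norm_outMom'_dir]
    rw [lintegral_const_mul _ (by fun_prop), lintegral_sphere_inner_right (p + q)
      (F := fun t => φ ((‖p‖ + ‖q‖ + t) / 2) * ψ ((‖p‖ + ‖q‖ - t) / 2)) (by fun_prop)]
  rw [h1, h1, ← R.measurePreserving.lintegral_comp_emb R.toHomeomorph.measurableEmbedding]
  refine lintegral_congr fun q => ?_
  rw [kernel_map, R.norm_map, R.norm_map, ← map_add, R.norm_map]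

lemma lintegral_loss_map (ε : ℝ) (ψ : ℝ → ℝ≥0∞) (R : Mom ≃ₗᵢ[ℝ] Mom) (p : Mom) :
    ∫⁻ q : Mom, ENNReal.ofReal (kernel b ε (R p) q) * ψ ‖q‖
      = ∫⁻ q : Mom, ENNReal.ofReal (kernel b ε p q) * ψ ‖q‖ := by
  rw [← R.measurePreserving.lintegral_comp_emb R.toHomeomorph.measurableEmbedding]
  refine lintegral_congr fun q => ?_
  rw [kernel_map, R.norm_map]

lemma integral_collisionIntegrand_slice {ε : ℝ} {f g : L1} (hf0 : 0 ≤ f) (hg0 : 0 ≤ g)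
    (h : ∫⁻ z, ENNReal.ofReal (kernel b ε z.1 z.2.1) * (‖f z.1‖ₑ * ‖g z.2.1‖ₑ) ∂tripleMeasure < ∞) :
    ∀ᵐ p, ∫ x, collisionIntegrand b ε f g (p, x) ∂collisionMeasure
      = (∫⁻ x, ENNReal.ofReal (kernel b ε p x.1) * (‖f (outMom p x.1 x.2)‖ₑ * ‖g (outMom' p x.1 x.2)‖ₑ)
          ∂collisionMeasure).toReal
        - (∫⁻ x, ENNReal.ofReal (kernel b ε p x.1) * (‖f p‖ₑ * ‖g x.1‖ₑ) ∂collisionMeasure).toReal := by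
  have hf := measurable_L1 f
  have hg := measurable_L1 g
  filter_upwards [(integrable_gain_triple hf hg h).prod_right_ae,
    (integrable_loss_triple hf hg h).prod_right_ae,
    Measure.ae_ae_of_ae_prod (ae_outMom (coeFn_nonneg hf0)),
    Measure.ae_ae_of_ae_prod (ae_outMom (coeFn_nonneg hg0))] with p h1 h2 h3 h4
  simp only [collisionIntegrand]
  rw [integral_sub h1 h2, integral_eq_lintegral_of_nonneg_ae _ h1.aestronglyMeasurable,
    integral_eq_lintegral_of_nonneg_ae _ h2.aestronglyMeasurable]
  · congr 2
    · refine lintegral_congr_ae ?_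
      filter_upwards [h3, h4] with x e1 e2
      rw [ENNReal.ofReal_mul (kernel_nonneg _ _ _ _), ENNReal.ofReal_mul e1.1,
        Real.enorm_of_nonneg e1.1, Real.enorm_of_nonneg e2.2.1]
    · refine lintegral_congr_ae ?_
      filter_upwards [h3, h4] with x e1 e2
      rw [ENNReal.ofReal_mul (kernel_nonneg _ _ _ _), ENNReal.ofReal_mul e1.2.2.1,
        Real.enorm_of_nonneg e1.2.2.1, Real.enorm_of_nonneg e2.2.2.2]
  · filter_upwards [h3, h4] with x e1 e2
    exact mul_nonneg (kernel_nonneg _ _ _ _) (mul_nonneg e1.2.2.1 e2.2.2.2)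
  · filter_upwards [h3, h4] with x e1 e2
    exact mul_nonneg (kernel_nonneg _ _ _ _) (mul_nonneg e1.1 e2.2.1)

lemma isIsotropic_of_ae {f : L1} {G : Mom → ℝ} (hG : Measurable G)
    (h : ∀ (R : Mom ≃ₗᵢ[ℝ] Mom) p, G (R p) = G p) (hf : ∀ᵐ p, f p = G p) : IsIsotropic f := by
  obtain ⟨φ, hφ, hGφ⟩ := exists_eq_comp_norm hG h
  exact ⟨φ, hφ, by filter_upwards [hf] with p hp; rw [hp, hGφ]⟩

lemma IsIsotropic.add {f g : L1} (hf : IsIsotropic f) (hg : IsIsotropic g) : IsIsotropic (f + g) := by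
  obtain ⟨φ, hφ, hf⟩ := hf
  obtain ⟨ψ, hψ, hg⟩ := hg
  refine ⟨fun r => φ r + ψ r, by fun_prop, ?_⟩
  filter_upwards [hf, hg, Lp.coeFn_add f g] with p h1 h2 h3
  rw [h3, Pi.add_apply, h1, h2]

lemma IsIsotropic.smul {f : L1} (hf : IsIsotropic f) (c : ℝ) : IsIsotropic (c • f) := by
  obtain ⟨φ, hφ, hf⟩ := hf
  refine ⟨fun r => c * φ r, by fun_prop, ?_⟩
  filter_upwards [hf, Lp.coeFn_smul c f] with p h1 h3
  rw [h3, Pi.smul_apply, h1, smul_eq_mul]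

lemma exists_subseq_tendsto_ae {F : ℕ → L1} {f : L1} (h : Tendsto F atTop (𝓝 f)) :
    ∃ ns : ℕ → ℕ, StrictMono ns ∧ ∀ᵐ p, Tendsto (fun n => F (ns n) p) atTop (𝓝 (f p)) :=
  (tendstoInMeasure_of_tendsto_Lp h).exists_seq_tendsto_ae

lemma IsIsotropic.of_tendsto {F : ℕ → L1} {f : L1} (h : Tendsto F atTop (𝓝 f))
    (hF : ∀ n, IsIsotropic (F n)) : IsIsotropic f := by
  obtain ⟨ns, -, hns⟩ := exists_subseq_tendsto_ae h
  choose φ hφ hFφ using hF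
  -- The radial profiles need not converge for every radius; their upper limit is measurable and
  -- agrees with the limit almost everywhere.
  refine ⟨fun r => limsup (fun n => φ (ns n) r) atTop, Measurable.limsup fun n => hφ _, ?_⟩
  filter_upwards [hns, ae_all_iff.2 hFφ] with p h1 h2
  rw [← h1.limsup_eq]
  simp only [h2]

lemma isClosed_isIsotropic : IsClosed {f : L1 | IsIsotropic f} :=
  IsSeqClosed.isClosed fun _ _ hF hf => IsIsotropic.of_tendsto hf hF

/-- The collision operator preserves isotropy. -/
lemma isIsotropic_of_eq_collision {C₁ ε : ℝ} {f g h : L1} (hf0 : 0 ≤ f) (hg0 : 0 ≤ g)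
    (hf : IsIsotropic f) (hg : IsIsotropic g)
    (hfin : ∫⁻ z, ENNReal.ofReal (kernel b ε z.1 z.2.1) * (‖f z.1‖ₑ * ‖g z.2.1‖ₑ) ∂tripleMeasure < ∞)
    (hh : ∀ᵐ p, h p = C₁ * ∫ x, collisionIntegrand b ε f g (p, x) ∂collisionMeasure) :
    IsIsotropic h := by
  obtain ⟨φ, hφ, hfφ⟩ := hf.exists_enorm
  obtain ⟨ψ, hψ, hgψ⟩ := hg.exists_enorm
  -- Gain and loss are written with the radial profiles instead of the `L¹` representatives, which
  -- makes them exactly rotation invariant.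
  set G : Mom → ℝ≥0∞ := fun p => ∫⁻ x, ENNReal.ofReal (kernel b ε p x.1) *
    (φ ‖outMom p x.1 x.2‖ * ψ ‖outMom' p x.1 x.2‖) ∂collisionMeasure with hG
  set L : Mom → ℝ≥0∞ := fun p => φ ‖p‖ * (ENNReal.ofReal (4 * Real.pi) *
    ∫⁻ q : Mom, ENNReal.ofReal (kernel b ε p q) * ψ ‖q‖) with hL
  have hGm : Measurable G := Measurable.lintegral_prod_right' (f := fun z : Mom × Mom × Dir =>
    ENNReal.ofReal (kernel b ε z.1 z.2.1) * (φ ‖outMom z.1 z.2.1 z.2.2‖ * ψ ‖outMom' z.1 z.2.1 z.2.2‖))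
    (by fun_prop)
  have hLm : Measurable L := by
    have : Measurable fun p : Mom => ∫⁻ q : Mom, ENNReal.ofReal (kernel b ε p q) * ψ ‖q‖ :=
      Measurable.lintegral_prod_right' (f := fun z : Mom × Mom =>
        ENNReal.ofReal (kernel b ε z.1 z.2) * ψ ‖z.2‖) (by fun_prop)
    rw [hL]; fun_prop
  refine isIsotropic_of_ae (G := fun p => C₁ * ((G p).toReal - (L p).toReal))
    ((hGm.ennreal_toReal.sub hLm.ennreal_toReal).const_mul C₁) (fun R p => ?_) ?_
  · simp only [hG, hL, lintegral_gain_map ε hφ hψ R p, lintegral_loss_map ε ψ R p, R.norm_map]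
  · filter_upwards [hh, integral_collisionIntegrand_slice hf0 hg0 hfin, hfφ,
      Measure.ae_ae_of_ae_prod (ae_outMom hfφ), Measure.ae_ae_of_ae_prod (ae_outMom hgψ)]
      with p h1 h2 h3 h4 h5
    have h6 : ∫⁻ x, ENNReal.ofReal (kernel b ε p x.1) * (‖f (outMom p x.1 x.2)‖ₑ *
        ‖g (outMom' p x.1 x.2)‖ₑ) ∂collisionMeasure = G p := by
      refine lintegral_congr_ae ?_
      filter_upwards [h4, h5] with x e1 e2
      rw [e1.1, e2.2.1]
    have h7 : ∫⁻ x, ENNReal.ofReal (kernel b ε p x.1) * (‖f p‖ₑ * ‖g x.1‖ₑ) ∂collisionMeasure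
        = L p := by
      have e0 : ∫⁻ x, ENNReal.ofReal (kernel b ε p x.1) * (‖f p‖ₑ * ‖g x.1‖ₑ) ∂collisionMeasure
          = ∫⁻ x, ENNReal.ofReal (kernel b ε p x.1) * (φ ‖p‖ * ψ ‖x.1‖) ∂collisionMeasure := by
        refine lintegral_congr_ae ?_
        filter_upwards [h5] with x e2
        rw [h3, e2.2.2.2]
      rw [e0, collisionMeasure, lintegral_prod _ (by fun_prop)]
      simp only [lintegral_const, toSphere_univ, hL]
      rw [lintegral_mul_const _ (by fun_prop), mul_comm (ENNReal.ofReal (4 * Real.pi)), ← mul_assoc,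
        ← lintegral_const_mul _ (by fun_prop)]
      congr 1
      refine lintegral_congr fun q => ?_
      ring
    rw [h1, h2, h6, h7]

end

end MasslessBoltzmann

/-! ### Global solutions with cut-off -/

namespace MasslessBoltzmann

noncomputable section

variable {b : ℝ}

/-- Conservation of mass in polarized form, the hypothesis on `I` and `B` in the Wild sum
construction. -/
lemma integral_collisionIntegrand_eq_zero {ε : ℝ} {f g : L1} (hf0 : 0 ≤ f) (hg0 : 0 ≤ g)
    (h : ∫⁻ z, ENNReal.ofReal (kernel b ε z.1 z.2.1) * (‖f z.1‖ₑ * ‖g z.2.1‖ₑ) ∂tripleMeasure < ∞) :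
    ∫ p, ∫ x, collisionIntegrand b ε f g (p, x) ∂collisionMeasure = 0 := by
  have hf := measurable_L1 f
  have hg := measurable_L1 g
  have hG := integrable_gain_triple hf hg h
  have hL := integrable_loss_triple hf hg h
  have hfo := ae_outMom (coeFn_nonneg hf0)
  have hgo := ae_outMom (coeFn_nonneg hg0)
  rw [← integral_prod (μ := (volume : Measure Mom)) (ν := collisionMeasure) (collisionIntegrand b ε f g)
    (integrable_collisionIntegrand hf hg h)]
  simp only [collisionIntegrand]
  rw [integral_sub hG hL, integral_eq_lintegral_of_nonneg_ae _ hG.aestronglyMeasurable,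
    integral_eq_lintegral_of_nonneg_ae _ hL.aestronglyMeasurable, sub_eq_zero]
  · congr 1
    have h1 := lintegral_gain b ε (F := fun p => ‖f p‖ₑ) (G := fun p => ‖g p‖ₑ) hf.enorm hg.enorm
    refine Eq.trans (lintegral_congr_ae ?_) (h1.trans (lintegral_congr_ae ?_))
    · filter_upwards [hfo, hgo] with x e1 e2
      rw [ENNReal.ofReal_mul (kernel_nonneg _ _ _ _), ENNReal.ofReal_mul e1.1,
        Real.enorm_of_nonneg e1.1, Real.enorm_of_nonneg e2.2.1]
    · filter_upwards [hfo, hgo] with x e1 e2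
      rw [ENNReal.ofReal_mul (kernel_nonneg _ _ _ _), ENNReal.ofReal_mul e1.2.2.1,
        Real.enorm_of_nonneg e1.2.2.1, Real.enorm_of_nonneg e2.2.2.2]
  · filter_upwards [hfo, hgo] with x e1 e2
    exact mul_nonneg (kernel_nonneg _ _ _ _) (mul_nonneg e1.2.2.1 e2.2.2.2)
  · filter_upwards [hfo, hgo] with x e1 e2
    exact mul_nonneg (kernel_nonneg _ _ _ _) (mul_nonneg e1.1 e2.2.1)

/-- With cut-off the loss rate is at most `4π * kernelBound b ε` times the mass of `g`. Adding this
multiple of `f` leaves a nonnegative quantity. -/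
lemma collision_add_nonneg (hb₁ : 1 < b) (hb₂ : b < 2) {ε : ℝ} (hε : 0 < ε) {f g : L1} (hf0 : 0 ≤ f)
    (hg0 : 0 ≤ g) :
    ∀ᵐ p, 0 ≤ ∫ x, collisionIntegrand b ε f g (p, x) ∂collisionMeasure
      + 4 * Real.pi * kernelBound b ε * (∫ q, g q) * f p := by
  have hf := measurable_L1 f
  have hg := measurable_L1 g
  have h := (lintegral_kernel_le_of_cutoff hb₁ hb₂ hε f g).trans_lt ENNReal.ofReal_lt_top
  filter_upwards [(integrable_gain_triple hf hg h).prod_right_ae,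
    (integrable_loss_triple hf hg h).prod_right_ae, coeFn_nonneg hf0,
    Measure.ae_ae_of_ae_prod (ae_outMom (coeFn_nonneg hf0)),
    Measure.ae_ae_of_ae_prod (ae_outMom (coeFn_nonneg hg0))] with p h1 h2 hp h3 h4
  simp only [collisionIntegrand]
  rw [integral_sub h1 h2]
  have h5 : 0 ≤ ∫ x, kernel b ε p x.1 * (f (outMom p x.1 x.2) * g (outMom' p x.1 x.2))
      ∂collisionMeasure := by
    refine integral_nonneg_of_ae ?_
    filter_upwards [h3, h4] with x e1 e2
    exact mul_nonneg (kernel_nonneg _ _ _ _) (mul_nonneg e1.1 e2.2.1)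
  have hgi : Integrable (fun x : Mom × Dir => g x.1) collisionMeasure :=
    (L1.integrable_coeFn g).comp_fst _
  have h6 : ∫ x, kernel b ε p x.1 * (f p * g x.1) ∂collisionMeasure
      ≤ ∫ x, kernelBound b ε * f p * g x.1 ∂collisionMeasure := by
    refine integral_mono_ae h2 (hgi.const_mul _) ?_
    filter_upwards [h4] with x e
    rw [mul_assoc]
    exact mul_le_mul_of_nonneg_right (kernel_le_of_cutoff hb₁ hb₂ hε p x.1) (mul_nonneg hp e.2.2.2)
  have h7 : ∫ x, g x.1 ∂collisionMeasure = 4 * Real.pi * ∫ q, g q := by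
    rw [collisionMeasure, integral_fun_fst, smul_eq_mul, Measure.real, toSphere_univ,
      ENNReal.toReal_ofReal (by positivity)]
  rw [integral_const_mul, h7] at h6
  linarith

/-- Global existence for the equation with cut-off. -/
theorem exists_isSolution_cutoff (hb₁ : 1 < b) (hb₂ : b < 2) {C₁ ε : ℝ} (hC₁ : 0 < C₁) (hε : 0 < ε)
    {f₀ : L1} (hf₀ : 0 ≤ f₀) (hiso : IsIsotropic f₀) :
    ∃ F : ℝ → L1, IsSolution C₁ b ε (Ici 0) f₀ F := by
  have hk := kernelBound_pos (b := b) hε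
  have hfin : ∀ f g : L1, ∫⁻ z, ENNReal.ofReal (kernel b ε z.1 z.2.1) * (‖f z.1‖ₑ * ‖g z.2.1‖ₑ)
      ∂tripleMeasure < ∞ := fun f g =>
    (lintegral_kernel_le_of_cutoff hb₁ hb₂ hε f g).trans_lt ENNReal.ofReal_lt_top
  obtain ⟨B, hB⟩ := exists_collision_bilinear (C₁ := C₁) hb₁ hb₂ hε
  obtain ⟨I, hI⟩ := exists_integral_functional (W := fun _ => 1) measurable_const (M := 1)
    (fun _ => by simp)
  simp only [mul_one] at hI
  -- Isotropy is built into the cone, so that the solution inherits it together with nonnegativity.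
  obtain ⟨F, hF0, hF⟩ := exists_global_solution B I (P := Ici (0 : L1) ∩ {f | IsIsotropic f})
    (κ := C₁ * (4 * Real.pi * kernelBound b ε)) (f₀ := f₀)
    (isClosed_Ici.inter isClosed_isIsotropic)
    (fun f hf g hg => ⟨add_nonneg (mem_Ici.1 hf.1) (mem_Ici.1 hg.1), hf.2.add hg.2⟩)
    (fun c hc f hf => by
      refine ⟨mem_Ici.2 ((Lp.coeFn_nonneg _).1 ?_), hf.2.smul c⟩
      filter_upwards [Lp.coeFn_smul c f, coeFn_nonneg hf.1] with p h1 h2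
      rw [h1]
      exact mul_nonneg hc h2)
    (fun f hf => by
      rw [hI, L1.norm_eq_integral_norm]
      refine integral_congr_ae ?_
      filter_upwards [coeFn_nonneg hf.1] with p hp
      rw [Real.norm_of_nonneg hp])
    (fun f hf g hg => by
      rw [hI, integral_congr_ae (hB f g), integral_const_mul,
        integral_collisionIntegrand_eq_zero hf.1 hg.1 (hfin f g), mul_zero])
    (by positivity)
    (fun f hf g hg => by
      refine ⟨mem_Ici.2 ((Lp.coeFn_nonneg _).1 ?_),
        (isIsotropic_of_eq_collision hf.1 hg.1 hf.2 hg.2 (hfin f g) (hB f g)).add (hf.2.smul _)⟩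
      filter_upwards [Lp.coeFn_add (B f g) ((C₁ * (4 * Real.pi * kernelBound b ε) * I g) • f),
        Lp.coeFn_smul (C₁ * (4 * Real.pi * kernelBound b ε) * I g) f, hB f g,
        collision_add_nonneg hb₁ hb₂ hε hf.1 hg.1] with p h1 h2 h3 h4
      rw [h1, Pi.add_apply, h2, h3, Pi.smul_apply, smul_eq_mul, hI]
      have := mul_nonneg hC₁.le h4
      simp only [Pi.zero_apply]
      linarith)
    ⟨hf₀, hiso⟩
  have hd : ∀ s ∈ Ici (0 : ℝ), derivWithin F (Ici 0) s = B (F s) (F s) := fun s hs =>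
    (hF s hs).2.hasDerivWithinAt.derivWithin (uniqueDiffOn_Ici 0 s hs)
  have hcont : ContinuousOn F (Ici 0) := fun s hs => (hF s hs).2.continuousAt.continuousWithinAt
  refine ⟨F, ?_, hF0, fun s hs => (hF s hs).1.1, fun s hs => (hF s hs).1.2, fun s _ => ?_,
    fun s _ => ?_, fun s hs => ?_⟩
  · rw [contDiffOn_one_iff_derivWithin (uniqueDiffOn_Ici 0)]
    refine ⟨fun s hs => (hF s hs).2.differentiableAt.differentiableWithinAt, ?_⟩
    refine ContinuousOn.congr (f := fun s => B (F s) (F s)) ?_ hd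
    exact (B.continuous.comp_continuousOn hcont).clm_apply hcont
  · exact (integrable_gain_triple (measurable_L1 (F s)) (measurable_L1 (F s)) (hfin _ _)).prod_right_ae
  · exact (integrable_loss_triple (measurable_L1 (F s)) (measurable_L1 (F s)) (hfin _ _)).prod_right_ae
  · rw [hd s hs]
    exact hB (F s) (F s)

end

end MasslessBoltzmann

/-! ### Tools for passing to the limit -/

namespace MasslessBoltzmann

noncomputable section

variable {b : ℝ}

/-- Differentiation of a limit of functions with uniformly convergent derivatives. -/
lemma hasDerivWithinAt_of_norm_deriv_sub_le {E : Type*} [NormedAddCommGroup E] [NormedSpace ℝ E]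
    {F v : ℕ → ℝ → E} {f q : ℝ → E} {T : ℝ} {δ : ℕ → ℝ}
    (hder : ∀ k, ∀ s ∈ Icc 0 T, HasDerivWithinAt (F k) (v k s) (Icc 0 T) s)
    (hcv : ∀ k, ContinuousOn (v k) (Icc 0 T))
    (hlim : ∀ s ∈ Icc 0 T, Tendsto (fun k => F k s) atTop (𝓝 (f s)))
    (hδ : Tendsto δ atTop (𝓝 0)) (hv : ∀ k, ∀ s ∈ Icc 0 T, ‖v k s - q s‖ ≤ δ k) :
    ContinuousOn q (Icc 0 T) ∧ ∀ s ∈ Icc 0 T, HasDerivWithinAt f (q s) (Icc 0 T) s := by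
  have hq : ContinuousOn q (Icc 0 T) := by
    refine TendstoUniformlyOn.continuousOn (F := v) (p := atTop) ?_ (Frequently.of_forall hcv)
    refine Metric.tendstoUniformlyOn_iff.2 fun e he => ?_
    filter_upwards [hδ.eventually (gt_mem_nhds he)] with k hk s hs
    rw [dist_comm, dist_eq_norm]
    exact (hv k s hs).trans_lt hk
  refine ⟨hq, fun s hs => ?_⟩
  rw [hasDerivWithinAt_iff_isLittleO, Asymptotics.isLittleO_iff]
  intro c hc
  obtain ⟨r, hr, hrq⟩ := Metric.continuousWithinAt_iff.1 (hq s hs) c hc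
  filter_upwards [self_mem_nhdsWithin, mem_nhdsWithin_of_mem_nhds (Metric.ball_mem_nhds s hr)]
    with y hy hyr
  -- The mean value inequality for `F k` minus a linear function, on a ball where `q` varies by less
  -- than `c`. In the limit `k → ∞` the term `δ k` disappears.
  have hk : ∀ k, ‖F k y - F k s - (y - s) • q s‖ ≤ (δ k + c) * ‖y - s‖ := fun k => by
    have h := Convex.norm_image_sub_le_of_norm_hasDerivWithin_le
      (f := fun y => F k y - y • q s) (f' := fun y => v k y - (1 : ℝ) • q s)
      (s := Icc 0 T ∩ Metric.ball s r) (C := δ k + c) (x := s) (y := y)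
      (fun x hx => ((hder k x hx.1).mono inter_subset_left).sub
        ((hasDerivAt_id x).smul_const (q s)).hasDerivWithinAt)
      (fun x hx => by
        rw [one_smul, show v k x - q s = (v k x - q x) + (q x - q s) by abel]
        refine (norm_add_le _ _).trans (add_le_add (hv k x hx.1) ?_)
        rw [← dist_eq_norm]
        exact (hrq hx.1 hx.2).le)
      ((convex_Icc 0 T).inter (convex_ball s r)) ⟨hs, Metric.mem_ball_self hr⟩ ⟨hy, hyr⟩
    rw [show F k y - F k s - (y - s) • q s = F k y - y • q s - (F k s - s • q s) by
      rw [sub_smul]; abel]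
    exact h
  have h1 : Tendsto (fun k => ‖F k y - F k s - (y - s) • q s‖) atTop
      (𝓝 ‖f y - f s - (y - s) • q s‖) := (((hlim y hy).sub (hlim s hs)).sub_const _).norm
  have h2 : Tendsto (fun k => (δ k + c) * ‖y - s‖) atTop (𝓝 ((0 + c) * ‖y - s‖)) :=
    (hδ.add_const c).mul_const _
  rw [zero_add] at h2
  exact le_of_tendsto_of_tendsto' h1 h2 hk

/-- Fatou's lemma for weighted norms of sequences converging in `L¹`. -/
lemma lintegral_enorm_mul_le_of_tendsto {F : ℕ → L1} {f : L1} (h : Tendsto F atTop (𝓝 f))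
    {W : Mom → ℝ} (hW : Measurable W) {A : ℝ≥0∞}
    (hF : ∀ᶠ n in atTop, ∫⁻ p, ‖F n p‖ₑ * ENNReal.ofReal (W p) ≤ A) :
    ∫⁻ p, ‖f p‖ₑ * ENNReal.ofReal (W p) ≤ A := by
  obtain ⟨ns, hns, hlim⟩ := exists_subseq_tendsto_ae h
  have h1 : ∫⁻ p, ‖f p‖ₑ * ENNReal.ofReal (W p)
      ≤ ∫⁻ p, liminf (fun n => ‖F (ns n) p‖ₑ * ENNReal.ofReal (W p)) atTop := by
    refine lintegral_mono_ae ?_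
    filter_upwards [hlim] with p hp
    have h2 := ENNReal.Tendsto.mul_const (b := ENNReal.ofReal (W p)) ((continuous_enorm.tendsto _).comp hp)
      (Or.inr ENNReal.ofReal_ne_top)
    exact h2.liminf_eq.ge
  refine h1.trans ((lintegral_liminf_le fun n => ?_).trans ?_)
  · have := measurable_L1 (F (ns n))
    fun_prop
  · exact liminf_le_of_frequently_le' ((hns.tendsto_atTop.eventually hF).frequently)

lemma norm_sub_le_of_weightedDist_le {f g : L1} {d : ℝ} (hd : 0 ≤ d)
    (h : weightedDist f g ≤ ENNReal.ofReal d) : ‖f - g‖ ≤ d := by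
  rw [← ENNReal.ofReal_le_ofReal_iff hd, ← enorm_L1]
  rw [weightedDist_eq_sub] at h
  refine le_trans (lintegral_mono fun p => ?_) h
  refine le_mul_of_one_le_right zero_le ?_
  rw [← ENNReal.ofReal_one]
  exact ENNReal.ofReal_le_ofReal (one_le_wt p)

lemma weightedDist_le_of_tendsto {F : ℕ → L1} {f g : L1} (h : Tendsto F atTop (𝓝 f)) {A : ℝ≥0∞}
    (hF : ∀ᶠ n in atTop, weightedDist g (F n) ≤ A) : weightedDist g f ≤ A := by
  simp only [weightedDist_eq_sub] at hF ⊢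
  exact lintegral_enorm_mul_le_of_tendsto (tendsto_const_nhds.sub h) measurable_wt hF

lemma integrable_collisionOp (C₁ : ℝ) {ε : ℝ} {f : Mom → ℝ} (hf : Measurable f)
    (h : ∫⁻ z, ENNReal.ofReal (kernel b ε z.1 z.2.1) * (‖f z.1‖ₑ * ‖f z.2.1‖ₑ) ∂tripleMeasure < ∞) :
    Integrable (collisionOp C₁ b ε f) :=
  (integrable_collisionIntegrand hf hf h).integral_prod_left.const_mul C₁

/-- Continuity of the collision operator with respect to the weighted distance and the cut-off. -/
theorem exists_norm_collisionOp_sub_le {b' : ℝ} (hb₁ : 1 < b) (hb₂ : b < 2) (hb'₁ : 1 < b')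
    (hb'₂ : b' < 2) {C₁ : ℝ} (hC₁ : 0 < C₁) :
    ∃ C : ℝ, 0 < C ∧ ∀ {ε ε' R A d : ℝ} {f g u v : L1}, 0 ≤ f → 0 ≤ R → 0 ≤ A → 0 ≤ d →
      (∀ p q, |kernel b ε p q - kernel b ε' p q| ≤ R * kernel b' 0 p q) →
      ∫⁻ p, ‖f p‖ₑ * ENNReal.ofReal (wtSq p) ≤ ENNReal.ofReal A →
      ∫⁻ p, ‖g p‖ₑ * ENNReal.ofReal (wtSq p) ≤ ENNReal.ofReal A →
      weightedDist f g ≤ ENNReal.ofReal d →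
      (∀ᵐ p, u p = collisionOp C₁ b ε f p) → (∀ᵐ p, v p = collisionOp C₁ b ε' g p) →
      ‖u - v‖ ≤ C * A * d + C * R * A ^ 2 + C * A * d := by
  obtain ⟨C, hC, h⟩ := exists_collisionOp_sub_le hb₁ hb₂ hb'₁ hb'₂ hC₁
  refine ⟨C, hC, fun {ε ε' R A d f g u v} hf0 hR hA hd hker hf hg hfg hu hv => ?_⟩
  -- No sign helps here: the dissipative term is estimated as well, in unweighted `L¹`, and yields
  -- the last summand of the bound.
  obtain ⟨Λ, r, hΛ, -, h2, h3, h4⟩ := h hf0 hR hA hker hf hg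
  rw [← weightedDist_eq] at h3 h4
  have h5 := h3.trans (add_le_add_left (mul_le_mul_right hfg _) _)
  have h6 := h4.trans (mul_le_mul_right hfg _)
  rw [← ENNReal.ofReal_mul (by positivity)] at h5 h6
  rw [← ENNReal.ofReal_add (by positivity) (by positivity)] at h5
  rw [← ENNReal.ofReal_le_ofReal_iff (by positivity), ← enorm_L1]
  rw [ENNReal.ofReal_add (by positivity) (by positivity)]
  have hfm := measurable_L1 f
  have hgm := measurable_L1 g
  calc ∫⁻ p, ‖(u - v : L1) p‖ₑ ≤ ∫⁻ p, (‖r p‖ₑ * ENNReal.ofReal (wt p) + ‖Λ p * (f p - g p)‖ₑ) := by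
        refine lintegral_mono_ae ?_
        filter_upwards [hu, hv, h2, Lp.coeFn_sub u v] with p e1 e2 e3 e4
        rw [e4, Pi.sub_apply, e1, e2, e3]
        refine enorm_sub_le.trans (add_le_add_left (le_mul_of_one_le_right zero_le ?_) _)
        rw [← ENNReal.ofReal_one]
        exact ENNReal.ofReal_le_ofReal (one_le_wt p)
    _ ≤ _ := by
        rw [lintegral_add_right _ (by fun_prop)]
        exact add_le_add h5 h6

end

end MasslessBoltzmann

/-! ### Removal of the cut-off -/

namespace MasslessBoltzmann

noncomputable section

variable {b : ℝ}

/-- Solutions with cut-off converge to a solution without cut-off. -/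
theorem exists_isSolution_of_cutoff (hb₁ : 1 < b) (hb₂ : b < 2) {C₁ T A : ℝ} (hC₁ : 0 < C₁)
    (hT : 0 < T) (hA : 0 < A) {f₀ : L1} {ε : ℕ → ℝ} (hε0 : ∀ k, 0 < ε k) (hεa : Antitone ε)
    (hεlim : Tendsto ε atTop (𝓝 0)) {F : ℕ → ℝ → L1}
    (hF : ∀ k, IsSolution C₁ b (ε k) (Icc 0 T) f₀ (F k))
    (hFA : ∀ k, ∀ s ∈ Icc 0 T, ∫⁻ p, ‖F k s p‖ₑ * ENNReal.ofReal (wtSq p) ≤ ENNReal.ofReal A) :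
    ∃ f : ℝ → L1, IsSolution C₁ b 0 (Icc 0 T) f₀ f ∧
      (∀ s ∈ Icc 0 T, ∫⁻ p, ‖f s p‖ₑ * ENNReal.ofReal (wtSq p) ≤ ENNReal.ofReal A) ∧
      ∃ d : ℕ → ℝ, Tendsto d atTop (𝓝 0) ∧
        ∀ k, ∀ s ∈ Icc 0 T, weightedDist (F k s) (f s) ≤ ENNReal.ofReal (d k) := by
  -- Half of the distance to `2`, so that `b + ζ` is still an admissible exponent.
  set ζ := (2 - b) / 2 with hζ
  have hζ0 : 0 < ζ := by rw [hζ]; linarith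
  have hb' : b + ζ < 2 := by rw [hζ]; linarith
  have hb'₁ : 1 < b + ζ := by linarith
  have hker : ∀ {k l}, k ≤ l → ∀ p q, |kernel b (ε k) p q - kernel b (ε l) p q|
      ≤ ε k ^ ζ * kernel (b + ζ) 0 p q := fun {k l} hkl p q =>
    abs_kernel_sub_le hζ0 hb' le_rfl (hεa hkl) (hε0 k).le p q
  have hker0 : ∀ k, ∀ p q, |kernel b (ε k) p q - kernel b 0 p q|
      ≤ ε k ^ ζ * kernel (b + ζ) 0 p q := fun k p q =>
    abs_kernel_sub_le hζ0 hb' le_rfl (hε0 k).le (hε0 k).le p q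
  have hR : ∀ k, 0 ≤ ε k ^ ζ := fun k => Real.rpow_nonneg (hε0 k).le _
  have hRlim : Tendsto (fun k => ε k ^ ζ) atTop (𝓝 0) := by
    have := hεlim.rpow_const (p := ζ) (Or.inr hζ0.le)
    rwa [Real.zero_rpow hζ0.ne'] at this
  obtain ⟨C, hC, hstab⟩ := exists_weightedDist_le hb₁ hb₂ hb'₁ hb' hC₁
  set d : ℕ → ℝ := fun k => 2 * (C * ε k ^ ζ * A ^ 2) * T * Real.exp (2 * (C * A) * T) with hd
  have hd0 : ∀ k, 0 ≤ d k := fun k => by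
    have := hR k
    simp only [hd]; positivity
  have hdlim : Tendsto d atTop (𝓝 0) := by
    have := (hRlim.const_mul C).mul_const (A ^ 2)
    have := ((this.const_mul 2).mul_const T).mul_const (Real.exp (2 * (C * A) * T))
    simpa using this
  have hdist : ∀ {k l}, k ≤ l → ∀ s ∈ Icc 0 T, weightedDist (F k s) (F l s) ≤ ENNReal.ofReal (d k) :=
    fun {k l} hkl => hstab (hR k) hA (hker hkl) (hF k) (hF l) (hFA k) (hFA l)
  -- The value outside of `[0, T]` is irrelevant; the implication lets the limit be chosen as a
  -- function on all of `ℝ`.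
  have hlim : ∀ s, ∃ g : L1, s ∈ Icc 0 T → Tendsto (fun k => F k s) atTop (𝓝 g) := fun s => by
    by_cases hs : s ∈ Icc 0 T
    · obtain ⟨g, hg⟩ := cauchySeq_tendsto_of_complete (cauchySeq_of_le_tendsto_0' (s := fun k => F k s) d
        (fun k l hkl => by
          rw [dist_eq_norm]
          exact norm_sub_le_of_weightedDist_le (hd0 k) (hdist hkl s hs)) hdlim)
      exact ⟨g, fun _ => hg⟩
    · exact ⟨0, fun h => absurd h hs⟩
  choose f hf using hlim
  have hfA : ∀ s ∈ Icc 0 T, ∫⁻ p, ‖f s p‖ₑ * ENNReal.ofReal (wtSq p) ≤ ENNReal.ofReal A :=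
    fun s hs => lintegral_enorm_mul_le_of_tendsto (hf s hs) measurable_wtSq
      (Eventually.of_forall fun k => hFA k s hs)
  have hFf : ∀ k, ∀ s ∈ Icc 0 T, weightedDist (F k s) (f s) ≤ ENNReal.ofReal (d k) := fun k s hs =>
    weightedDist_le_of_tendsto (hf s hs) ((eventually_ge_atTop k).mono fun l hl => hdist hl s hs)
  have hf0 : ∀ s ∈ Icc 0 T, 0 ≤ f s := fun s hs =>
    ge_of_tendsto' (hf s hs) fun k => (hF k).nonneg s hs
  have hfin : ∀ s ∈ Icc 0 T, ∫⁻ z, ENNReal.ofReal (kernel b 0 z.1 z.2.1) *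
      (‖f s z.1‖ₑ * ‖f s z.2.1‖ₑ) ∂tripleMeasure < ∞ := fun s hs =>
    lintegral_kernel_lt_top_of_moment hb₁ hb₂ 0 (hfA s hs) (hfA s hs)
  have hq : ∀ s, ∃ q : L1, s ∈ Icc 0 T → ∀ᵐ p, q p = collisionOp C₁ b 0 (f s) p := fun s => by
    by_cases hs : s ∈ Icc 0 T
    · have h := integrable_collisionOp C₁ (measurable_L1 (f s)) (hfin s hs)
      exact ⟨h.toL1 _, fun _ => h.coeFn_toL1⟩
    · exact ⟨0, fun h => absurd h hs⟩
  choose q hq using hq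
  obtain ⟨K, hK, hcont⟩ := exists_norm_collisionOp_sub_le hb₁ hb₂ hb'₁ hb' hC₁
  have hδlim : Tendsto (fun k => K * A * d k + K * ε k ^ ζ * A ^ 2 + K * A * d k) atTop (𝓝 0) := by
    have h1 := hdlim.const_mul (K * A)
    have h2 := (hRlim.const_mul K).mul_const (A ^ 2)
    simpa using (h1.add h2).add h1
  -- The time derivatives of `F k` converge to the collision operator of the limit, uniformly in
  -- `s`.
  obtain ⟨hqc, hqd⟩ := hasDerivWithinAt_of_norm_deriv_sub_le (F := F)
    (v := fun k => derivWithin (F k) (Icc 0 T)) (f := f) (q := q) (T := T)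
    (fun k s hs => (hF k).hasDerivWithinAt hs)
    (fun k => ((contDiffOn_one_iff_derivWithin (uniqueDiffOn_Icc hT)).1 (hF k).contDiffOn).2)
    hf hδlim
    (fun k s hs => hcont ((hF k).nonneg s hs) (hR k) hA.le (hd0 k) (hker0 k) (hFA k s hs) (hfA s hs)
      (hFf k s hs) ((hF k).equation s hs) (hq s hs))
  have hder : ∀ s ∈ Icc 0 T, derivWithin f (Icc 0 T) s = q s := fun s hs =>
    (hqd s hs).derivWithin (uniqueDiffOn_Icc hT s hs)
  refine ⟨f, ⟨?_, ?_, hf0, ?_, fun s hs => ?_, fun s hs => ?_, fun s hs => ?_⟩, hfA, d, hdlim, hFf⟩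
  · rw [contDiffOn_one_iff_derivWithin (uniqueDiffOn_Icc hT)]
    exact ⟨fun s hs => (hqd s hs).differentiableWithinAt, hqc.congr hder⟩
  · refine tendsto_nhds_unique (hf 0 (left_mem_Icc.2 hT.le)) ?_
    simp only [(hF _).initial]
    exact tendsto_const_nhds
  · exact fun s hs => IsIsotropic.of_tendsto (hf s hs) fun k => (hF k).isotropic s hs
  · exact (integrable_gain_triple (measurable_L1 (f s)) (measurable_L1 (f s)) (hfin s hs)).prod_right_ae
  · exact (integrable_loss_triple (measurable_L1 (f s)) (measurable_L1 (f s)) (hfin s hs)).prod_right_ae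
  · rw [hder s hs]
    exact hq s hs

lemma rpow_le_wtSq_add_sq {m : ℝ} (hm : m ∈ Icc (-2 : ℝ) 2) (p : Mom) :
    ‖p‖ ^ m ≤ wtSq p + ‖p‖ ^ 2 := by
  have h0 : 0 ≤ ‖p‖ ^ 2 := by positivity
  rcases le_total m 0 with h | h
  · have := rpow_neg_le_wtSq (s := -m) (by linarith) (by linarith [hm.1]) p
    rw [neg_neg] at this
    linarith
  · have h1 := one_le_wtSq p
    rcases le_total ‖p‖ 1 with h2 | h2
    · linarith [Real.rpow_le_one (norm_nonneg p) h2 h]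
    · have := Real.rpow_le_rpow_of_exponent_le h2 hm.2
      rw [Real.rpow_two] at this
      linarith

/-- Moments of intermediate order. -/
lemma integrable_mul_rpow {f : L1} (hf : 0 ≤ f) {A B : ℝ}
    (hA : ∫⁻ p, ‖f p‖ₑ * ENNReal.ofReal (wtSq p) ≤ ENNReal.ofReal A)
    (hB : ∫⁻ p, ‖f p‖ₑ * ENNReal.ofReal (‖p‖ ^ 2) ≤ ENNReal.ofReal B) {m : ℝ}
    (hm : m ∈ Icc (-2 : ℝ) 2) :
    Integrable (fun p : Mom => f p * ‖p‖ ^ m) ∧ ∫ p, f p * ‖p‖ ^ m ≤ max A 0 + max B 0 := by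
  have hfm := measurable_L1 f
  -- `A` and `B` may be negative here, in which case `ENNReal.ofReal` reads them as zero.
  have hA0 := le_max_right A 0
  have hB0 := le_max_right B 0
  have h1 : ∫⁻ p, ‖f p‖ₑ * ENNReal.ofReal (‖p‖ ^ m) ≤ ENNReal.ofReal (max A 0 + max B 0) := by
    rw [ENNReal.ofReal_add hA0 hB0]
    calc _ ≤ ∫⁻ p, (‖f p‖ₑ * ENNReal.ofReal (wtSq p) + ‖f p‖ₑ * ENNReal.ofReal (‖p‖ ^ 2)) := by
          refine lintegral_mono fun p => ?_
          rw [← mul_add, ← ENNReal.ofReal_add (zero_le_one.trans (one_le_wtSq p)) (by positivity)]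
          exact mul_le_mul_right (ENNReal.ofReal_le_ofReal (rpow_le_wtSq_add_sq hm p)) _
      _ ≤ _ := by
          rw [lintegral_add_left (by fun_prop)]
          exact add_le_add (hA.trans (ENNReal.ofReal_le_ofReal (le_max_left _ _)))
            (hB.trans (ENNReal.ofReal_le_ofReal (le_max_left _ _)))
  refine ⟨⟨(by fun_prop : Measurable _).aestronglyMeasurable, ?_⟩, ?_⟩
  · rw [hasFiniteIntegral_iff_enorm]
    refine lt_of_le_of_lt (le_of_eq (lintegral_congr fun p => ?_)) (h1.trans_lt ENNReal.ofReal_lt_top)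
    rw [enorm_mul, Real.enorm_of_nonneg (Real.rpow_nonneg (norm_nonneg p) m)]
  · rw [integral_mul_eq_toReal hf (by fun_prop) fun p => by positivity]
    exact ENNReal.toReal_le_of_le_ofReal (by positivity) h1

lemma lintegral_moment_lt_top {f : L1} {m : ℝ} (h : Integrable (fun p : Mom => f p * ‖p‖ ^ m)) :
    ∫⁻ p, ‖f p‖ₑ * ENNReal.ofReal (‖p‖ ^ m) < ∞ := by
  have h2 := h.hasFiniteIntegral
  rw [hasFiniteIntegral_iff_enorm] at h2
  refine lt_of_le_of_lt (le_of_eq (lintegral_congr fun p => ?_)) h2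
  rw [enorm_mul, Real.enorm_of_nonneg (Real.rpow_nonneg (norm_nonneg p) m)]

end

end MasslessBoltzmann

theorem theorem1 (C₁ b : ℝ) (hC₁ : 0 < C₁) (hb₁ : 1 < b) (hb₂ : b < 2)
    (f₀ : MasslessBoltzmann.L1) (hf₀ : 0 ≤ f₀) (hiso : MasslessBoltzmann.IsIsotropic f₀)
    (hmom : ∀ m ∈ Icc (-2 : ℝ) 2,
      Integrable (fun p : MasslessBoltzmann.Mom => f₀ p * ‖p‖ ^ m) volume) :
    ∃ T : ℝ, 0 < T ∧ ∃ f : ℝ → MasslessBoltzmann.L1,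
      -- `f` is a nonnegative solution in `C¹([0,T]; L¹)` with data `f₀` at `s = 0`
      MasslessBoltzmann.IsSolution C₁ b 0 (Icc 0 T) f₀ f ∧
      -- it is the only one
      (∀ g : ℝ → MasslessBoltzmann.L1,
        MasslessBoltzmann.IsSolution C₁ b 0 (Icc 0 T) f₀ g → EqOn g f (Icc 0 T)) ∧
      -- its moments are bounded uniformly on `[0,T]`
      (∃ C : ℝ, ∀ m ∈ Icc (-1 : ℝ) 2, ∀ s ∈ Icc (0 : ℝ) T,
        Integrable (fun p : MasslessBoltzmann.Mom => f s p * ‖p‖ ^ m) volume ∧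
          ∫ p : MasslessBoltzmann.Mom, f s p * ‖p‖ ^ m ≤ C) ∧
      -- it is the limit of the (global, unique) solutions of the equations with cut-off
      (∃ F : ℕ → ℝ → MasslessBoltzmann.L1,
        (∀ k : ℕ, MasslessBoltzmann.IsSolution C₁ b (1 / ((k : ℝ) + 1)) (Ici 0) f₀ (F k)) ∧
        (∀ (k : ℕ) (G : ℝ → MasslessBoltzmann.L1),
          MasslessBoltzmann.IsSolution C₁ b (1 / ((k : ℝ) + 1)) (Icc 0 T) f₀ G →
            EqOn G (F k) (Icc 0 T)) ∧
        Tendsto (fun k : ℕ => ⨆ s ∈ Icc (0 : ℝ) T, MasslessBoltzmann.weightedDist (F k s) (f s))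
          atTop (𝓝 0)) := by
  have hinv := MasslessBoltzmann.lintegral_moment_lt_top (hmom (-2) (by norm_num))
  have hsq := MasslessBoltzmann.lintegral_moment_lt_top (hmom 2 (by norm_num))
  have hfin : ∫⁻ p, ‖f₀ p‖ₑ * ENNReal.ofReal (MasslessBoltzmann.wtSq p) < ∞ := by
    have h : ∀ p, ‖f₀ p‖ₑ * ENNReal.ofReal (MasslessBoltzmann.wtSq p)
        = ‖f₀ p‖ₑ + ‖f₀ p‖ₑ * ENNReal.ofReal (‖p‖ ^ (-2 : ℝ)) := fun p => by
      rw [Real.rpow_neg (norm_nonneg p), Real.rpow_two, MasslessBoltzmann.wtSq,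
        ENNReal.ofReal_add zero_le_one (by positivity), ENNReal.ofReal_one, mul_add, mul_one, one_div]
    simp only [h]
    rw [lintegral_add_left (MasslessBoltzmann.measurable_L1 f₀).enorm]
    exact ENNReal.add_lt_top.2 ⟨(MasslessBoltzmann.lintegral_enorm_ne_top f₀).lt_top, hinv⟩
  set Y := (∫⁻ p, ‖f₀ p‖ₑ * ENNReal.ofReal (MasslessBoltzmann.wtSq p)).toReal with hY
  have hY0 : 0 ≤ Y := ENNReal.toReal_nonneg
  have hf₀Y : ∫⁻ p, ‖f₀ p‖ₑ * ENNReal.ofReal (MasslessBoltzmann.wtSq p) ≤ ENNReal.ofReal Y :=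
    ENNReal.le_ofReal_iff_toReal_le hfin.ne hY0 |>.2 le_rfl
  obtain ⟨C, hC, hbound⟩ := MasslessBoltzmann.exists_moment_bound hb₁ hb₂ hC₁
  -- The longest time allowed by `exists_moment_bound`. It depends on the data only through `Y` and
  -- is the same for all cut-offs.
  set T := 1 / (2 * (C * (1 + Y))) with hT
  have hT0 : 0 < T := by positivity
  have hCT : C * (1 + Y) * T ≤ 1 / 2 := by
    rw [hT]
    refine le_of_eq ?_
    field_simp
  set A := 2 * (1 + Y) with hA
  have hA0 : 0 < A := by positivity
  have hε : ∀ k : ℕ, 0 < 1 / ((k : ℝ) + 1) := fun k => by positivity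
  have hex : ∀ k : ℕ, ∃ F : ℝ → MasslessBoltzmann.L1,
      MasslessBoltzmann.IsSolution C₁ b (1 / ((k : ℝ) + 1)) (Ici 0) f₀ F := fun k =>
    MasslessBoltzmann.exists_isSolution_cutoff hb₁ hb₂ hC₁ (hε k) hf₀ hiso
  choose F hF using hex
  have hF' := fun k => (hF k).restrict hT0
  have hFA := fun k => hbound (hε k).le (hF' k) hY0 hf₀Y hCT
  obtain ⟨f, hf, hfA, d, hd, hdist⟩ := MasslessBoltzmann.exists_isSolution_of_cutoff hb₁ hb₂ hC₁ hT0 hA0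
    (ε := fun k : ℕ => 1 / ((k : ℝ) + 1)) hε (fun k l hkl => Nat.one_div_le_one_div hkl)
    tendsto_one_div_add_atTop_nhds_zero_nat hF' hFA
  refine ⟨T, hT0, f, hf, fun g hg => ?_, ?_, F, hF, fun k G hG => ?_, ?_⟩
  -- The competitor needs no assumption on its moments: the a priori bound with `ε = 0` applies to
  -- every solution with these data.
  · exact hg.eqOn_of_moment hb₁ hb₂ hC₁ hA0 hf (hbound le_rfl hg hY0 hf₀Y hCT) hfA
  · obtain ⟨B, hB⟩ := MasslessBoltzmann.exists_moment_two_bound hb₁ hb₂ hC₁ le_rfl hf hA0.le hfA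
      (by simpa only [Real.rpow_two] using hsq.ne)
    exact ⟨max A 0 + max B 0, fun m hm s hs => MasslessBoltzmann.integrable_mul_rpow (hf.nonneg s hs)
      (hfA s hs) (hB s hs) ⟨by linarith [hm.1], hm.2⟩⟩
  · exact hG.eqOn_of_moment hb₁ hb₂ hC₁ hA0 (hF' k) (hbound (hε k).le hG hY0 hf₀Y hCT) (hFA k)
  · refine tendsto_of_tendsto_of_tendsto_of_le_of_le tendsto_const_nhds ?_ (fun _ => zero_le)
      (fun k => iSup₂_le (hdist k))
    have h := (ENNReal.continuous_ofReal.tendsto 0).comp hd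
    rwa [ENNReal.ofReal_zero] at h
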